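/- Let $m$ be a square-free positive integer such that $K=\mathbb{Q}(\sqrt{-m})$ has class number $1$, let $\mathcal{O}_K=\mathbb{Z}+\mathbb{Z}\omega$ with $\omega=\frac{1+\sqrt{-m}}{2}$ if $m\equiv 3 \pmod 4$ and $\omega=\sqrt{-m}$ otherwise, and let $\ell\ge 1$ be an integer and $\mathcal{P}$ a finite set of primes. *Quadratic space.* Put $S=\begin{pmatrix}2&1\\1&(m+1)/2\end{pmatrix}$ if $m\equiv 3\pmod 4$ and $S=\mathrm{diag}(2,2m)$ otherwise, $S_0=\begin{pmatrix}0&0&1\\0&-S&0\\1&0&0\end{pmatrix}$, $\phi_0(x,y)=\frac12x^tS_0y$ on $\mathbb{Q}^4$ and $L_0=\mathbb{Z}^4$. Let $q$ be the level of $S$, i.e. the least positive integer with $\frac q2\,x^tSx\in\mathbb{Z}$ for all $x\in S^{-1}\mathbb{Z}^2$, and $D=-\ell q$. Let $\widehat\Gamma^+(L_0)$ be the group of $g\in \mathrm{SL}_4(\mathbb{Q})$ with $g^tS_0g=S_0$, $gL_0=L_0$ and $g\in 1_4+\mathrm{M}_4(\mathbb{Z})S_0$ that lie in the identity component of the special orthogonal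 group of $S_0$ over $\mathbb{R}$. *Zeta functions.* Let $\xi\in\mathbb{Q}^4$ satisfy $\phi_0(\xi,\xi)=\ell$, $\phi_0(\xi,L_0)=\frac12\mathbb{Z}$ and $\xi_1>0$ (for instance, $\xi$ may be any member $\xi_i$ of a system of representatives of the classes of such vectors). For $d\ge 1$ let $n(\xi;d)$ be the number of $s\in\mathbb{Z}^2/dS\mathbb{Z}^2$ such that, writing $S^{-1}[s]=s^tS^{-1}s$, one has $D\equiv\frac12qS^{-1}[s]\pmod{qd}$ and $\left(\frac{\frac12qS^{-1}[s]-D}{qd},\,S^{-1}s,\,d\right)^t=\gamma\xi$ for some $\gamma\in\widehat\Gamma^+(L_0)$. Put $$\zeta_{\xi,\mathcal{P}}(s)=\sum_{\substack{N\ge1\\(N,p)=1\ \forall p\in\mathcal{P}}}n(\xi;N)N^{-s},\qquad \hat\zeta_{\xi,\mathcal{P}}(s)=\zeta_{K,\mathcal{P}}(s)\,\zeta_{\xi,\mathcal{P}}(s),$$ where $\zeta_{K,\mathcal{P}}$ is the Dedekind zeta function of $K$ with the Euler factors above the primes in $\mathcal{P}$ removed. *Ideals.* Let $B=K+\varepsilon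 K$ be the quaternion algebra with $\varepsilon^2=-\ell$ and $\varepsilon a=\bar a\varepsilon$ for $a\in K$, with main involution $\alpha\mapsto\bar\alpha$ and reduced norm $\mathrm{nrd}(\alpha)=\alpha\bar\alpha$, and let $\mathfrak{o}=\mathcal{O}_K+\varepsilon\mathcal{O}_K$. A proper basis of a left ideal $U\subseteq\mathfrak{o}$ is a pair $\omega_i=g_{i1}+\varepsilon\,\overline{g_{i2}}$ $(i=1,2)$ with $U=\mathcal{O}_K\omega_1+\mathcal{O}_K\omega_2$ such that $\det(g_{ij})$ is a positive integer; this integer is the norm $N(U)$ and does not depend on the proper basis. For a right ideal $I\subseteq\mathfrak{o}$ put $N(I)=N(\bar I)$, where $\bar I=\{\bar a\mid a\in I\}$. To $\xi=(x,y,z,w)^t$ attach the Hermitian matrix $f=\begin{pmatrix}a&b\\ \bar b&c\end{pmatrix}=\begin{pmatrix}x&y+\omega z\\ y+\bar\omega z&w\end{pmatrix}$ and the form $f(u,v)=(u,v)f(\bar u,\bar v)^t$. Let $U\subseteq\mathfrak{o}$ be a left ideal corresponding to $f$ under Latimer's correspondence, in either of the following senses: (i) $U$ has a proper basis $\omega_1,\omega_2$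 with $\mathrm{nrd}(u\omega_1+v\omega_2)=N(U)f(u,v)$ for all $u,v\in\mathcal{O}_K$; or (ii) $U=(\mathcal{O}_Ka+\mathcal{O}_K(b+\varepsilon))\alpha$ for some $\alpha\in B^\times$. *Conclusion.* Let $[\bar U]$ be the set of right ideals $I\subseteq\mathfrak{o}$ of the form $I=\alpha\bar U$ with $\alpha\in B^\times$. For every $I\in[\bar U]$ whose norm $N(I)$ is not divisible by any prime in $\mathcal{P}$, $N(I)$ is a positive integer, and it generates the $\mathbb{Z}$-submodule of $\mathbb{Q}$ generated by $\{\mathrm{nrd}(\alpha)\mid\alpha\in I\}$. For every $s\in\mathbb{C}$ with $\mathrm{Re}(s)>2$ the series $\zeta_{\xi,\mathcal{P}}(s)$ and the series below converge absolutely, and $$\hat\zeta_{\xi,\mathcal{P}}(s)=\sum_{\substack{I\in[\bar U]\\ p\,\nmid\, N(I)\ \forall p\in\mathcal{P}}}N(I)^{-s}.$$ -/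

import Mathlib

open scoped NumberField Matrix

namespace HermZeta

noncomputable section

/-! ### The lattice `L = ℤ²`, the quadratic space `(V₀, φ₀)` and its integral groups -/

/-- The even positive definite matrix `S` attached to a square-free positive integer `m`. -/
def matS (m : ℕ) : Matrix (Fin 2) (Fin 2) ℤ :=
  if m % 4 = 3 then !![2, 1; 1, ((m : ℤ) + 1) / 2] else !![2, 0; 0, 2 * (m : ℤ)]

/-- `S` with rational entries. -/
def matSQ (m : ℕ) : Matrix (Fin 2) (Fin 2) ℚ := (matS m).map (Int.cast : ℤ → ℚ)

/-- `S₀ = ( 0 0 1 ; 0 -S 0 ; 1 0 0 )`. -/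
def matS0 (m : ℕ) : Matrix (Fin 4) (Fin 4) ℤ :=
  !![0, 0, 0, 1;
     0, -matS m 0 0, -matS m 0 1, 0;
     0, -matS m 1 0, -matS m 1 1, 0;
     1, 0, 0, 0]

/-- The bilinear form `φ₀(x, y) = ½ xᵗ S₀ y` on `V₀ = ℚ⁴`. -/
def phi0 (m : ℕ) (x y : Fin 4 → ℚ) : ℚ :=
  (x ⬝ᵥ ((matS0 m).map (Int.cast : ℤ → ℚ) *ᵥ y)) / 2

/-- `L₀ = ℤ⁴` inside `V₀ = ℚ⁴`. -/
def latL0 : Set (Fin 4 → ℚ) := Set.range fun (v : Fin 4 → ℤ) i => (v i : ℚ)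

/-- `L₀[ℓ, 2⁻¹ℤ] = {x ∈ V₀ | φ₀(x, x) = ℓ and φ₀(x, L₀) = 2⁻¹ℤ}`. -/
def primitiveVectors (m ℓ : ℕ) : Set (Fin 4 → ℚ) :=
  {x | phi0 m x x = ℓ ∧ (phi0 m x '' latL0) = Set.range fun k : ℤ => (k : ℚ) / 2}

/-- The rational points of the positive cone: `x₁ > 0` and `φ₀(x, x) > 0`. -/
def cone (m : ℕ) : Set (Fin 4 → ℚ) := {x | 0 < x 0 ∧ 0 < phi0 m x x}

/-- The special orthogonal group of `φ₀` over `ℝ`, as a subspace of the space of matrices. -/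
def realSO (m : ℕ) : Set (Matrix (Fin 4) (Fin 4) ℝ) :=
  {g | g.det = 1 ∧
    gᵀ * (matS0 m).map (Int.cast : ℤ → ℝ) * g = (matS0 m).map (Int.cast : ℤ → ℝ)}

/-- `Γ(L₀)`: the elements `g` of the rational special orthogonal group with `g L₀ = L₀`. -/
def gammaL0 (m : ℕ) : Set (Matrix (Fin 4) (Fin 4) ℚ) :=
  {g | g.det = 1 ∧
    gᵀ * (matS0 m).map (Int.cast : ℤ → ℚ) * g = (matS0 m).map (Int.cast : ℤ → ℚ) ∧
    (fun v => g *ᵥ v) '' latL0 = latL0}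

/-- The discriminant kernel: the elements of `Γ(L₀)` lying in `1 + M₄(ℤ) S₀`. -/
def discKernel (m : ℕ) : Set (Matrix (Fin 4) (Fin 4) ℚ) :=
  {g | g ∈ gammaL0 m ∧
    ∃ M : Matrix (Fin 4) (Fin 4) ℤ, g = 1 + (M * matS0 m).map (Int.cast : ℤ → ℚ)}

/-- The elements of the discriminant kernel lying in the identity component of the real special
orthogonal group. -/
def discKernelPlus (m : ℕ) : Set (Matrix (Fin 4) (Fin 4) ℚ) :=
  {g | g ∈ discKernel m ∧
    g.map (Rat.cast : ℚ → ℝ) ∈ connectedComponentIn (realSO m) 1}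

/-- The dual lattice of `L = ℤ²`: the `x ∈ ℚ²` with `2φ(x, y) = -xᵗSy ∈ ℤ` for all `y ∈ ℤ²`. -/
def dualL (m : ℕ) : Set (Fin 2 → ℚ) :=
  {x | ∀ y : Fin 2 → ℤ, ∃ k : ℤ, x ⬝ᵥ (matSQ m *ᵥ fun i => (y i : ℚ)) = k}

/-- The level of `L`: the least positive integer `q` with `q φ[x] ∈ ℤ` for all `x` in the dual
lattice. -/
def level (m : ℕ) : ℕ :=
  sInf {q : ℕ | 0 < q ∧ ∀ x ∈ dualL m, ∃ k : ℤ, (q : ℚ) * (-(x ⬝ᵥ (matSQ m *ᵥ x)) / 2) = k}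

/-- `½ q S⁻¹[s]` for `s ∈ ℤ²`, where `q` is the level. -/
def halfQSInv (m : ℕ) (s : Fin 2 → ℤ) : ℚ :=
  (level m : ℚ) * ((fun i => (s i : ℚ)) ⬝ᵥ ((matSQ m)⁻¹ *ᵥ fun i => (s i : ℚ))) / 2

/-- The vector `((½ q S⁻¹[s] - D)/(q d), S⁻¹ s, d)` with `D = -ℓ q`. -/
def repVector (m ℓ d : ℕ) (s : Fin 2 → ℤ) : Fin 4 → ℚ :=
  ![(halfQSInv m s - -((ℓ : ℚ) * level m)) / (level m * d),
    ((matSQ m)⁻¹ *ᵥ fun i => (s i : ℚ)) 0,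
    ((matSQ m)⁻¹ *ᵥ fun i => (s i : ℚ)) 1,
    d]

/-- The sublattice `d S ℤ²` of `ℤ²`. -/
def dSLattice (m d : ℕ) : Submodule ℤ (Fin 2 → ℤ) :=
  LinearMap.range (Matrix.mulVecLin ((d : ℤ) • matS m))

/-- `n(ξ; d)`: the number of classes `s ∈ ℤ²/dSℤ²` with `D ≡ ½ q S⁻¹[s] (mod q d)` such that
`((½ q S⁻¹[s] - D)/(q d), S⁻¹ s, d)` is equivalent to `ξ` under the connected discriminant kernel;
here `D = -ℓ q`. -/
def repCount (m ℓ : ℕ) (ξ : Fin 4 → ℚ) (d : ℕ) : ℕ :=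
  Set.ncard ((dSLattice m d).mkQ '' {s : Fin 2 → ℤ |
    (∃ k : ℤ, -((ℓ : ℚ) * level m) - halfQSInv m s = (level m * d : ℚ) * k) ∧
    ∃ γ ∈ discKernelPlus m, repVector m ℓ d s = γ *ᵥ ξ})

/-- The coefficients of `ζ_{ξ,𝒫}`: `n(ξ; N)` if `N` is prime to all `p ∈ 𝒫`, and `0` otherwise. -/
def zetaXiCoeff (m ℓ : ℕ) (P : Finset ℕ) (ξ : Fin 4 → ℚ) (N : ℕ) : ℂ :=
  open Classical in if ∀ p ∈ P, N.Coprime p then (repCount m ℓ ξ N : ℂ) else 0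

/-- `ζ_{ξ,𝒫}(s) = ∑ n(ξ; N) N^{-s}` over the `N ≥ 1` prime to all `p ∈ 𝒫`. -/
def zetaXi (m ℓ : ℕ) (P : Finset ℕ) (ξ : Fin 4 → ℚ) (s : ℂ) : ℂ :=
  LSeries (zetaXiCoeff m ℓ P ξ) s

/-! ### The imaginary quadratic field `K = ℚ(√-m)` -/

instance factNoRoot (m : ℕ) [NeZero m] : Fact (∀ r : ℚ, r ^ 2 ≠ -(m : ℚ) + 0 * r) :=
  ⟨fun r h => by
    have hm : (0 : ℚ) < m := by exact_mod_cast Nat.pos_of_ne_zero (NeZero.ne m)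
    nlinarith [sq_nonneg r]⟩

/-- `K = ℚ(√-m)`; the element `⟨x, y⟩` is `x + y √-m`, and `star` is complex conjugation. -/
abbrev K (m : ℕ) : Type := QuadraticAlgebra ℚ (-(m : ℚ)) 0

instance numberFieldK (m : ℕ) [NeZero m] : NumberField (K m) where
  to_charZero := inferInstance
  to_finiteDimensional := by
    have h : Module.Finite ℚ (K m) := inferInstance
    convert h

/-- The generator `ω` of `𝓞 K`: `(1 + √-m)/2` if `m ≡ 3 (mod 4)`, and `√-m` otherwise. -/
def omegaK (m : ℕ) : K m := if m % 4 = 3 then ⟨1 / 2, 1 / 2⟩ else ⟨0, 1⟩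

/-- `ζ_{K,𝒫}(s)`: the Dedekind zeta function of `K` with the Euler factors above the primes in `𝒫`
removed. -/
def zetaK (m : ℕ) [NeZero m] (P : Finset ℕ) (s : ℂ) : ℂ :=
  NumberField.dedekindZeta (K m) s *
    ∏ p ∈ P, ∏ 𝔭 ∈ IsDedekindDomain.primesOverFinset (Ideal.span {(p : ℤ)}) (𝓞 (K m)),
      (1 - (Ideal.absNorm 𝔭 : ℂ) ^ (-s))

/-- `ζ̂_{ξ,𝒫}(s) = ζ_{K,𝒫}(s) ζ_{ξ,𝒫}(s)`. -/
def zetaHat (m ℓ : ℕ) [NeZero m] (P : Finset ℕ) (ξ : Fin 4 → ℚ) (s : ℂ) : ℂ :=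
  zetaK m P s * zetaXi m ℓ P ξ s

/-- The Hermitian matrix `( x  y+ωz ; y+ω̄z  w )` attached to the vector `(x, y, z, w) ∈ V₀`. -/
def hermMatrix (m : ℕ) (ξ : Fin 4 → ℚ) : Matrix (Fin 2) (Fin 2) (K m) :=
  !![algebraMap ℚ (K m) (ξ 0), algebraMap ℚ (K m) (ξ 1) + omegaK m * algebraMap ℚ (K m) (ξ 2);
     algebraMap ℚ (K m) (ξ 1) + star (omegaK m) * algebraMap ℚ (K m) (ξ 2),
       algebraMap ℚ (K m) (ξ 3)]

/-- The binary Hermitian form `f(u, v) = (u, v) f (ū, v̄)ᵗ`. -/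
def hermForm (m : ℕ) (f : Matrix (Fin 2) (Fin 2) (K m)) (u v : K m) : K m :=
  ![u, v] ⬝ᵥ (f *ᵥ ![star u, star v])

/-! ### The quaternion algebra `B = K + εK` and the order `𝔬 = 𝓞 K + ε 𝓞 K` -/

/-- `B = K + εK` with `ε² = -ℓ` and `εa = āε` for `a ∈ K`: the quaternion algebra over `ℚ` with
`i² = -m`, `j² = -ℓ`, where `i = √-m ∈ K` and `j = ε`. Its standard involution is `star`. -/
abbrev B (m ℓ : ℕ) : Type := QuaternionAlgebra ℚ (-(m : ℚ)) 0 (-(ℓ : ℚ))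

/-- The embedding of `K` in `B`. -/
def incl (m ℓ : ℕ) (a : K m) : B m ℓ := ⟨a.re, a.im, 0, 0⟩

/-- The element `ε` of `B`. -/
def eps (m ℓ : ℕ) : B m ℓ := ⟨0, 0, 1, 0⟩

/-- The reduced norm `nrd α = α ᾱ` on `B`, as a rational number. -/
def nrd (m ℓ : ℕ) (α : B m ℓ) : ℚ := (α * star α).re

/-- `𝔬 = 𝓞 K + ε 𝓞 K`. -/
def orderO (m ℓ : ℕ) [NeZero m] : AddSubgroup (B m ℓ) where
  carrier := {x | ∃ a b : 𝓞 (K m), x = incl m ℓ a + eps m ℓ * incl m ℓ b}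
  zero_mem' := ⟨0, 0, by ext <;> simp [incl, eps]⟩
  add_mem' := by
    rintro _ _ ⟨a, b, rfl⟩ ⟨c, d, rfl⟩
    exact ⟨a + c, b + d, by ext <;> simp [incl, eps] <;> ring⟩
  neg_mem' := by
    rintro _ ⟨a, b, rfl⟩
    exact ⟨-a, -b, by ext <;> simp [incl, eps]⟩

/-- `𝓞 K ω₁ + 𝓞 K ω₂` for `ω₁, ω₂ ∈ B`. -/
def okSpan (m ℓ : ℕ) [NeZero m] (ω₁ ω₂ : B m ℓ) : AddSubgroup (B m ℓ) where
  carrier := {x | ∃ u v : 𝓞 (K m), x = incl m ℓ u * ω₁ + incl m ℓ v * ω₂}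
  zero_mem' := ⟨0, 0, by ext <;> simp [incl]⟩
  add_mem' := by
    rintro _ _ ⟨a, b, rfl⟩ ⟨c, d, rfl⟩
    exact ⟨a + c, b + d, by ext <;> simp [incl] <;> ring⟩
  neg_mem' := by
    rintro _ ⟨a, b, rfl⟩
    exact ⟨-a, -b, by ext <;> simp [incl] <;> ring⟩

/-- `I` is a left ideal in `𝔬`. -/
def IsLeftIdeal (m ℓ : ℕ) [NeZero m] (I : AddSubgroup (B m ℓ)) : Prop :=
  I ≤ orderO m ℓ ∧ ∀ x ∈ orderO m ℓ, ∀ y ∈ I, x * y ∈ I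

/-- `I` is a right ideal in `𝔬`. -/
def IsRightIdeal (m ℓ : ℕ) [NeZero m] (I : AddSubgroup (B m ℓ)) : Prop :=
  I ≤ orderO m ℓ ∧ ∀ x ∈ orderO m ℓ, ∀ y ∈ I, y * x ∈ I

/-- `I` and `J` are in the same left class: `J = Iα` for some `α ∈ Bˣ`. -/
def SameLeftClass (m ℓ : ℕ) (I J : AddSubgroup (B m ℓ)) : Prop :=
  ∃ α : (B m ℓ)ˣ, J = I.map (AddMonoidHom.mulRight (α : B m ℓ))

/-- `I` and `J` are in the same right class: `J = αI` for some `α ∈ Bˣ`. -/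
def SameRightClass (m ℓ : ℕ) (I J : AddSubgroup (B m ℓ)) : Prop :=
  ∃ α : (B m ℓ)ˣ, J = I.map (AddMonoidHom.mulLeft (α : B m ℓ))

/-- `Ī = {ā | a ∈ I}`. -/
def conjIdeal (m ℓ : ℕ) (I : AddSubgroup (B m ℓ)) : AddSubgroup (B m ℓ) :=
  I.map (starAddEquiv : B m ℓ ≃+ B m ℓ).toAddMonoidHom

/-- `g₁` for `b = g₁ + ε ḡ₂ = g₁ + g₂ ε` with `g₁, g₂ ∈ K`. -/
def coord₁ (m ℓ : ℕ) (b : B m ℓ) : K m := ⟨b.re, b.imI⟩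

/-- `g₂` for `b = g₁ + ε ḡ₂ = g₁ + g₂ ε` with `g₁, g₂ ∈ K`. -/
def coord₂ (m ℓ : ℕ) (b : B m ℓ) : K m := ⟨b.imJ, b.imK⟩

/-- The determinant `det (g_{ij})` for `ω_i = g_{i1} + ε ḡ_{i2}`. -/
def basisDet (m ℓ : ℕ) (ω₁ ω₂ : B m ℓ) : K m :=
  Matrix.det !![coord₁ m ℓ ω₁, coord₂ m ℓ ω₁; coord₁ m ℓ ω₂, coord₂ m ℓ ω₂]

/-- `ω₁, ω₂` is a proper basis of `I` with determinant the positive integer `n`. -/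
def IsProperBasis (m ℓ : ℕ) [NeZero m] (I : AddSubgroup (B m ℓ)) (ω₁ ω₂ : B m ℓ) (n : ℕ) : Prop :=
  I = okSpan m ℓ ω₁ ω₂ ∧ 0 < n ∧ basisDet m ℓ ω₁ ω₂ = (n : K m)

/-- The norm `N(I)` of a left ideal `I`: the positive integer that is the determinant of a proper
basis of `I` (it does not depend on the proper basis; the value is `0` if there is none). -/
def normLeft (m ℓ : ℕ) [NeZero m] (I : AddSubgroup (B m ℓ)) : ℕ :=
  sInf {n : ℕ | ∃ ω₁ ω₂, IsProperBasis m ℓ I ω₁ ω₂ n}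

/-- The norm `N(I)` of a right ideal `I`: the norm of the left ideal `Ī`. -/
def normRight (m ℓ : ℕ) [NeZero m] (I : AddSubgroup (B m ℓ)) : ℕ :=
  normLeft m ℓ (conjIdeal m ℓ I)

/-- The reduced norm of a lattice: the `ℤ`-submodule of `ℚ` generated by the reduced norms of its
elements. -/
def nrdLattice (m ℓ : ℕ) (I : AddSubgroup (B m ℓ)) : AddSubgroup ℚ :=
  AddSubgroup.closure (nrd m ℓ '' I)

/-- Latimer's correspondence between regular left ideals and positive definite binary Hermitian
forms: `U` has a proper basis `ω₁, ω₂` such that `nrd(u ω₁ + v ω₂) = N(U) f(u, v)`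
for all `u, v ∈ 𝓞 K`. -/
def HasNormForm (m ℓ : ℕ) [NeZero m] (U : AddSubgroup (B m ℓ))
    (f : Matrix (Fin 2) (Fin 2) (K m)) : Prop :=
  ∃ ω₁ ω₂ n, IsProperBasis m ℓ U ω₁ ω₂ n ∧ ∀ u v : 𝓞 (K m),
    algebraMap ℚ (K m) (nrd m ℓ (incl m ℓ u * ω₁ + incl m ℓ v * ω₂)) = n * hermForm m f u v

/-- Latimer's explicit left ideal `[a, b + ε]` attached to `f = ( a b ; b̄ c )`. -/
def latimerIdeal (m ℓ : ℕ) [NeZero m] (f : Matrix (Fin 2) (Fin 2) (K m)) : AddSubgroup (B m ℓ) :=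
  okSpan m ℓ (incl m ℓ (f 0 0)) (incl m ℓ (f 0 1) + eps m ℓ)

/-- The right ideals of `𝔬` in the class of `Ū` whose norm is not divisible by any prime in `𝒫`. -/
def rightIdealsInClass (m ℓ : ℕ) [NeZero m] (P : Finset ℕ) (U : AddSubgroup (B m ℓ)) :
    Set (AddSubgroup (B m ℓ)) :=
  {I | IsRightIdeal m ℓ I ∧ SameRightClass m ℓ (conjIdeal m ℓ U) I ∧
    ∀ p ∈ P, ¬ p ∣ normRight m ℓ I}

end

end HermZeta

open HermZeta

/-!
Since `K` has class number one, `𝒪_K` is a principal ideal domain, and both sides of the identity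
count rows `c ∈ 𝒪_K²` by the values of one positive definite binary Hermitian form.

**The form.** Stability of `U` under `ε` forces `ξ` to be an integral vector `v` (this is where the
left ideal property enters), so `ξ` is an integral Hermitian matrix of determinant `ℓ`. For a row
`c` let `F(c)` be the value `rowForm m v c` of the form.

**Representation numbers.** `SL₂(𝒪_K)` acts on Hermitian matrices by `H ↦ g H gᴴ`, and its image is
exactly the connected discriminant kernel (`mem_discKernelPlus_iff`). One inclusion is a computation
together with the factorization of `SL₂(ℂ)` into transvections, which gives connectedness. For the
other, an element of the kernel maps the first isotropic basis vector to a primitive positive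
semidefinite matrix of rank one, which over a principal ideal domain is in the orbit of that vector;
a translation then reduces to an isometry of the middle block, and the congruence modulo `S₀` shows
that it comes from a diagonal matrix. The vectors counted by `n(ξ; d)` are therefore the
`h v` with `h ∈ SL₂(𝒪_K)` and last entry `d`. That entry is the value of `F` at the bottom row of
`h`, and the class of `s` modulo `dSℤ²` forgets exactly the translations. Hence `n(ξ; d)` is the
number of unimodular rows `c` with `F(c) = d`, up to the special unitary group of the form
(`repCount_eq_ncard`).

**Ideals.** To a nonzero row `c` corresponds the right ideal `rightId m ℓ v c`, of norm `F(c)`,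
which depends only on the class of `c` under the special unitary group (`normRight_rightId`,
`rightId_eq_iff`). The right ideals in the class of `Ū` are precisely these
(`setOf_rightIdeal_eq`, `exists_classData`). In the second description of Latimer's correspondence
the form that occurs is the complex conjugate one, which has the same values. By primitivity of `ξ`
the values of the form generate `ℤ`, and this gives the reduced norm of each ideal.

**The product.** Every nonzero row is `h c₀` with `c₀` unimodular, uniquely up to units, and
`F(h c₀) = N(h) F(c₀)`. So a right ideal in the class is a product of a nonzero ideal of `𝒪_K`
and a right ideal attached to a unimodular row, and norms multiply (`exists_bijective_mulId`). The
first factor contributes `ζ_{K,𝒫}`, the second `ζ_{ξ,𝒫}`. Everything converges absolutely for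
`Re(s) > 2` because `F` is a positive definite quaternary form over `ℤ` (`summable_rowForm`).
-/

namespace HermZeta

noncomputable section

open scoped QuadraticAlgebra

/-! ### The ring of integers in coordinates -/

/-- The integer `A` in `ω² = A + B ω`. The division is exact, since `m ≡ 3 (mod 4)` there. -/
def paramA (m : ℕ) : ℤ := if m % 4 = 3 then -(((m : ℤ) + 1) / 4) else -(m : ℤ)

/-- The integer `B` in `ω² = A + B ω`. -/
def paramB (m : ℕ) : ℤ := if m % 4 = 3 then 1 else 0

/-- The ring `ℤ + ℤω` in coordinates: `⟨x, y⟩` is `x + yω`. -/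
abbrev R (m : ℕ) : Type := QuadraticAlgebra ℤ (paramA m) (paramB m)

lemma matS_eq (m : ℕ) : matS m = !![2, paramB m; paramB m, -2 * paramA m] := by
  unfold matS paramA paramB
  split_ifs with h
  · have : ((m : ℤ) + 1) / 2 = -2 * -(((m : ℤ) + 1) / 4) := by omega
    rw [this]
  · simp

lemma param_cases (m : ℕ) : (m % 4 = 3 ∧ paramB m = 1 ∧ 4 * paramA m = -(m : ℤ) - 1) ∨
    (m % 4 ≠ 3 ∧ paramB m = 0 ∧ paramA m = -(m : ℤ)) := by
  unfold paramA paramB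
  split_ifs with h
  · left; refine ⟨h, rfl, ?_⟩; omega
  · right; exact ⟨h, rfl, rfl⟩

lemma disc_neg (m : ℕ) [NeZero m] : paramB m ^ 2 + 4 * paramA m < 0 := by
  have hm := Nat.pos_of_ne_zero (NeZero.ne m)
  rcases param_cases m with ⟨_, h2, h3⟩ | ⟨_, h2, h3⟩ <;> rw [h2, h3] <;> omega

lemma disc_le (m : ℕ) [NeZero m] : paramB m ^ 2 + 4 * paramA m ≤ -3 := by
  have hm := Nat.pos_of_ne_zero (NeZero.ne m)
  rcases param_cases m with ⟨_, h2, h3⟩ | ⟨_, h2, h3⟩ <;> rw [h2, h3] <;> omega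

lemma four_mul_norm (m : ℕ) (z : R m) :
    4 * z.norm = z.trace ^ 2 - (paramB m ^ 2 + 4 * paramA m) * z.im ^ 2 := by
  rw [QuadraticAlgebra.norm_def, QuadraticAlgebra.trace_def]; ring

lemma norm_nonneg' (m : ℕ) [NeZero m] (z : R m) : 0 ≤ z.norm := by
  have := four_mul_norm m z
  nlinarith [disc_neg m, sq_nonneg z.trace, sq_nonneg z.im,
    mul_nonneg (neg_nonneg.2 (disc_neg m).le) (sq_nonneg z.im)]

lemma norm_eq_zero' (m : ℕ) [NeZero m] {z : R m} : z.norm = 0 ↔ z = 0 := by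
  refine ⟨fun h => ?_, fun h => by rw [h, QuadraticAlgebra.norm_zero]⟩
  have h4 := four_mul_norm m z
  rw [h] at h4
  have h1 : 0 ≤ -(paramB m ^ 2 + 4 * paramA m) * z.im ^ 2 :=
    mul_nonneg (neg_nonneg.2 (disc_neg m).le) (sq_nonneg z.im)
  have h2 : z.im ^ 2 = 0 := by
    have : (paramB m ^ 2 + 4 * paramA m) * z.im ^ 2 = 0 := by nlinarith [sq_nonneg z.trace]
    exact (mul_eq_zero.1 this).resolve_left (disc_neg m).ne
  have h3 : z.trace ^ 2 = 0 := by rw [h2] at h4; linarith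
  have h2' : z.im = 0 := by simpa using h2
  have h3' : z.trace = 0 := by simpa using h3
  rw [QuadraticAlgebra.trace_def, h2'] at h3'
  ext
  · simpa using h3'
  · simpa using h2'

lemma norm_pos' (m : ℕ) [NeZero m] {z : R m} (hz : z ≠ 0) : 0 < z.norm :=
  lt_of_le_of_ne (norm_nonneg' m z) fun h => hz ((norm_eq_zero' m).1 h.symm)

/-- The norm form is anisotropic, so `ℤ + ℤω` is a domain. -/
instance isDomainR (m : ℕ) [NeZero m] : IsDomain (R m) :=
  have : NoZeroDivisors (R m) := ⟨fun {x y} h => by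
    have h1 : x.norm * y.norm = 0 := by rw [← map_mul, h, QuadraticAlgebra.norm_zero]
    rcases mul_eq_zero.1 h1 with h2 | h2
    · exact Or.inl ((norm_eq_zero' m).1 h2)
    · exact Or.inr ((norm_eq_zero' m).1 h2)⟩
  NoZeroDivisors.to_isDomain _

lemma omegaK_sq (m : ℕ) :
    omegaK m * omegaK m =
      algebraMap ℚ (K m) (paramA m) + algebraMap ℚ (K m) (paramB m) * omegaK m := by
  rcases param_cases m with ⟨h1, h2, h3⟩ | ⟨h1, h2, h3⟩
  · have h3' : (paramA m : ℚ) = (-(m : ℚ) - 1) / 4 := by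
      rw [eq_div_iff (by norm_num), mul_comm]; exact_mod_cast h3
    rw [h3', h2, omegaK, if_pos h1]
    ext <;> simp <;> ring
  · rw [h3, h2, omegaK, if_neg h1]
    ext <;> simp

/-- The embedding `x + yω` of `ℤ + ℤω` in `K`. -/
def toK (m : ℕ) : R m →+* K m where
  toFun x := algebraMap ℚ (K m) x.re + omegaK m * algebraMap ℚ (K m) x.im
  map_zero' := by simp
  map_one' := by simp [QuadraticAlgebra.re_one, QuadraticAlgebra.im_one]
  map_add' x y := by simp; ring
  map_mul' x y := by
    simp only [QuadraticAlgebra.re_mul, QuadraticAlgebra.im_mul, Int.cast_add, Int.cast_mul,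
      map_add, map_mul]
    linear_combination -algebraMap ℚ (K m) x.im * algebraMap ℚ (K m) y.im * omegaK_sq m

lemma toK_apply (m : ℕ) (x : R m) :
    toK m x = algebraMap ℚ (K m) x.re + omegaK m * algebraMap ℚ (K m) x.im := rfl

lemma star_omegaK (m : ℕ) : star (omegaK m) = algebraMap ℚ (K m) (paramB m) - omegaK m := by
  rcases param_cases m with ⟨h1, h2, h3⟩ | ⟨h1, h2, h3⟩
  · rw [h2, omegaK, if_pos h1]
    ext
    · simp; norm_num
    · simp
  · rw [h2, omegaK, if_neg h1]
    ext
    · simp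
    · simp

lemma star_algebraMap' (m : ℕ) (x : ℚ) : star (algebraMap ℚ (K m) x) = algebraMap ℚ (K m) x :=
  QuadraticAlgebra.ext (by simp) (by simp)

lemma toK_star (m : ℕ) (x : R m) : toK m (star x) = star (toK m x) := by
  rw [toK_apply, toK_apply, star_add, star_mul, star_algebraMap', star_algebraMap', star_omegaK,
    QuadraticAlgebra.re_star, QuadraticAlgebra.im_star]
  push_cast
  ring

lemma omegaK_im_ne (m : ℕ) : (omegaK m).im ≠ 0 := by
  unfold omegaK; split_ifs <;> norm_num

lemma toK_im (m : ℕ) (x : R m) : (toK m x).im = (omegaK m).im * x.im := by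
  simp [toK_apply]

lemma toK_re (m : ℕ) (x : R m) : (toK m x).re = x.re + (omegaK m).re * x.im := by
  simp [toK_apply]

lemma toK_injective (m : ℕ) : Function.Injective (toK m) := by
  rw [injective_iff_map_eq_zero]
  intro x hx
  have h1 : (omegaK m).im * x.im = 0 := by rw [← toK_im, hx]; rfl
  have h2 : x.im = 0 := by simpa [omegaK_im_ne] using h1
  have h3 : (x.re : ℚ) = 0 := by
    have := toK_re m x
    rw [hx, h2] at this
    simpa using this.symm
  ext
  · exact_mod_cast h3
  · exact h2

lemma toK_intCast (m : ℕ) (n : ℤ) : toK m (algebraMap ℤ (R m) n) = algebraMap ℚ (K m) n := by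
  simp

lemma toK_norm (m : ℕ) (x : R m) : (toK m x).norm = (x.norm : ℚ) := by
  apply QuadraticAlgebra.algebraMap_injective (R := ℚ) (a := -(m : ℚ)) (b := 0)
  rw [QuadraticAlgebra.algebraMap_norm_eq_mul_star, ← toK_star, ← map_mul,
    ← QuadraticAlgebra.algebraMap_norm_eq_mul_star, toK_intCast]

lemma isIntegral_toK (m : ℕ) (x : R m) : IsIntegral ℤ (toK m x) :=
  (Algebra.IsIntegral.isIntegral (R := ℤ) x).map (toK m).toIntAlgHom

/-- A rational number `t` such that `m t²` is an integer is an integer, when `m` is square-free. -/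
lemma exists_int_of_squarefree_mul_sq {m : ℕ} (hm : Squarefree m) {t : ℚ} {k : ℤ}
    (h : (m : ℚ) * t ^ 2 = k) : ∃ n : ℤ, t = n := by
  have hd : (t.den : ℚ) ≠ 0 := by exact_mod_cast t.den_ne_zero
  have h1 : (m : ℤ) * t.num ^ 2 = k * (t.den : ℤ) ^ 2 := by
    have h2 : (m : ℚ) * (t.num / t.den) ^ 2 = k := by rw [Rat.num_div_den]; exact h
    have h3 : (m : ℚ) * t.num ^ 2 = k * (t.den : ℚ) ^ 2 := by
      rw [← h2]; field_simp
    exact_mod_cast h3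
  have h2 : (t.den ^ 2) ∣ m * t.num.natAbs ^ 2 := by
    rw [← Int.natCast_dvd_natCast]
    push_cast
    rw [sq_abs]
    exact ⟨k, by rw [h1]; ring⟩
  have hc : Nat.Coprime (t.den ^ 2) (t.num.natAbs ^ 2) := t.reduced.symm.pow 2 2
  have h3 : t.den * t.den ∣ m := by rw [← sq]; exact hc.dvd_of_dvd_mul_right h2
  have h4 : t.den = 1 := Nat.isUnit_iff.1 (hm _ h3)
  exact ⟨t.num, ((Rat.den_eq_one_iff t).1 h4).symm⟩

lemma isIntegral_algebraMap_rat {m : ℕ} {t : ℚ} (h : IsIntegral ℤ (algebraMap ℚ (K m) t)) :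
    ∃ n : ℤ, t = n := by
  have h1 : IsIntegral ℤ t :=
    (isIntegral_algebraMap_iff (QuadraticAlgebra.algebraMap_injective)).1 h
  obtain ⟨n, hn⟩ := IsIntegrallyClosed.isIntegral_iff.1 h1
  exact ⟨n, by rw [← hn]; rfl⟩

/-- An integral element of `K` has integral trace `a` and norm, hence integral `b = 2 Im`; the
congruence `a² + m b² ≡ 0 (mod 4)` then forces it into `ℤ + ℤω`. -/
lemma exists_toK_eq {m : ℕ} (hm : Squarefree m) {x : K m} (hx : IsIntegral ℤ x) :
    ∃ r : R m, toK m r = x := by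
  have hs : IsIntegral ℤ (star x) := hx.map (starRingEnd (K m)).toIntAlgHom
  obtain ⟨a, ha⟩ := isIntegral_algebraMap_rat (m := m) (t := x.trace) (by
    rw [QuadraticAlgebra.algebraMap_trace_eq_add_star]; exact hx.add hs)
  obtain ⟨n, hn⟩ := isIntegral_algebraMap_rat (m := m) (t := x.norm) (by
    rw [QuadraticAlgebra.algebraMap_norm_eq_mul_star]; exact hx.mul hs)
  rw [QuadraticAlgebra.trace_def] at ha
  rw [QuadraticAlgebra.norm_def] at hn
  obtain ⟨b, hb⟩ := exists_int_of_squarefree_mul_sq hm (t := 2 * x.im) (k := 4 * n - a ^ 2) (by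
    push_cast; rw [← hn, ← ha]; ring)
  have hab : a ^ 2 + m * b ^ 2 = 4 * n := by
    have : (a : ℚ) ^ 2 + m * b ^ 2 = 4 * n := by rw [← hn, ← ha, ← hb]; ring
    exact_mod_cast this
  have hm4 : m % 4 ≠ 0 := fun h => by
    have h2 : 2 * 2 ∣ m := by omega
    have := Nat.isUnit_iff.1 (hm 2 h2)
    omega
  have hmod : ((a % 4) ^ 2 + ((m : ℤ) % 4) * (b % 4) ^ 2) % 4 = 0 := by
    have h0 : (a ^ 2 + m * b ^ 2) % 4 = 0 := by rw [hab]; omega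
    simpa [Int.add_emod, Int.mul_emod, pow_two] using h0
  have ha4 : a % 4 = 0 ∨ a % 4 = 1 ∨ a % 4 = 2 ∨ a % 4 = 3 := by omega
  have hb4 : b % 4 = 0 ∨ b % 4 = 1 ∨ b % 4 = 2 ∨ b % 4 = 3 := by omega
  by_cases h : m % 4 = 3
  · have hm3 : (m : ℤ) % 4 = 3 := by omega
    have hpar : (a - b) % 2 = 0 := by
      rw [hm3] at hmod
      rcases ha4 with ha | ha | ha | ha <;> rcases hb4 with hb | hb | hb | hb <;>
        rw [ha, hb] at hmod <;> norm_num at hmod <;> omega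
    obtain ⟨c, hc⟩ : ∃ c, a = 2 * c + b := ⟨(a - b) / 2, by omega⟩
    have hc' : (a : ℚ) = 2 * c + b := by exact_mod_cast hc
    refine ⟨⟨c, b⟩, ?_⟩
    ext
    · simp [toK_re, omegaK, h]; linarith
    · simp [toK_im, omegaK, h]; linarith
  · have hm12 : (m : ℤ) % 4 = 1 ∨ (m : ℤ) % 4 = 2 := by omega
    have hpar : a % 2 = 0 ∧ b % 2 = 0 := by
      rcases hm12 with hm' | hm' <;> rw [hm'] at hmod <;>
      rcases ha4 with ha | ha | ha | ha <;> rcases hb4 with hb | hb | hb | hb <;>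
        rw [ha, hb] at hmod <;> norm_num at hmod <;> omega
    obtain ⟨c, hc⟩ : ∃ c, a = 2 * c := ⟨a / 2, by omega⟩
    obtain ⟨d, hd⟩ : ∃ d, b = 2 * d := ⟨b / 2, by omega⟩
    have hc' : (a : ℚ) = 2 * c := by exact_mod_cast hc
    have hd' : (b : ℚ) = 2 * d := by exact_mod_cast hd
    refine ⟨⟨c, d⟩, ?_⟩
    ext
    · simp [toK_re, omegaK, h]; linarith
    · simp [toK_im, omegaK, h]; linarith

/-- The ring of integers of `K` is `ℤ + ℤω`. -/
def toOK (m : ℕ) [NeZero m] (hm : Squarefree m) : R m ≃+* 𝓞 (K m) :=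
  RingEquiv.ofBijective
    ((toK m).codRestrict (integralClosure ℤ (K m)).toSubring (isIntegral_toK m) : R m →+* 𝓞 (K m))
    ⟨fun x y h => toK_injective m (congrArg (Subtype.val) h), fun y => by
      obtain ⟨r, hr⟩ := exists_toK_eq hm y.2
      exact ⟨r, Subtype.ext hr⟩⟩

lemma coe_toOK (m : ℕ) [NeZero m] (hm : Squarefree m) (x : R m) :
    ((toOK m hm x : 𝓞 (K m)) : K m) = toK m x := rfl

lemma isPrincipalIdealRing_R (m : ℕ) [NeZero m] (hm : Squarefree m)
    (hK : NumberField.classNumber (K m) = 1) : IsPrincipalIdealRing (R m) := by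
  have := NumberField.classNumber_eq_one_iff.1 hK
  exact IsPrincipalIdealRing.of_surjective (toOK m hm).symm.toRingHom (toOK m hm).symm.surjective

lemma absNorm_span_toOK (m : ℕ) [NeZero m] (hm : Squarefree m) (x : R m) :
    Ideal.absNorm (Ideal.span {toOK m hm x}) = x.norm.natAbs := by
  rw [Ideal.absNorm_span_singleton]
  congr 1
  have h : ((Algebra.norm ℤ (toOK m hm x) : ℤ) : ℚ) = x.norm := by
    rw [Algebra.coe_norm_int, coe_toOK, ← toK_norm, Algebra.norm_apply]
    exact QuadraticAlgebra.det_toLinearMap_eq_norm (toK m x)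
  exact_mod_cast h

/-! ### The action of `SL₂` on binary Hermitian matrices -/

section Action

variable {F : Type*} [CommRing F] {a b : F}

/-- The Hermitian matrix `( x  y+zω ; y+zω̄  w )` with coordinates `v = (x, y, z, w)`. -/
def Hm (v : Fin 4 → F) : Matrix (Fin 2) (Fin 2) (QuadraticAlgebra F a b) :=
  !![.C (v 0), ⟨v 1, v 2⟩; star ⟨v 1, v 2⟩, .C (v 3)]

/-- The coordinates of a Hermitian matrix. -/
def coords (M : Matrix (Fin 2) (Fin 2) (QuadraticAlgebra F a b)) : Fin 4 → F :=
  ![(M 0 0).re, (M 0 1).re, (M 0 1).im, (M 1 1).re]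

/-- The action `H ↦ g H gᴴ` in coordinates. -/
def act (g : Matrix (Fin 2) (Fin 2) (QuadraticAlgebra F a b)) (v : Fin 4 → F) : Fin 4 → F :=
  coords (g * Hm v * gᴴ)

lemma coords_Hm (v : Fin 4 → F) : coords (Hm (a := a) (b := b) v) = v := by
  ext i; fin_cases i <;> simp [coords, Hm]

lemma Hm_injective : Function.Injective (Hm (F := F) (a := a) (b := b)) :=
  Function.LeftInverse.injective coords_Hm

lemma Hm_isHermitian (v : Fin 4 → F) : (Hm (a := a) (b := b) v)ᴴ = Hm v := by
  ext i j <;> fin_cases i <;> fin_cases j <;> simp [Hm]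

lemma Hm_add (v w : Fin 4 → F) : Hm (a := a) (b := b) (v + w) = Hm v + Hm w := by
  ext i j <;> fin_cases i <;> fin_cases j <;> simp [Hm] <;> ring

lemma Hm_smul (c : F) (v : Fin 4 → F) : Hm (a := a) (b := b) (c • v) = c • Hm v := by
  ext i j <;> fin_cases i <;> fin_cases j <;> simp [Hm] <;> ring

lemma coords_add (M N : Matrix (Fin 2) (Fin 2) (QuadraticAlgebra F a b)) :
    coords (M + N) = coords M + coords N := by
  ext i; fin_cases i <;> simp [coords]

lemma coords_smul (c : F) (M : Matrix (Fin 2) (Fin 2) (QuadraticAlgebra F a b)) :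
    coords (c • M) = c • coords M := by
  ext i; fin_cases i <;> simp [coords]

lemma Hm_coords [IsDomain F] [CharZero F] {M : Matrix (Fin 2) (Fin 2) (QuadraticAlgebra F a b)}
    (hM : Mᴴ = M) : Hm (coords M) = M := by
  have key : ∀ x : QuadraticAlgebra F a b, star x = x → x.im = 0 := fun x hx => by
    have h1 : -x.im = x.im := by
      conv_rhs => rw [← hx]
      rw [QuadraticAlgebra.im_star]
    have h2 : 2 * x.im = 0 := by linear_combination -h1
    simpa using h2
  have h00 := key (M 0 0) (by conv_rhs => rw [← hM]
                              rfl)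
  have h11 := key (M 1 1) (by conv_rhs => rw [← hM]
                              rfl)
  have h01 : star (M 0 1) = M 1 0 := by
    conv_rhs => rw [← hM]
    rfl
  ext i j
  · fin_cases i <;> fin_cases j <;> simp [Hm, coords, ← h01]
  · fin_cases i <;> fin_cases j <;> simp [Hm, coords, ← h01, h00, h11]

lemma Hm_act [IsDomain F] [CharZero F] (g : Matrix (Fin 2) (Fin 2) (QuadraticAlgebra F a b))
    (v : Fin 4 → F) : Hm (act g v) = g * Hm v * gᴴ :=
  Hm_coords (by simp [Matrix.conjTranspose_mul, Hm_isHermitian, mul_assoc])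

lemma act_mul [IsDomain F] [CharZero F] (g h : Matrix (Fin 2) (Fin 2) (QuadraticAlgebra F a b))
    (v : Fin 4 → F) : act (g * h) v = act g (act h v) := by
  apply Hm_injective (a := a) (b := b)
  rw [Hm_act, Hm_act, Hm_act, Matrix.conjTranspose_mul]
  simp only [mul_assoc]

lemma act_one (v : Fin 4 → F) :
    act (1 : Matrix (Fin 2) (Fin 2) (QuadraticAlgebra F a b)) v = v := by
  rw [act, Matrix.conjTranspose_one, one_mul, mul_one, coords_Hm]

/-- The matrix of the action of `g` on the coordinates of Hermitian matrices. -/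
def actMat (g : Matrix (Fin 2) (Fin 2) (QuadraticAlgebra F a b)) : Matrix (Fin 4) (Fin 4) F :=
  LinearMap.toMatrix'
    { toFun := act g
      map_add' := fun v w => by
        rw [act, Hm_add, mul_add, add_mul, coords_add]; rfl
      map_smul' := fun c v => by
        rw [act, Hm_smul, Matrix.mul_smul, Matrix.smul_mul, coords_smul]; rfl }

lemma actMat_mulVec (g : Matrix (Fin 2) (Fin 2) (QuadraticAlgebra F a b)) (v : Fin 4 → F) :
    actMat g *ᵥ v = act g v := by
  rw [actMat, LinearMap.toMatrix'_mulVec]; rfl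

lemma actMat_apply (g : Matrix (Fin 2) (Fin 2) (QuadraticAlgebra F a b)) (i j : Fin 4) :
    actMat g i j = act g (Pi.single j 1) i := by
  rw [← actMat_mulVec]; simp

lemma actMat_mul [IsDomain F] [CharZero F]
    (g h : Matrix (Fin 2) (Fin 2) (QuadraticAlgebra F a b)) :
    actMat (g * h) = actMat g * actMat h := by
  apply Matrix.mulVec_injective
  funext v
  rw [← Matrix.mulVec_mulVec, actMat_mulVec, actMat_mulVec, actMat_mulVec, act_mul]

lemma actMat_one : actMat (1 : Matrix (Fin 2) (Fin 2) (QuadraticAlgebra F a b)) = 1 := by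
  apply Matrix.mulVec_injective
  funext v
  rw [actMat_mulVec, act_one, Matrix.one_mulVec]

/-- The symmetric matrix `S₀` over a commutative ring. -/
def S0 (a b : F) : Matrix (Fin 4) (Fin 4) F :=
  !![0, 0, 0, 1; 0, -2, -b, 0; 0, -b, 2 * a, 0; 1, 0, 0, 0]

/-- The special orthogonal group of `S₀`, as a submonoid of the matrices. -/
def SO (a b : F) : Submonoid (Matrix (Fin 4) (Fin 4) F) where
  carrier := {g | g.det = 1 ∧ gᵀ * S0 a b * g = S0 a b}
  one_mem' := by simp
  mul_mem' := by
    rintro g h ⟨hg1, hg2⟩ ⟨hh1, hh2⟩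
    refine ⟨by rw [Matrix.det_mul, hg1, hh1, one_mul], ?_⟩
    calc (g * h)ᵀ * S0 a b * (g * h) = hᵀ * (gᵀ * S0 a b * g) * h := by
          rw [Matrix.transpose_mul]; simp only [mul_assoc]
      _ = S0 a b := by rw [hg2, hh2]

/-- The upper triangular transvection. -/
def upper (x : QuadraticAlgebra F a b) : Matrix (Fin 2) (Fin 2) (QuadraticAlgebra F a b) :=
  !![1, x; 0, 1]

/-- The lower triangular transvection. -/
def lower (x : QuadraticAlgebra F a b) : Matrix (Fin 2) (Fin 2) (QuadraticAlgebra F a b) :=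
  !![1, 0; x, 1]

lemma act_apply (g : Matrix (Fin 2) (Fin 2) (QuadraticAlgebra F a b)) (v : Fin 4 → F) :
    act g v = ![(g 0 0 * .C (v 0) * star (g 0 0) + g 0 1 * star ⟨v 1, v 2⟩ * star (g 0 0)
        + g 0 0 * ⟨v 1, v 2⟩ * star (g 0 1) + g 0 1 * .C (v 3) * star (g 0 1)).re,
      (g 0 0 * .C (v 0) * star (g 1 0) + g 0 1 * star ⟨v 1, v 2⟩ * star (g 1 0)
        + g 0 0 * ⟨v 1, v 2⟩ * star (g 1 1) + g 0 1 * .C (v 3) * star (g 1 1)).re,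
      (g 0 0 * .C (v 0) * star (g 1 0) + g 0 1 * star ⟨v 1, v 2⟩ * star (g 1 0)
        + g 0 0 * ⟨v 1, v 2⟩ * star (g 1 1) + g 0 1 * .C (v 3) * star (g 1 1)).im,
      (g 1 0 * .C (v 0) * star (g 1 0) + g 1 1 * star ⟨v 1, v 2⟩ * star (g 1 0)
        + g 1 0 * ⟨v 1, v 2⟩ * star (g 1 1) + g 1 1 * .C (v 3) * star (g 1 1)).re] := by
  simp only [act, coords, Matrix.mul_apply, Fin.sum_univ_two, Hm, Matrix.conjTranspose_apply,
    Matrix.of_apply, Matrix.cons_val', Matrix.cons_val_zero, Matrix.cons_val_one,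
    Matrix.cons_val_fin_one, add_mul, ← add_assoc]

lemma actMat_upper (x : QuadraticAlgebra F a b) : actMat (upper x) =
    !![1, 2 * x.re + b * x.im, b * x.re - 2 * a * x.im, x.norm;
       0, 1, 0, x.re;
       0, 0, 1, x.im;
       0, 0, 0, 1] := by
  ext i j
  rw [actMat_apply, act_apply]
  fin_cases i <;> fin_cases j <;>
    simp [upper, QuadraticAlgebra.norm_def] <;> ring

lemma actMat_lower (x : QuadraticAlgebra F a b) : actMat (lower x) =
    !![1, 0, 0, 0;
       x.re + b * x.im, 1, 0, 0;
       -x.im, 0, 1, 0;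
       x.norm, 2 * x.re + b * x.im, b * x.re + (2 * a + b ^ 2) * x.im, 1] := by
  ext i j
  rw [actMat_apply, act_apply]
  fin_cases i <;> fin_cases j <;>
    simp [lower, QuadraticAlgebra.norm_def] <;> ring

lemma actMat_upper_mem (x : QuadraticAlgebra F a b) : actMat (upper x) ∈ SO a b := by
  rw [actMat_upper]
  constructor
  · simp [Matrix.det_succ_row_zero, Fin.sum_univ_succ]
  · ext i j
    fin_cases i <;> fin_cases j <;>
      simp [S0, Matrix.mul_apply, Fin.sum_univ_succ, QuadraticAlgebra.norm_def] <;> ring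

lemma actMat_lower_mem (x : QuadraticAlgebra F a b) : actMat (lower x) ∈ SO a b := by
  rw [actMat_lower]
  constructor
  · simp [Matrix.det_succ_row_zero, Fin.sum_univ_succ, Fin.succAbove]
  · ext i j
    fin_cases i <;> fin_cases j <;>
      simp [S0, Matrix.mul_apply, Fin.sum_univ_succ, QuadraticAlgebra.norm_def] <;> ring

end Action

/-! ### Base change and the connected component over `ℝ` -/

section BaseChange

variable {F F' : Type*} [CommRing F] [CommRing F'] {a b : F}

/-- Change of the base ring of a quadratic algebra. -/
def mapQ (f : F →+* F') : QuadraticAlgebra F a b →+* QuadraticAlgebra F' (f a) (f b) where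
  toFun x := ⟨f x.re, f x.im⟩
  map_zero' := by ext <;> simp
  map_one' := by ext <;> simp
  map_add' x y := by ext <;> simp
  map_mul' x y := by ext <;> simp

lemma mapQ_star (f : F →+* F') (x : QuadraticAlgebra F a b) :
    mapQ f (star x) = star (mapQ f x) := by
  ext <;> simp [mapQ]

lemma act_map (f : F →+* F') (g : Matrix (Fin 2) (Fin 2) (QuadraticAlgebra F a b))
    (v : Fin 4 → F) : act (g.map (mapQ f)) (f ∘ v) = f ∘ act g v := by
  have h1 : Hm (f ∘ v) = (Hm (a := a) (b := b) v).map (mapQ f) := by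
    ext i j <;> fin_cases i <;> fin_cases j <;> simp [Hm, mapQ]
  have h2 : ∀ M : Matrix (Fin 2) (Fin 2) (QuadraticAlgebra F a b),
      coords (M.map (mapQ f)) = f ∘ coords M := fun M => by
    ext i; fin_cases i <;> simp [coords, mapQ]
  have h3 : (g.map (mapQ f))ᴴ = gᴴ.map (mapQ f) := by
    ext1 i j; simp [Matrix.conjTranspose_apply, mapQ_star]
  rw [act, act, ← h2, h1, h3, Matrix.map_mul, Matrix.map_mul]

lemma actMat_map (f : F →+* F') (g : Matrix (Fin 2) (Fin 2) (QuadraticAlgebra F a b)) :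
    actMat (g.map (mapQ f)) = (actMat g).map f := by
  ext i j
  rw [actMat_apply, Matrix.map_apply, actMat_apply]
  have : (Pi.single j 1 : Fin 4 → F') = f ∘ Pi.single j 1 := by
    ext k; by_cases h : k = j <;> simp [h]
  rw [this, act_map]; rfl

lemma S0_map (f : F →+* F') (a b : F) : (S0 a b).map f = S0 (f a) (f b) := by
  have h2 : f 2 = 2 := map_ofNat f 2
  ext i j
  fin_cases i <;> fin_cases j <;> simp [S0, h2]

end BaseChange

/-- Over a field, every matrix of determinant `1` is a product of four transvections. -/
lemma exists_transvections {F : Type*} [Field F] {a b : F} [Fact (∀ r : F, r ^ 2 ≠ a + b * r)]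
    (g : Matrix (Fin 2) (Fin 2) (QuadraticAlgebra F a b)) (hg : g.det = 1) :
    ∃ w x y z, g = lower w * upper x * lower y * upper z := by
  -- three transvections suffice if the lower left entry is nonzero
  have key : ∀ g : Matrix (Fin 2) (Fin 2) (QuadraticAlgebra F a b), g.det = 1 → g 1 0 ≠ 0 →
      ∃ x y z, g = upper x * lower y * upper z := by
    intro g hg h
    rw [Matrix.det_fin_two] at hg
    refine ⟨(g 0 0 - 1) / g 1 0, g 1 0, (g 1 1 - 1) / g 1 0, ?_⟩
    ext1 i j
    fin_cases i <;> fin_cases j <;>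
      simp only [upper, lower, Fin.zero_eta, Fin.mk_one, Fin.isValue, Matrix.mul_apply,
        Matrix.of_apply, Matrix.cons_val', Matrix.cons_val_fin_one, Fin.sum_univ_two,
        Matrix.cons_val_zero, Matrix.cons_val_one, mul_one, mul_zero, zero_mul, add_zero,
        one_mul, zero_add]
    · field_simp; ring
    · field_simp; linear_combination -hg
    · field_simp; ring
  by_cases h : g 1 0 = 0
  · have hd : (lower 1 * g).det = 1 := by
      rw [Matrix.det_mul, hg, Matrix.det_fin_two]; simp [lower]
    have h00 : g 0 0 ≠ 0 := fun h0 => by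
      rw [Matrix.det_fin_two, h, h0] at hg; simp at hg
    obtain ⟨x, y, z, hxyz⟩ := key (lower 1 * g) hd (by
      simpa [lower, Matrix.mul_apply, Fin.sum_univ_two, h] using h00)
    refine ⟨-1, x, y, z, ?_⟩
    rw [mul_assoc, mul_assoc, ← mul_assoc (upper x), ← hxyz, ← mul_assoc]
    have : (lower (-1) : Matrix (Fin 2) (Fin 2) (QuadraticAlgebra F a b)) * lower 1 = 1 := by
      ext1 i j; fin_cases i <;> fin_cases j <;> simp [lower, Matrix.mul_apply, Fin.sum_univ_two]
    rw [this, one_mul]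
  · obtain ⟨x, y, z, hxyz⟩ := key g hg h
    refine ⟨0, x, y, z, ?_⟩
    have : (lower 0 : Matrix (Fin 2) (Fin 2) (QuadraticAlgebra F a b)) = 1 := by
      ext1 i j; fin_cases i <;> fin_cases j <;> simp [lower]
    rw [this, one_mul]; exact hxyz

section Real

variable {a b : ℝ}

lemma fact_of_disc_neg (h : b ^ 2 + 4 * a < 0) : Fact (∀ r : ℝ, r ^ 2 ≠ a + b * r) :=
  ⟨fun r hr => by nlinarith [sq_nonneg (2 * r - b)]⟩

/-- The image of `SL₂` lies in the identity component: a product of transvections is joined to `1`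
by scaling their parameters. -/
lemma actMat_mem_component (h : b ^ 2 + 4 * a < 0)
    (g : Matrix (Fin 2) (Fin 2) (QuadraticAlgebra ℝ a b)) (hg : g.det = 1) :
    actMat g ∈ connectedComponentIn (SO a b : Set (Matrix (Fin 4) (Fin 4) ℝ)) 1 := by
  have := fact_of_disc_neg h
  obtain ⟨w, x, y, z, rfl⟩ := exists_transvections g hg
  -- the path from `1` to the given element along which all four parameters are scaled by `t`
  let γ : ℝ → Matrix (Fin 4) (Fin 4) ℝ := fun t =>
    actMat (lower (t • w)) * actMat (upper (t • x)) * actMat (lower (t • y)) *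
      actMat (upper (t • z))
  have hn : ∀ x : QuadraticAlgebra ℝ a b, Continuous fun t : ℝ => (t • x).norm := fun x => by
    simp only [QuadraticAlgebra.norm_def, QuadraticAlgebra.re_smul, QuadraticAlgebra.im_smul,
      smul_eq_mul]
    fun_prop
  have hu : ∀ x : QuadraticAlgebra ℝ a b, Continuous fun t : ℝ => actMat (upper (t • x)) :=
    fun x => by
      refine continuous_matrix fun i j => ?_
      simp only [actMat_upper]
      have := hn x
      fin_cases i <;> fin_cases j <;> simp <;> fun_prop
  have hl : ∀ x : QuadraticAlgebra ℝ a b, Continuous fun t : ℝ => actMat (lower (t • x)) :=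
    fun x => by
      refine continuous_matrix fun i j => ?_
      simp only [actMat_lower]
      have := hn x
      fin_cases i <;> fin_cases j <;> simp <;> fun_prop
  have hγ : Continuous γ := (((hl w).mul (hu x)).mul (hl y)).mul (hu z)
  have h0 : γ 0 = 1 := by
    have hu0 : actMat (upper (0 : QuadraticAlgebra ℝ a b)) = 1 := by
      rw [← actMat_one (a := a) (b := b)]; congr 1
      ext1 i j; fin_cases i <;> fin_cases j <;> simp [upper]
    have hl0 : actMat (lower (0 : QuadraticAlgebra ℝ a b)) = 1 := by
      rw [← actMat_one (a := a) (b := b)]; congr 1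
      ext1 i j; fin_cases i <;> fin_cases j <;> simp [lower]
    simp only [γ, zero_smul, hu0, hl0, mul_one]
  have h1 : γ 1 = actMat (lower w * upper x * lower y * upper z) := by
    simp only [γ, one_smul, actMat_mul]
  have hsub : γ '' Set.univ ⊆ (SO a b : Set (Matrix (Fin 4) (Fin 4) ℝ)) := by
    rintro _ ⟨t, -, rfl⟩
    exact (SO a b).mul_mem ((SO a b).mul_mem ((SO a b).mul_mem (actMat_lower_mem _)
      (actMat_upper_mem _)) (actMat_lower_mem _)) (actMat_upper_mem _)
  have hpre : IsPreconnected (γ '' Set.univ) := isPreconnected_univ.image γ hγ.continuousOn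
  have := hpre.subset_connectedComponentIn ⟨0, trivial, h0⟩ hsub
  exact this ⟨1, trivial, h1⟩

lemma actMat_mem_SO_real (h : b ^ 2 + 4 * a < 0)
    (g : Matrix (Fin 2) (Fin 2) (QuadraticAlgebra ℝ a b)) (hg : g.det = 1) :
    actMat g ∈ SO a b :=
  connectedComponentIn_subset _ _ (actMat_mem_component h g hg)

/-- An element of the identity component maps the isotropic vector `e₁` into the closed positive
cone: the trace of the image, as a Hermitian matrix, cannot vanish on the whole group and equals `1`
at the identity. -/
lemma pos_of_mem_component (h : b ^ 2 + 4 * a < 0) {g : Matrix (Fin 4) (Fin 4) ℝ}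
    (hg : g ∈ connectedComponentIn (SO a b : Set (Matrix (Fin 4) (Fin 4) ℝ)) 1) :
    0 < g 0 0 + g 3 0 := by
  have key : ∀ g ∈ (SO a b : Set (Matrix (Fin 4) (Fin 4) ℝ)), g 0 0 + g 3 0 ≠ 0 := by
    rintro g ⟨hd, hg⟩ h0
    have h00 := congrFun (congrFun hg 0) 0
    simp [Matrix.mul_apply, Fin.sum_univ_succ, S0] at h00
    have h3 : g 3 0 = -g 0 0 := by linarith
    rw [h3] at h00
    -- an isotropic Hermitian matrix of trace zero vanishes, by definiteness
    have e1 : g 0 0 ^ 2 + (g 1 0 + b / 2 * g 2 0) ^ 2 + (-(b ^ 2 + 4 * a) / 4) * g 2 0 ^ 2 = 0 := by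
      linear_combination -h00 / 2
    have p1 : 0 ≤ (-(b ^ 2 + 4 * a) / 4) * g 2 0 ^ 2 := by
      apply mul_nonneg _ (sq_nonneg _); linarith
    have q1 : g 0 0 ^ 2 = 0 := by nlinarith [sq_nonneg (g 0 0), sq_nonneg (g 1 0 + b / 2 * g 2 0)]
    have q2 : (g 1 0 + b / 2 * g 2 0) ^ 2 = 0 := by
      nlinarith [sq_nonneg (g 0 0), sq_nonneg (g 1 0 + b / 2 * g 2 0)]
    have q3 : (-(b ^ 2 + 4 * a) / 4) * g 2 0 ^ 2 = 0 := by
      nlinarith [sq_nonneg (g 0 0), sq_nonneg (g 1 0 + b / 2 * g 2 0)]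
    have r1 : g 0 0 = 0 := by simpa using q1
    have r3 : g 2 0 = 0 := by
      rcases mul_eq_zero.1 q3 with h' | h'
      · linarith
      · simpa using h'
    have r2 : g 1 0 = 0 := by rw [r3] at q2; simpa using q2
    have r4 : g 3 0 = 0 := by rw [h3, r1, neg_zero]
    have : g.det = 0 := Matrix.det_eq_zero_of_column_eq_zero 0 (fun i => by
      fin_cases i <;> assumption)
    rw [hd] at this
    exact one_ne_zero this
  by_contra hneg
  have hcont : ContinuousOn (fun g : Matrix (Fin 4) (Fin 4) ℝ => g 0 0 + g 3 0)
      (connectedComponentIn (SO a b : Set (Matrix (Fin 4) (Fin 4) ℝ)) 1) :=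
    ((continuous_apply_apply 0 0).add (continuous_apply_apply 3 0)).continuousOn
  have h1 := mem_connectedComponentIn
    (show (1 : Matrix (Fin 4) (Fin 4) ℝ) ∈ (SO a b : Set _) from (SO a b).one_mem)
  have := isPreconnected_connectedComponentIn.intermediate_value hg h1 hcont
  obtain ⟨g', hg', h0⟩ := this (show (0 : ℝ) ∈ Set.Icc _ _ from ⟨not_lt.1 hneg, by simp⟩)
  exact key g' (connectedComponentIn_subset _ _ hg') h0

end Real

/-! ### The connected discriminant kernel is the image of `SL₂` -/

lemma matS0_eq (m : ℕ) : matS0 m = S0 (paramA m) (paramB m) := by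
  rw [matS0, matS_eq]
  ext i j; fin_cases i <;> fin_cases j <;> simp [S0]

lemma realSO_eq (m : ℕ) : realSO m = (SO (paramA m : ℝ) (paramB m : ℝ) : Set _) := by
  have : (matS0 m).map (Int.cast : ℤ → ℝ) = S0 (paramA m : ℝ) (paramB m : ℝ) := by
    rw [matS0_eq]; exact S0_map (Int.castRingHom ℝ) _ _
  rw [realSO, this]; rfl

lemma disc_neg_real (m : ℕ) [NeZero m] : (paramB m : ℝ) ^ 2 + 4 * (paramA m : ℝ) < 0 := by
  exact_mod_cast disc_neg m

lemma det_map_mapQ {F F' : Type*} [CommRing F] [CommRing F'] {a b : F} (f : F →+* F')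
    {g : Matrix (Fin 2) (Fin 2) (QuadraticAlgebra F a b)} (hg : g.det = 1) :
    (g.map (mapQ f)).det = 1 := by
  have := (RingHom.map_det (mapQ f) g).symm
  rw [hg, map_one] at this
  exact this

lemma SO_of_map {F F' : Type*} [CommRing F] [CommRing F'] {a b : F} (f : F →+* F')
    (hf : Function.Injective f) {G : Matrix (Fin 4) (Fin 4) F}
    (hG : G.map f ∈ SO (f a) (f b)) : G ∈ SO a b := by
  obtain ⟨h1, h2⟩ := hG
  refine ⟨hf ?_, ?_⟩
  · rw [map_one, ← h1]; exact RingHom.map_det f G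
  · apply Matrix.map_injective hf
    change (_ : Matrix _ _ _).map f = (S0 a b).map f
    rw [Matrix.map_mul, Matrix.map_mul, S0_map]
    exact h2

lemma SO_map {F F' : Type*} [CommRing F] [CommRing F'] {a b : F} (f : F →+* F')
    {G : Matrix (Fin 4) (Fin 4) F}
    (hG : G ∈ SO a b) : G.map f ∈ SO (f a) (f b) := by
  obtain ⟨h1, h2⟩ := hG
  refine ⟨?_, ?_⟩
  · rw [← map_one f, ← h1]; exact (RingHom.map_det f G).symm
  · rw [← S0_map, ← Matrix.transpose_map, ← Matrix.map_mul, ← Matrix.map_mul, h2]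

lemma actMat_mem_SO (m : ℕ) [NeZero m] {g : Matrix (Fin 2) (Fin 2) (R m)} (hg : g.det = 1) :
    actMat g ∈ SO (paramA m) (paramB m) := by
  apply SO_of_map (Int.castRingHom ℝ) Int.cast_injective
  rw [← actMat_map]
  exact actMat_mem_SO_real (disc_neg_real m) _ (det_map_mapQ _ hg)

/-- The matrix `(ρ(g) - 1) S₀⁻¹`, where `ρ(g)` is the matrix of the action of `g`. It has entries
in the base ring because conjugation is trivial modulo the different. -/
def discM {F : Type*} [CommRing F] {a b : F}
    (g : Matrix (Fin 2) (Fin 2) (QuadraticAlgebra F a b)) : Matrix (Fin 4) (Fin 4) F :=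
  let p := g 0 0
  let q := g 0 1
  let r := g 1 0
  let s := g 1 1
  let x (β : QuadraticAlgebra F a b) : Fin 4 → F :=
    ![(β * p * star q).im, (q * .C (β * r).im - β * p * .C s.im).re,
      (q * .C (β * r).im - β * p * .C s.im).im, (β * r * star s).im]
  let A := actMat g
  !![A 0 3, -x ⟨0, 1⟩ 0, x 1 0, A 0 0 - 1;
     A 1 3, -x ⟨0, 1⟩ 1, x 1 1, A 1 0;
     A 2 3, -x ⟨0, 1⟩ 2, x 1 2, A 2 0;
     A 3 3 - 1, -x ⟨0, 1⟩ 3, x 1 3, A 3 0]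

lemma actMat_eq_one_add_discM {F : Type*} [CommRing F] {a b : F}
    {g : Matrix (Fin 2) (Fin 2) (QuadraticAlgebra F a b)} (hg : g.det = 1) :
    actMat g = 1 + discM g * S0 a b := by
  rw [Matrix.det_fin_two] at hg
  have h1 := congrArg QuadraticAlgebra.re hg
  have h2 := congrArg QuadraticAlgebra.im hg
  simp at h1 h2
  ext i j
  fin_cases j
  · fin_cases i <;> simp [discM, S0]
  · fin_cases i <;> simp [discM, S0]
    all_goals rw [actMat_apply, act_apply]
    all_goals simp
    · ring
    · linear_combination h1
    · linear_combination h2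
    · ring
  · fin_cases i <;> simp [discM, S0]
    all_goals rw [actMat_apply, act_apply]
    all_goals simp
    · ring
    · linear_combination a * h2
    · linear_combination h1 + b * h2
    · ring
  · fin_cases i <;> simp [discM, S0]

lemma map_cast_mulVec (G : Matrix (Fin 4) (Fin 4) ℤ) (v : Fin 4 → ℤ) :
    G.map (Int.cast : ℤ → ℚ) *ᵥ (fun i => (v i : ℚ)) = fun i => ((G *ᵥ v) i : ℚ) := by
  ext i
  simp [Matrix.mulVec, dotProduct]

/-- The image of `SL₂` over the ring of integers lies in the connected discriminant kernel. -/
lemma actMat_mem_discKernelPlus (m : ℕ) [NeZero m] {g : Matrix (Fin 2) (Fin 2) (R m)}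
    (hg : g.det = 1) : (actMat g).map (Int.cast : ℤ → ℚ) ∈ discKernelPlus m := by
  have hSO := SO_map (Int.castRingHom ℚ) (actMat_mem_SO m hg)
  refine ⟨⟨⟨hSO.1, ?_, ?_⟩, discM g, ?_⟩, ?_⟩
  · have := hSO.2
    rw [← S0_map, ← matS0_eq] at this
    exact this
  · have hinv : g * g.adjugate = 1 := by rw [Matrix.mul_adjugate, hg, one_smul]
    ext v
    constructor
    · rintro ⟨_, ⟨w, rfl⟩, rfl⟩
      exact ⟨actMat g *ᵥ w, (map_cast_mulVec _ _).symm⟩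
    · rintro ⟨w, rfl⟩
      refine ⟨_, ⟨actMat g.adjugate *ᵥ w, rfl⟩, ?_⟩
      simp only [map_cast_mulVec, Matrix.mulVec_mulVec, ← actMat_mul, hinv, actMat_one,
        Matrix.one_mulVec]
  · rw [matS0_eq]
    conv_lhs => rw [actMat_eq_one_add_discM hg]
    rw [Matrix.map_add _ (by intros; push_cast; rfl)]
    congr 1
    ext i j; by_cases h : i = j <;> simp [Matrix.one_apply, h]
  · rw [realSO_eq, Matrix.map_map]
    have : (actMat g).map ((Rat.cast : ℚ → ℝ) ∘ (Int.cast : ℤ → ℚ)) =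
        actMat (g.map (mapQ (Int.castRingHom ℝ))) := by
      rw [actMat_map]
      ext i j; simp
    rw [this]
    exact actMat_mem_component (disc_neg_real m) _ (det_map_mapQ _ hg)

/-- In a principal ideal domain, a nonzero pair is a multiple of a unimodular pair. -/
lemma exists_eq_mul_isCoprime {A : Type*} [CommRing A] [IsDomain A] [IsPrincipalIdealRing A]
    {x y : A} (h : ¬ (x = 0 ∧ y = 0)) :
    ∃ d u v, d ≠ 0 ∧ x = d * u ∧ y = d * v ∧ IsCoprime u v := by
  obtain ⟨d, hd⟩ := IsPrincipalIdealRing.principal (Ideal.span {x, y})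
  change _ = Ideal.span {d} at hd
  have hx : x ∈ Ideal.span {d} := hd ▸ Ideal.subset_span (by simp)
  have hy : y ∈ Ideal.span {d} := hd ▸ Ideal.subset_span (by simp)
  obtain ⟨u, hu⟩ := Ideal.mem_span_singleton.1 hx
  obtain ⟨v, hv⟩ := Ideal.mem_span_singleton.1 hy
  have hd' : d ∈ Ideal.span {x, y} := hd ▸ Ideal.subset_span (by simp)
  obtain ⟨s, t, hst⟩ := Ideal.mem_span_pair.1 hd'
  have hd0 : d ≠ 0 := by
    rintro rfl
    exact h ⟨by simpa using hu, by simpa using hv⟩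
  refine ⟨d, u, v, hd0, hu, hv, s, t, mul_left_cancel₀ hd0 ?_⟩
  rw [hu, hv] at hst
  linear_combination hst

lemma algebraMap_dvd_of_dvd {F : Type*} [CommRing F] {a b : F} {s : F}
    {z : QuadraticAlgebra F a b} (h : algebraMap F _ s ∣ z) : s ∣ z.trace := by
  obtain ⟨w, rfl⟩ := h
  refine ⟨w.trace, ?_⟩
  simp [QuadraticAlgebra.trace_def]; ring

lemma norm_add' {F : Type*} [CommRing F] {a b : F} (x y : QuadraticAlgebra F a b) :
    (x + y).norm = x.norm + y.norm + (x * star y).trace := by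
  simp [QuadraticAlgebra.norm_def, QuadraticAlgebra.trace_def]; ring

/-- A primitive positive isotropic Hermitian matrix over a ring of class number one is
`( N(u)  u v̄ ; ū v  N(v) )` with `u`, `v` coprime. -/
lemma exists_isotropic_eq (m : ℕ) [NeZero m] [IsPrincipalIdealRing (R m)] {a c : ℤ} {β : R m}
    (hac : a * c = β.norm) (hpos : 0 < a + c)
    (hprim : ∀ r : ℤ, r ∣ a → algebraMap ℤ (R m) r ∣ β → r ∣ c → IsUnit r) :
    ∃ u v : R m, IsCoprime u v ∧ a = u.norm ∧ β = u * star v ∧ c = v.norm := by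
  have hn := norm_nonneg' m β
  have ha0 : 0 ≤ a := by nlinarith
  have hc0 : 0 ≤ c := by nlinarith
  rcases ha0.eq_or_lt with rfl | ha
  · have hβ : β = 0 := (norm_eq_zero' m).1 (by rw [← hac, zero_mul])
    have hc : IsUnit c := hprim c (dvd_zero _) (hβ ▸ dvd_zero _) dvd_rfl
    have hc1 : c = 1 := by rcases Int.isUnit_iff.1 hc with h | h <;> omega
    exact ⟨0, 1, isCoprime_zero_left.2 isUnit_one, by simp, by simp [hβ], by simp [hc1]⟩
  have hca : algebraMap ℤ (R m) a ≠ 0 := by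
    rw [Ne, ← map_zero (algebraMap ℤ (R m)), QuadraticAlgebra.algebraMap_inj]; exact ha.ne'
  obtain ⟨d, u, v, hd, hu, hv, huv⟩ := exists_eq_mul_isCoprime (x := algebraMap ℤ (R m) a)
    (y := star β) (fun h => hca h.1)
  have hH := norm_pos' m hd
  -- the three entries, multiplied by `a`, are `N(d)` times those of the asserted matrix
  have e1 : a * a = d.norm * u.norm := by
    rw [← map_mul, ← hu, QuadraticAlgebra.norm_algebraMap, sq]
  have e3 : a * c = d.norm * v.norm := by
    rw [← map_mul, ← hv, QuadraticAlgebra.norm_star, hac]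
  have e2 : algebraMap ℤ (R m) a * β = algebraMap ℤ (R m) d.norm * (u * star v) := by
    rw [QuadraticAlgebra.algebraMap_norm_eq_mul_star]
    calc algebraMap ℤ (R m) a * β = algebraMap ℤ (R m) a * star (star β) := by rw [star_star]
      _ = (d * u) * star (d * v) := by rw [← hu, ← hv]
      _ = _ := by rw [star_mul]; ring
  -- `a / N(d) = s / r` in lowest terms; both `s` and `r` turn out to be `1`
  obtain ⟨g, s, r, hg, hs, hr, hsr⟩ := exists_eq_mul_isCoprime (x := a) (y := d.norm)
    (fun h => ha.ne' h.1)
  wlog hg0 : 0 < g generalizing g s r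
  · exact this (-g) (-s) (-r) (neg_ne_zero.2 hg) (by linarith) (by linarith) hsr.neg_neg
      (by omega)
  have hs0 : 0 < s := pos_of_mul_pos_right (hs ▸ ha) hg0.le
  have hr0 : 0 < r := pos_of_mul_pos_right (hr ▸ hH) hg0.le
  have hgR : algebraMap ℤ (R m) g ≠ 0 := by
    rw [Ne, ← map_zero (algebraMap ℤ (R m)), QuadraticAlgebra.algebraMap_inj]; exact hg
  have f1 : s * a = r * u.norm := by
    apply mul_left_cancel₀ hg; rw [← mul_assoc, ← mul_assoc, ← hs, ← hr, e1]
  have f3 : s * c = r * v.norm := by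
    apply mul_left_cancel₀ hg; rw [← mul_assoc, ← mul_assoc, ← hs, ← hr, e3]
  have f2 : algebraMap ℤ (R m) s * β = algebraMap ℤ (R m) r * (u * star v) := by
    apply mul_left_cancel₀ hgR
    rw [← mul_assoc, ← mul_assoc, ← map_mul, ← map_mul, ← hs, ← hr, e2]
  have g1 : s ∣ u.norm := hsr.dvd_of_dvd_mul_left ⟨a, f1.symm⟩
  have g3 : s ∣ v.norm := hsr.dvd_of_dvd_mul_left ⟨c, f3.symm⟩
  have g2 : algebraMap ℤ (R m) s ∣ u * star v :=
    (hsr.map (algebraMap ℤ (R m))).dvd_of_dvd_mul_left ⟨β, f2.symm⟩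
  obtain ⟨x, y, hxy⟩ := huv
  have hs1 : s = 1 := by
    have : s ∣ (1 : R m).norm := by
      rw [← hxy, norm_add', map_mul, map_mul]
      refine dvd_add (dvd_add (g1.mul_left _) (g3.mul_left _)) (algebraMap_dvd_of_dvd ?_)
      rw [star_mul, show x * u * (star v * star y) = u * star v * (x * star y) by ring]
      exact g2.mul_right _
    rw [QuadraticAlgebra.norm_one] at this
    exact Int.eq_one_of_dvd_one hs0.le this
  rw [hs1, one_mul] at f1 f3
  rw [hs1, map_one, one_mul] at f2
  have hr1 : r = 1 := by
    have := hprim r ⟨_, f1⟩ ⟨_, f2⟩ ⟨_, f3⟩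
    rcases Int.isUnit_iff.1 this with h | h <;> omega
  rw [hr1, one_mul] at f1 f3
  rw [hr1, map_one, one_mul] at f2
  exact ⟨u, v, ⟨x, y, hxy⟩, f1, f2, f3⟩

/-- The discriminant kernel of the integral special orthogonal group. -/
def discZ (m : ℕ) : Submonoid (Matrix (Fin 4) (Fin 4) ℤ) where
  carrier := {G | G ∈ SO (paramA m) (paramB m) ∧
    ∃ M : Matrix (Fin 4) (Fin 4) ℤ, G = 1 + M * S0 (paramA m) (paramB m)}
  one_mem' := ⟨one_mem _, 0, by simp⟩
  mul_mem' := by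
    rintro g h ⟨hg, M, hM⟩ ⟨hh, N, hN⟩
    refine ⟨mul_mem hg hh, M + N + M * S0 (paramA m) (paramB m) * N, ?_⟩
    rw [hM, hN]
    noncomm_ring

lemma actMat_mem_discZ (m : ℕ) [NeZero m] {g : Matrix (Fin 2) (Fin 2) (R m)} (hg : g.det = 1) :
    actMat g ∈ discZ m :=
  ⟨actMat_mem_SO m hg, discM g, actMat_eq_one_add_discM hg⟩

/-- A unit of norm one congruent to `1` modulo the different is the square of a unit of norm one. -/
lemma exists_sq_eq_of_congr_one (m : ℕ) [NeZero m] {ζ : R m} (hζ : ζ.norm = 1) {n : ℤ}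
    (hn : 0 ≤ n) (h : (ζ - 1).norm = -(paramB m ^ 2 + 4 * paramA m) * n) :
    ∃ μ : R m, μ.norm = 1 ∧ μ * μ = ζ := by
  have hT : (ζ - 1).norm = 2 - ζ.trace := by
    rw [QuadraticAlgebra.norm_def] at hζ
    rw [QuadraticAlgebra.norm_def, QuadraticAlgebra.trace_def]
    simp only [QuadraticAlgebra.re_sub, QuadraticAlgebra.im_sub, QuadraticAlgebra.re_one,
      QuadraticAlgebra.im_one]
    linear_combination hζ
  have h4 := four_mul_norm m ζ
  rw [hζ] at h4
  have hd := disc_le m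
  set d := -(paramB m ^ 2 + 4 * paramA m) with hd'
  -- `N(ζ - 1) = 2 - T(ζ)` is at most `4` and a multiple of `|d| ≥ 3`, which leaves `ζ = 1`, a
  -- primitive cube root of unity, or `ζ = -1` with `d = -4`
  have hT2 : ζ.trace ^ 2 ≤ 4 := by nlinarith [sq_nonneg ζ.im]
  have hT3 : -2 ≤ ζ.trace ∧ ζ.trace ≤ 2 := ⟨by nlinarith, by nlinarith⟩
  have hdn : d * n = 2 - ζ.trace := by rw [← h, hT]
  have hsq := QuadraticAlgebra.sq_eq_trace_smul_sub_norm ζ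
  rw [hζ, map_one] at hsq
  rcases hn.eq_or_lt with rfl | hn
  · have : ζ = 1 := sub_eq_zero.1 ((norm_eq_zero' m).1 (by rw [h, mul_zero]))
    exact ⟨1, by simp, by simp [this]⟩
  have hn1 : n = 1 := by nlinarith
  rw [hn1, mul_one] at hdn
  have hcase : ζ.trace = -1 ∨ ζ.trace = -2 := by omega
  rcases hcase with ht | ht
  · refine ⟨ζ * ζ, by rw [map_mul, hζ, mul_one], ?_⟩
    rw [ht] at hsq
    have h1 : ζ ^ 2 = -ζ - 1 := by rw [hsq]; simp
    linear_combination (ζ ^ 2 - ζ) * h1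
  · have hm1 : paramB m = 0 ∧ paramA m = -1 := by
      rcases param_cases m with ⟨h1, h2, h3⟩ | ⟨h1, h2, h3⟩
      · rw [h2] at hd'; omega
      · rw [h2] at hd'; exact ⟨h2, by omega⟩
    have hz : ζ = -1 := by
      have : (ζ + 1) ^ 2 = 0 := by
        rw [ht] at hsq
        have : (-2 : ℤ) • ζ = -2 * ζ := by simp
        rw [this] at hsq
        linear_combination hsq
      exact eq_neg_of_add_eq_zero_left (by simpa using this)
    refine ⟨⟨0, 1⟩, ?_, ?_⟩
    · rw [QuadraticAlgebra.norm_def]; simp [hm1]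
    · rw [hz]; ext <;> simp [hm1]

/-- An element of the discriminant kernel fixing both isotropic basis vectors is the action of a
diagonal matrix. -/
lemma exists_actMat_of_fix (m : ℕ) [NeZero m] {G : Matrix (Fin 4) (Fin 4) ℤ} (hG : G ∈ discZ m)
    (h0 : G.col 0 = ![1, 0, 0, 0]) (h3 : G.col 3 = ![0, 0, 0, 1]) :
    ∃ g : Matrix (Fin 2) (Fin 2) (R m), g.det = 1 ∧ G = actMat g := by
  obtain ⟨⟨hdet, hiso⟩, M, hM⟩ := hG
  have c00 := congrFun h0 0
  have c10 := congrFun h0 1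
  have c20 := congrFun h0 2
  have c30 := congrFun h0 3
  have c03 := congrFun h3 0
  have c13 := congrFun h3 1
  have c23 := congrFun h3 2
  have c33 := congrFun h3 3
  simp [Matrix.col_apply] at c00 c10 c20 c30 c03 c13 c23 c33
  have key : ∀ i j, (Gᵀ * S0 (paramA m) (paramB m) * G) i j = S0 (paramA m) (paramB m) i j :=
    fun i j => by rw [hiso]
  have c31 : G 3 1 = 0 := by
    simpa [Matrix.mul_apply, Fin.sum_univ_succ, S0, c00, c10, c20, c30] using key 0 1
  have c32 : G 3 2 = 0 := by
    simpa [Matrix.mul_apply, Fin.sum_univ_succ, S0, c00, c10, c20, c30] using key 0 2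
  have c01 : G 0 1 = 0 := by
    simpa [Matrix.mul_apply, Fin.sum_univ_succ, S0, c03, c13, c23, c33] using key 3 1
  have c02 : G 0 2 = 0 := by
    simpa [Matrix.mul_apply, Fin.sum_univ_succ, S0, c03, c13, c23, c33] using key 3 2
  have k11 := key 1 1
  have k12 := key 1 2
  simp [Matrix.mul_apply, Fin.sum_univ_succ, S0, c01, c31, c02] at k11 k12
  have hdet' : G 1 1 * G 2 2 - G 1 2 * G 2 1 = 1 := by
    rw [Matrix.det_succ_row_zero] at hdet
    simp [Fin.sum_univ_succ, c00, c01, c02, c03, Matrix.det_fin_three, c30, c31, c32, c33,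
      Matrix.submatrix_apply, c13, c23] at hdet
    linarith
  obtain ⟨ζ, hζ⟩ : ∃ ζ : R m, ζ = ⟨G 1 1, G 2 1⟩ := ⟨_, rfl⟩
  obtain ⟨η, hη⟩ : ∃ η : R m, η = ⟨G 1 2, G 2 2⟩ := ⟨_, rfl⟩
  have hN : ζ.norm = 1 := by
    rw [hζ, QuadraticAlgebra.norm_def]
    have : (2 : ℤ) ≠ 0 := two_ne_zero
    apply mul_left_cancel₀ this
    simp only
    linear_combination -k11
  have hκ : star ζ * η = ⟨0, 1⟩ := by
    have him : (star ζ * η).im = 1 := by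
      rw [hζ, hη]; simp; linear_combination hdet'
    ext
    · have : (2 : ℤ) ≠ 0 := two_ne_zero
      apply mul_left_cancel₀ this
      have h' : (star ζ * η).trace = paramB m := by
        rw [hζ, hη, QuadraticAlgebra.trace_def]; simp
        linear_combination -k12
      rw [QuadraticAlgebra.trace_def, him] at h'
      simp only
      linear_combination h'
    · exact him
  have hηζ : η = ζ * ⟨0, 1⟩ := by
    rw [← hκ, ← mul_assoc, ← QuadraticAlgebra.algebraMap_norm_eq_mul_star, hN, map_one, one_mul]
  have hMij : ∀ i j, G i j = (1 : Matrix (Fin 4) (Fin 4) ℤ) i j +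
      (M * S0 (paramA m) (paramB m)) i j := fun i j => by
    conv_lhs => rw [hM]
    rfl
  -- `(ζ - 1) δ = d μ` for the generator `δ = 2ω - B` of the different, of square `d`
  obtain ⟨μ, hμ⟩ : ∃ μ : R m, μ = ⟨M 1 2, M 2 2⟩ := ⟨_, rfl⟩
  have hmu : (ζ - 1) * ⟨-paramB m, 2⟩ =
      algebraMap ℤ (R m) (paramB m ^ 2 + 4 * paramA m) * μ := by
    have e : (ζ - 1) * ⟨-paramB m, 2⟩ =
        2 * (η - ⟨0, 1⟩) - algebraMap ℤ (R m) (paramB m) * (ζ - 1) := by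
      rw [hηζ]; ext <;> simp <;> ring
    rw [e, hζ, hη, hμ]
    have m11 := hMij 1 1
    have m12 := hMij 1 2
    have m21 := hMij 2 1
    have m22 := hMij 2 2
    simp [Matrix.mul_apply, Fin.sum_univ_succ, S0] at m11 m12 m21 m22
    rw [sq]
    ext
    · simp; linear_combination 2 * m12 - paramB m * m11
    · simp; linear_combination 2 * m22 - paramB m * m21
  have hnorm : (ζ - 1).norm = -(paramB m ^ 2 + 4 * paramA m) * μ.norm := by
    have h1 := congrArg QuadraticAlgebra.norm hmu
    rw [map_mul, map_mul, QuadraticAlgebra.norm_algebraMap] at h1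
    have h2 : (⟨-paramB m, 2⟩ : R m).norm = -(paramB m ^ 2 + 4 * paramA m) := by
      rw [QuadraticAlgebra.norm_def]; ring
    rw [h2] at h1
    have hd := (disc_neg m).ne
    apply mul_left_cancel₀ (neg_ne_zero.2 hd)
    linear_combination h1
  obtain ⟨ν, hν, hνζ⟩ := exists_sq_eq_of_congr_one m hN (norm_nonneg' m μ) hnorm
  have hνν : ν * star ν = 1 := by
    rw [← QuadraticAlgebra.algebraMap_norm_eq_mul_star, hν, map_one]
  refine ⟨!![ν, 0; 0, star ν], by rw [Matrix.det_fin_two]; simpa using hνν, ?_⟩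
  have hact : ∀ v, act !![ν, 0; 0, star ν] v =
      ![v 0, (ζ * ⟨v 1, v 2⟩).re, (ζ * ⟨v 1, v 2⟩).im, v 3] := fun v => by
    have e1 : ν * .C (v 0) * star ν = .C (v 0) := by rw [mul_right_comm, hνν, one_mul]
    have e2 : ν * (⟨v 1, v 2⟩ : R m) * ν = ζ * ⟨v 1, v 2⟩ := by rw [← hνζ]; ring
    have e3 : star ν * .C (v 3) * ν = .C (v 3) := by
      rw [mul_right_comm, mul_comm (star ν), hνν, one_mul]
    rw [act_apply]
    simp only [Matrix.of_apply, Matrix.cons_val', Matrix.cons_val_zero, Matrix.cons_val_fin_one,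
      Matrix.cons_val_one, star_star, star_zero, mul_zero, zero_mul, add_zero, zero_add, e1, e2,
      e3, QuadraticAlgebra.re_C]
  have g11 : G 1 1 = ζ.re := by rw [hζ]
  have g21 : G 2 1 = ζ.im := by rw [hζ]
  have g12 : G 1 2 = (ζ * ⟨0, 1⟩).re := by rw [← hηζ, hη]
  have g22 : G 2 2 = (ζ * ⟨0, 1⟩).im := by rw [← hηζ, hη]
  ext i j
  rw [actMat_apply, hact]
  fin_cases j
  · fin_cases i <;> simp [c00, c10, c20, c30]
  · fin_cases i <;> simp [c01, c31, g11, g21]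
  · fin_cases i <;> simp [c02, c32, g12, g22]
  · fin_cases i <;> simp [c03, c13, c23, c33]

/-- The image of `e₁` is a primitive isotropic vector in the positive cone, hence in the
`SL₂`-orbit of `e₁`; after this the image of `e₄` is moved to `e₄` by a translation, and the
remaining isometry fixes both. -/
lemma exists_actMat_of_mem_discZ (m : ℕ) [NeZero m] [IsPrincipalIdealRing (R m)]
    {G : Matrix (Fin 4) (Fin 4) ℤ} (hG : G ∈ discZ m) (hpos : 0 < G 0 0 + G 3 0) :
    ∃ g : Matrix (Fin 2) (Fin 2) (R m), g.det = 1 ∧ G = actMat g := by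
  have hiso := hG.1.2
  have k00 : (Gᵀ * S0 (paramA m) (paramB m) * G) 0 0 = S0 (paramA m) (paramB m) 0 0 := by rw [hiso]
  simp [Matrix.mul_apply, Fin.sum_univ_succ, S0] at k00
  obtain ⟨u, v, ⟨s, t, hst⟩, hu, huv, hv⟩ := exists_isotropic_eq m (a := G 0 0) (c := G 3 0)
    (β := ⟨G 1 0, G 2 0⟩)
    (by
      rw [QuadraticAlgebra.norm_def]
      apply mul_left_cancel₀ (two_ne_zero : (2 : ℤ) ≠ 0)
      simp only
      linear_combination k00) hpos
    -- a common divisor of the first column divides the determinant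
    (fun r ha hb hc => by
      have h1 : G.adjugate * G = 1 := by rw [Matrix.adjugate_mul, hG.1.1, one_smul]
      have h2 : (G.adjugate * G) 0 0 = 1 := by rw [h1]; rfl
      rw [Matrix.mul_apply] at h2
      obtain ⟨hb1, hb2⟩ := QuadraticAlgebra.algebraMap_dvd_iff.1 hb
      apply isUnit_of_dvd_one
      rw [← h2]
      refine Finset.dvd_sum fun i _ => Dvd.dvd.mul_left ?_ _
      fin_cases i <;> assumption)
  have hcol0 : G.col 0 = act !![u, -t; v, s] (![1, 0, 0, 0] : Fin 4 → ℤ) := by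
    rw [act_apply]
    have huv1 := congrArg QuadraticAlgebra.re huv
    have huv2 := congrArg QuadraticAlgebra.im huv
    simp only at huv1 huv2
    ext i
    fin_cases i
    · simp [Matrix.col_apply, hu, QuadraticAlgebra.norm_def]; ring
    · simp [Matrix.col_apply, huv1]
    · simp [Matrix.col_apply, huv2]
    · simp [Matrix.col_apply, hv, QuadraticAlgebra.norm_def]; ring
  have hdet : (!![u, -t; v, s] : Matrix (Fin 2) (Fin 2) (R m)).det = 1 := by
    rw [Matrix.det_fin_two]; simp; linear_combination hst
  generalize !![u, -t; v, s] = g at hdet hcol0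
  have hadj : g.adjugate.det = 1 := by
    rw [Matrix.det_adjugate, hdet, one_pow]
  have hG1 := mul_mem (actMat_mem_discZ m hadj) hG
  obtain ⟨G1, hG1'⟩ : ∃ G1, G1 = actMat g.adjugate * G := ⟨_, rfl⟩
  have hGG1 : G = actMat g * G1 := by
    rw [hG1', ← mul_assoc, ← actMat_mul, Matrix.mul_adjugate, hdet, one_smul, actMat_one, one_mul]
  rw [← hG1'] at hG1
  have hc0 : G1.col 0 = ![1, 0, 0, 0] := by
    have : G1.col 0 = actMat g.adjugate *ᵥ G.col 0 := by
      rw [hG1']; rfl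
    rw [this, hcol0, actMat_mulVec, ← act_mul, Matrix.adjugate_mul, hdet, one_smul, act_one]
  have k03 : (G1ᵀ * S0 (paramA m) (paramB m) * G1) 0 3 = S0 (paramA m) (paramB m) 0 3 := by
    rw [hG1.1.2]
  have k33 : (G1ᵀ * S0 (paramA m) (paramB m) * G1) 3 3 = S0 (paramA m) (paramB m) 3 3 := by
    rw [hG1.1.2]
  have c00 := congrFun hc0 0
  have c10 := congrFun hc0 1
  have c20 := congrFun hc0 2
  have c30 := congrFun hc0 3
  simp [Matrix.col_apply] at c00 c10 c20 c30
  simp [Matrix.mul_apply, Fin.sum_univ_succ, S0, c00, c10, c20, c30] at k03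
  simp [Matrix.mul_apply, Fin.sum_univ_succ, S0, k03] at k33
  -- isometry determines the last column of `G1` by its middle entries `x`
  obtain ⟨x, hx⟩ : ∃ x : R m, x = ⟨G1 1 3, G1 2 3⟩ := ⟨_, rfl⟩
  have hx0 : G1 0 3 = x.norm := by
    rw [hx, QuadraticAlgebra.norm_def]
    apply mul_left_cancel₀ (two_ne_zero : (2 : ℤ) ≠ 0)
    simp only
    linear_combination k33
  have hup : ∀ x : R m, (upper x).det = 1 := fun x => by
    rw [Matrix.det_fin_two]; simp [upper]
  have hinv : upper (-x) * upper x = 1 := by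
    ext1 i j; fin_cases i <;> fin_cases j <;> simp [upper, Matrix.mul_apply, Fin.sum_univ_two]
  have hinv' : upper x * upper (-x) = 1 := by
    ext1 i j; fin_cases i <;> fin_cases j <;> simp [upper, Matrix.mul_apply, Fin.sum_univ_two]
  obtain ⟨G2, hG2'⟩ : ∃ G2, G2 = actMat (upper (-x)) * G1 := ⟨_, rfl⟩
  have hG2 := mul_mem (actMat_mem_discZ m (hup (-x))) hG1
  rw [← hG2'] at hG2
  have hG12 : G1 = actMat (upper x) * G2 := by
    rw [hG2', ← mul_assoc, ← actMat_mul, hinv', actMat_one, one_mul]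
  have hcol : ∀ j, G2.col j = actMat (upper (-x)) *ᵥ G1.col j := fun j => by rw [hG2']; rfl
  obtain ⟨g2, hg2, hgG2⟩ := exists_actMat_of_fix m hG2
    (by
      rw [hcol, hc0, actMat_upper]
      ext i; fin_cases i <;> simp [Matrix.mulVec, dotProduct, Fin.sum_univ_succ])
    (by
      have h3 : G1.col 3 = actMat (upper x) *ᵥ ![0, 0, 0, 1] := by
        rw [actMat_upper]
        ext i
        fin_cases i <;> simp [Matrix.mulVec, dotProduct, Fin.sum_univ_succ, Matrix.col_apply, hx0,
          k03]
        · rw [hx]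
        · rw [hx]
      rw [hcol, h3, Matrix.mulVec_mulVec, ← actMat_mul, hinv, actMat_one, Matrix.one_mulVec])
  exact ⟨g * (upper x * g2), by rw [Matrix.det_mul, Matrix.det_mul, hdet, hup, hg2]; simp,
    by rw [hGG1, hG12, hgG2, actMat_mul, actMat_mul]⟩

/-- The elements of the connected discriminant kernel are exactly the actions of the elements of
`SL₂` over the ring of integers. -/
theorem mem_discKernelPlus_iff (m : ℕ) [NeZero m] [IsPrincipalIdealRing (R m)]
    (γ : Matrix (Fin 4) (Fin 4) ℚ) :
    γ ∈ discKernelPlus m ↔ ∃ g : Matrix (Fin 2) (Fin 2) (R m), g.det = 1 ∧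
      γ = (actMat g).map (Int.cast : ℤ → ℚ) := by
  refine ⟨?_, fun ⟨g, hg, h⟩ => h ▸ actMat_mem_discKernelPlus m hg⟩
  rintro ⟨⟨⟨hdet, hiso, -⟩, M, hM⟩, hcomp⟩
  obtain ⟨G, hG⟩ : ∃ G, G = 1 + M * S0 (paramA m) (paramB m) := ⟨_, rfl⟩
  have hγ : γ = G.map (Int.cast : ℤ → ℚ) := by
    rw [hM, hG, Matrix.map_add _ (by intros; push_cast; rfl), matS0_eq]
    congr 1
    ext i j; by_cases h : i = j <;> simp [Matrix.one_apply, h]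
  rw [realSO_eq] at hcomp
  have hpos := pos_of_mem_component (disc_neg_real m) hcomp
  have hSO : G ∈ SO (paramA m) (paramB m) := by
    apply SO_of_map (Int.castRingHom ℚ) Int.cast_injective
    refine ⟨by rw [← hdet, hγ]; rfl, ?_⟩
    rw [← S0_map, ← matS0_eq]
    rw [hγ] at hiso
    exact hiso
  have hpos' : 0 < G 0 0 + G 3 0 := by
    rw [hγ] at hpos
    simp at hpos
    exact_mod_cast hpos
  obtain ⟨g, hg, h⟩ := exists_actMat_of_mem_discZ m ⟨hSO, M, hG⟩ hpos'
  exact ⟨g, hg, by rw [hγ, h]⟩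

/-! ### Representation numbers as numbers of classes of unimodular rows -/

lemma matSQ_eq (m : ℕ) :
    matSQ m = !![2, (paramB m : ℚ); (paramB m : ℚ), -2 * (paramA m : ℚ)] := by
  rw [matSQ, matS_eq]
  ext i j; fin_cases i <;> fin_cases j <;> simp

lemma det_matSQ (m : ℕ) : (matSQ m).det = -((paramB m : ℚ) ^ 2 + 4 * paramA m) := by
  rw [matSQ_eq, Matrix.det_fin_two_of]; ring

lemma isUnit_det_matSQ (m : ℕ) [NeZero m] : IsUnit (matSQ m).det := by
  rw [det_matSQ]
  have h : ((paramB m : ℚ) ^ 2 + 4 * paramA m) < 0 := by exact_mod_cast disc_neg m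
  exact (neg_ne_zero.2 h.ne).isUnit

lemma level_pos (m : ℕ) [NeZero m] : 0 < level m := by
  have hd : ((paramB m : ℚ) ^ 2 + 4 * paramA m) < 0 := by exact_mod_cast disc_neg m
  have hne : {q : ℕ | 0 < q ∧ ∀ x ∈ dualL m,
      ∃ k : ℤ, (q : ℚ) * (-(x ⬝ᵥ (matSQ m *ᵥ x)) / 2) = k}.Nonempty := by
    refine ⟨(-(paramB m ^ 2 + 4 * paramA m)).toNat, by have := disc_neg m; omega, ?_⟩
    intro x hx
    obtain ⟨k, hk⟩ := hx ![1, 0]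
    obtain ⟨l, hl⟩ := hx ![0, 1]
    have hq : (((-(paramB m ^ 2 + 4 * paramA m)).toNat : ℕ) : ℚ) =
        -((paramB m : ℚ) ^ 2 + 4 * paramA m) := by
      have : (((-(paramB m ^ 2 + 4 * paramA m)).toNat : ℕ) : ℤ) =
        -(paramB m ^ 2 + 4 * paramA m) := Int.toNat_of_nonneg (by have := disc_neg m; omega)
      exact_mod_cast this
    rw [matSQ_eq] at hk hl
    simp [Matrix.mulVec, dotProduct] at hk hl
    refine ⟨paramA m * k ^ 2 + paramB m * k * l - l ^ 2, ?_⟩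
    rw [hq, matSQ_eq]
    simp [Matrix.mulVec, dotProduct]
    rw [← hk, ← hl]
    ring
  exact (Nat.sInf_mem hne).1

lemma norm_coords (m : ℕ) (t : Fin 2 → ℤ) :
    (fun i => (t i : ℚ)) ⬝ᵥ (matSQ m *ᵥ fun i => (t i : ℚ)) =
      2 * ((⟨t 0, t 1⟩ : R m).norm : ℚ) := by
  rw [matSQ_eq, QuadraticAlgebra.norm_def]
  simp [Matrix.mulVec, dotProduct]
  ring

lemma matSQ_mulVec_cast (m : ℕ) (t : Fin 2 → ℤ) :
    (fun i => ((matS m *ᵥ t) i : ℚ)) = matSQ m *ᵥ fun i => (t i : ℚ) := by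
  ext i
  simp [matSQ, Matrix.mulVec, dotProduct]

lemma inv_matSQ_mulVec (m : ℕ) [NeZero m] (t : Fin 2 → ℤ) :
    (matSQ m)⁻¹ *ᵥ (fun i => ((matS m *ᵥ t) i : ℚ)) = fun i => (t i : ℚ) := by
  rw [matSQ_mulVec_cast, Matrix.mulVec_mulVec, Matrix.nonsing_inv_mul _ (isUnit_det_matSQ m),
    Matrix.one_mulVec]

lemma halfQSInv_mulVec (m : ℕ) [NeZero m] (t : Fin 2 → ℤ) :
    halfQSInv m (matS m *ᵥ t) = level m * ((⟨t 0, t 1⟩ : R m).norm : ℚ) := by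
  rw [halfQSInv, inv_matSQ_mulVec, matSQ_mulVec_cast, dotProduct_comm, norm_coords]
  ring

lemma matS_mulVec_injective (m : ℕ) [NeZero m] : Function.Injective fun t => matS m *ᵥ t := by
  intro t t' h
  have h1 := inv_matSQ_mulVec m t
  simp only at h
  rw [h, inv_matSQ_mulVec] at h1
  ext i
  exact_mod_cast (congrFun h1 i).symm

lemma mkQ_matS_eq_iff (m : ℕ) [NeZero m] (d : ℕ) (t t' : Fin 2 → ℤ) :
    (dSLattice m d).mkQ (matS m *ᵥ t) = (dSLattice m d).mkQ (matS m *ᵥ t') ↔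
      ∃ x : Fin 2 → ℤ, t = t' + (d : ℤ) • x := by
  rw [Submodule.mkQ_apply, Submodule.mkQ_apply, Submodule.Quotient.eq, dSLattice,
    LinearMap.mem_range]
  constructor
  · rintro ⟨x, hx⟩
    refine ⟨x, matS_mulVec_injective m ?_⟩
    rw [Matrix.mulVecLin_apply, Matrix.smul_mulVec] at hx
    simp only [Matrix.mulVec_add, Matrix.mulVec_smul, hx]
    abel
  · rintro ⟨x, rfl⟩
    refine ⟨x, ?_⟩
    rw [Matrix.mulVecLin_apply, Matrix.smul_mulVec, Matrix.mulVec_add, Matrix.mulVec_smul]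
    abel

/-- The determinant of the Hermitian matrix with coordinates `v`. -/
def detForm (m : ℕ) (v : Fin 4 → ℤ) : ℤ := v 0 * v 3 - (⟨v 1, v 2⟩ : R m).norm

lemma det_Hm (m : ℕ) (v : Fin 4 → ℤ) :
    (Hm v : Matrix (Fin 2) (Fin 2) (R m)).det = algebraMap ℤ (R m) (detForm m v) := by
  rw [Matrix.det_fin_two, detForm, map_sub, QuadraticAlgebra.algebraMap_norm_eq_mul_star]
  simp [Hm]

lemma detForm_act (m : ℕ) {g : Matrix (Fin 2) (Fin 2) (R m)} (hg : g.det = 1) (v : Fin 4 → ℤ) :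
    detForm m (act g v) = detForm m v := by
  apply QuadraticAlgebra.algebraMap_injective (R := ℤ) (a := paramA m) (b := paramB m)
  rw [← det_Hm, ← det_Hm, Hm_act, Matrix.det_mul, Matrix.det_mul, Matrix.det_conjTranspose, hg]
  simp

/-- The value `c H cᴴ` of the Hermitian form with coordinates `v` at the row `c`. -/
def rowForm (m : ℕ) (v : Fin 4 → ℤ) (c : Fin 2 → R m) : ℤ :=
  v 0 * (c 0).norm + (c 0 * ⟨v 1, v 2⟩ * star (c 1)).trace + v 3 * (c 1).norm

lemma act_three (m : ℕ) (g : Matrix (Fin 2) (Fin 2) (R m)) (v : Fin 4 → ℤ) :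
    act g v 3 = rowForm m v (g 1) := by
  rw [act_apply, rowForm, QuadraticAlgebra.norm_def, QuadraticAlgebra.norm_def,
    QuadraticAlgebra.trace_def]
  simp
  ring

/-- Two rows are equivalent under the special unitary group of the Hermitian form with
coordinates `v`. -/
def SURel (m : ℕ) (v : Fin 4 → ℤ) (c c' : Fin 2 → R m) : Prop :=
  ∃ g : Matrix (Fin 2) (Fin 2) (R m), g.det = 1 ∧ act g v = v ∧ c' = c ᵥ* g

lemma exists_completion {A : Type*} [CommRing A] {c : Fin 2 → A} (hc : IsCoprime (c 0) (c 1)) :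
    ∃ h : Matrix (Fin 2) (Fin 2) A, h.det = 1 ∧ h 1 = c := by
  obtain ⟨s, t, hst⟩ := hc
  refine ⟨!![t, -s; c 0, c 1], by rw [Matrix.det_fin_two_of]; linear_combination hst, ?_⟩
  ext i; fin_cases i <;> rfl

lemma isCoprime_row {A : Type*} [CommRing A] {h : Matrix (Fin 2) (Fin 2) A} (hh : h.det = 1) :
    IsCoprime (h 1 0) (h 1 1) := by
  rw [Matrix.det_fin_two] at hh
  exact ⟨-h 0 1, h 0 0, by linear_combination hh⟩

lemma act_upper (m : ℕ) (x : R m) (w : Fin 4 → ℤ) :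
    act (upper x) w 1 = w 1 + w 3 * x.re ∧ act (upper x) w 2 = w 2 + w 3 * x.im ∧
      act (upper x) w 3 = w 3 := by
  rw [← actMat_mulVec, actMat_upper]
  simp [Matrix.mulVec, dotProduct, Fin.sum_univ_succ]
  constructor <;> ring

lemma det_upper {F : Type*} [CommRing F] {a b : F} (x : QuadraticAlgebra F a b) :
    (upper x).det = 1 := by
  rw [upper, Matrix.det_fin_two_of]; ring

/-- Elements of `SL₂` with the same bottom row differ by an upper transvection. -/
lemma exists_upper_mul_eq {F : Type*} [CommRing F] {a b : F}
    {h h' : Matrix (Fin 2) (Fin 2) (QuadraticAlgebra F a b)} (hh : h.det = 1) (hh' : h'.det = 1)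
    (hrow : h 1 = h' 1) : ∃ x, h' = upper x * h := by
  rw [Matrix.det_fin_two] at hh hh'
  have e0 : h' 1 0 = h 1 0 := by rw [hrow]
  have e1 : h' 1 1 = h 1 1 := by rw [hrow]
  rw [e0, e1] at hh'
  refine ⟨h' 0 1 * h 0 0 - h' 0 0 * h 0 1, ?_⟩
  ext1 i j
  fin_cases i <;> fin_cases j <;>
    simp only [upper, Fin.zero_eta, Fin.mk_one, Fin.isValue, Matrix.mul_apply, Matrix.of_apply,
      Matrix.cons_val', Matrix.cons_val_fin_one, Fin.sum_univ_two, Matrix.cons_val_zero,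
      Matrix.cons_val_one, one_mul, zero_mul, zero_add, e0, e1]
  · linear_combination -h' 0 0 * hh + h 0 0 * hh'
  · linear_combination -h' 0 1 * hh + h 0 1 * hh'

lemma eq_of_detForm_eq (m : ℕ) {w w' : Fin 4 → ℤ} (hq : detForm m w = detForm m w')
    (h1 : w 1 = w' 1) (h2 : w 2 = w' 2) (h3 : w 3 = w' 3) (h0 : w 3 ≠ 0) : w = w' := by
  have : w 0 = w' 0 := by
    unfold detForm at hq
    rw [h1, h2, ← h3] at hq
    apply mul_right_cancel₀ h0
    linarith
  ext i; fin_cases i <;> assumption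

/-- Two elements of `SL₂` carry the Hermitian matrix to matrices with lower right entry `d` and
congruent off-diagonal entries modulo `d` if and only if their bottom rows are equivalent. -/
lemma offDiag_congr_iff (m : ℕ) (v : Fin 4 → ℤ) {d : ℕ} (hd : d ≠ 0)
    {h h' : Matrix (Fin 2) (Fin 2) (R m)} (hh : h.det = 1) (hh' : h'.det = 1)
    (hf : rowForm m v (h 1) = d) (hf' : rowForm m v (h' 1) = d) :
    (∃ x : Fin 2 → ℤ, ![act h' v 1, act h' v 2] = ![act h v 1, act h v 2] + (d : ℤ) • x) ↔
      SURel m v (h 1) (h' 1) := by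
  rw [← act_three] at hf hf'
  constructor
  · rintro ⟨x, hx⟩
    have hu := act_upper m ⟨x 0, x 1⟩ (act h v)
    -- translating by `x` makes the two images equal, without changing the bottom row of `h`
    have hdk : (upper ⟨x 0, x 1⟩ * h).det = 1 := by rw [Matrix.det_mul, det_upper, hh, one_mul]
    have heq : act (upper ⟨x 0, x 1⟩ * h) v = act h' v := by
      apply eq_of_detForm_eq m
      · rw [detForm_act m hdk, detForm_act m hh']
      · have := congrFun hx 0
        simp at this
        rw [act_mul, hu.1, this, hf]
      · have := congrFun hx 1
        simp at this
        rw [act_mul, hu.2.1, this, hf]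
      · rw [act_mul, hu.2.2, hf, hf']
      · rw [act_mul, hu.2.2, hf]; exact_mod_cast hd
    have hrow : (upper ⟨x 0, x 1⟩ * h : Matrix (Fin 2) (Fin 2) (R m)) 1 = h 1 := by
      ext1 j; simp [upper, Matrix.mul_apply, Fin.sum_univ_two]
    generalize upper ⟨x 0, x 1⟩ * h = k at hdk heq hrow
    refine ⟨k.adjugate * h', by rw [Matrix.det_mul, Matrix.det_adjugate, hdk, hh']; simp, ?_, ?_⟩
    · rw [act_mul, ← heq, ← act_mul, Matrix.adjugate_mul, hdk, one_smul, act_one]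
    · have : h' = k * (k.adjugate * h') := by
        rw [← mul_assoc, Matrix.mul_adjugate, hdk, one_smul, one_mul]
      conv_lhs => rw [this]
      rw [Matrix.mul_apply_eq_vecMul, hrow]
  · rintro ⟨g, hg, hgv, hrow⟩
    have hdk : (h * g).det = 1 := by rw [Matrix.det_mul, hh, hg, one_mul]
    obtain ⟨x, hx⟩ := exists_upper_mul_eq hdk hh' (by rw [hrow, Matrix.mul_apply_eq_vecMul])
    refine ⟨![x.re, x.im], ?_⟩
    have hu := act_upper m x (act h v)
    have : act h' v = act (upper x) (act h v) := by rw [hx, act_mul, act_mul, hgv]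
    rw [this]
    ext i
    fin_cases i
    · simp [hu.1, hf]
    · simp [hu.2.1, hf]

lemma ncard_image_eq_of_iff {α X Y : Type*} {f : α → X} {g : α → Y} {S : Set α}
    (h : ∀ c ∈ S, ∀ c' ∈ S, f c = f c' ↔ g c = g c') : (f '' S).ncard = (g '' S).ncard := by
  have e1 : f '' S = Prod.fst '' ((fun c => (f c, g c)) '' S) := by
    rw [Set.image_image]
  have e2 : g '' S = Prod.snd '' ((fun c => (f c, g c)) '' S) := by
    rw [Set.image_image]
  have i1 : Set.InjOn Prod.fst ((fun c => (f c, g c)) '' S) := by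
    rintro _ ⟨c, hc, rfl⟩ _ ⟨c', hc', rfl⟩ hcc
    exact Prod.ext hcc ((h c hc c' hc').1 hcc)
  have i2 : Set.InjOn Prod.snd ((fun c => (f c, g c)) '' S) := by
    rintro _ ⟨c, hc, rfl⟩ _ ⟨c', hc', rfl⟩ hcc
    exact Prod.ext ((h c hc c' hc').2 hcc) hcc
  rw [e1, e2, i1.ncard_image, i2.ncard_image]

/-- `n(ξ; d)` is the number of classes of unimodular rows at which the Hermitian form takes the
value `d`, under any invariant `Ψ` that separates the classes. The row is the bottom row of an
element of `SL₂` that carries `ξ` to the vector in question. -/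
theorem repCount_eq_ncard (m ℓ : ℕ) [NeZero m] [IsPrincipalIdealRing (R m)] {v : Fin 4 → ℤ}
    (hv : detForm m v = ℓ) {d : ℕ} (hd : d ≠ 0) {X : Type*} (Ψ : (Fin 2 → R m) → X)
    (hΨ : ∀ c c', rowForm m v c = d → rowForm m v c' = d → (Ψ c = Ψ c' ↔ SURel m v c c')) :
    repCount m ℓ (fun i => (v i : ℚ)) d =
      (Ψ '' {c | IsCoprime (c 0) (c 1) ∧ rowForm m v c = d}).ncard := by
  classical
  -- `comp c` completes a unimodular row `c` to an element of `SL₂`, and `τ c` is the class of the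
  -- corresponding `s`, that is, of the off-diagonal entry, multiplied by `S`
  let comp : (Fin 2 → R m) → Matrix (Fin 2) (Fin 2) (R m) := fun c =>
    if hc : IsCoprime (c 0) (c 1) then (exists_completion hc).choose else 1
  have hcomp : ∀ c : Fin 2 → R m, IsCoprime (c 0) (c 1) → (comp c).det = 1 ∧ comp c 1 = c :=
    fun c hc => by simp only [comp, dif_pos hc]; exact (exists_completion hc).choose_spec
  let τ : (Fin 2 → R m) → (Fin 2 → ℤ) ⧸ dSLattice m d := fun c =>
    (dSLattice m d).mkQ (matS m *ᵥ ![act (comp c) v 1, act (comp c) v 2])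
  have hτ : ∀ c ∈ {c : Fin 2 → R m | IsCoprime (c 0) (c 1) ∧ rowForm m v c = d},
      ∀ c' ∈ {c : Fin 2 → R m | IsCoprime (c 0) (c 1) ∧ rowForm m v c = d},
      τ c = τ c' ↔ Ψ c = Ψ c' := by
    rintro c ⟨hc, hcf⟩ c' ⟨hc', hcf'⟩
    obtain ⟨h1, h2⟩ := hcomp c hc
    obtain ⟨h1', h2'⟩ := hcomp c' hc'
    rw [hΨ c c' hcf hcf', eq_comm, mkQ_matS_eq_iff,
      offDiag_congr_iff m v hd h1 h1' (by rw [h2, hcf]) (by rw [h2', hcf']), h2, h2']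
  rw [← ncard_image_eq_of_iff hτ, repCount]
  congr 1
  have hlev : (level m : ℚ) ≠ 0 := by exact_mod_cast (level_pos m).ne'
  have hdQ : (d : ℚ) ≠ 0 := by exact_mod_cast hd
  ext y
  constructor
  · rintro ⟨s, ⟨-, γ, hγ, hs⟩, rfl⟩
    obtain ⟨g, hg, rfl⟩ := (mem_discKernelPlus_iff m γ).1 hγ
    rw [map_cast_mulVec, actMat_mulVec] at hs
    have h1 := congrFun hs 1
    have h2 := congrFun hs 2
    have h3 := congrFun hs 3
    simp only [repVector, Matrix.cons_val] at h1 h2 h3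
    have hf : rowForm m v (g 1) = d := by
      rw [← act_three]; exact_mod_cast h3.symm
    have hcop := isCoprime_row hg
    obtain ⟨k1, k2⟩ := hcomp (g 1) hcop
    have hst : s = matS m *ᵥ ![act g v 1, act g v 2] := by
      have e : (matSQ m)⁻¹ *ᵥ (fun i => (s i : ℚ)) =
          fun i => ((![act g v 1, act g v 2] : Fin 2 → ℤ) i : ℚ) := by
        ext i; fin_cases i
        · exact h1
        · exact h2
      have e' := congrArg (matSQ m *ᵥ ·) e
      beta_reduce at e'
      rw [Matrix.mulVec_mulVec, Matrix.mul_nonsing_inv _ (isUnit_det_matSQ m), Matrix.one_mulVec,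
        ← matSQ_mulVec_cast] at e'
      ext i
      exact_mod_cast congrFun e' i
    refine ⟨g 1, ⟨hcop, hf⟩, ?_⟩
    rw [hst]
    simp only [τ]
    rw [mkQ_matS_eq_iff, offDiag_congr_iff m v hd hg k1 hf (by rw [k2, hf]), k2]
    exact ⟨1, Matrix.det_one, act_one v, by rw [Matrix.vecMul_one]⟩
  · rintro ⟨c, ⟨hc, hcf⟩, rfl⟩
    obtain ⟨h1, h2⟩ := hcomp c hc
    have hw3 : act (comp c) v 3 = d := by rw [act_three, h2, hcf]
    have hdet := detForm_act m h1 v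
    rw [hv, detForm, hw3] at hdet
    have hhalf := halfQSInv_mulVec m ![act (comp c) v 1, act (comp c) v 2]
    simp only [Matrix.cons_val_zero, Matrix.cons_val_one] at hhalf
    have hdet' : ((act (comp c) v 0 : ℤ) : ℚ) * d -
        ((⟨act (comp c) v 1, act (comp c) v 2⟩ : R m).norm : ℚ) = ℓ := by exact_mod_cast hdet
    refine ⟨matS m *ᵥ ![act (comp c) v 1, act (comp c) v 2], ⟨?_, ?_⟩, rfl⟩
    · refine ⟨-act (comp c) v 0, ?_⟩
      rw [hhalf]; push_cast; linear_combination (level m : ℚ) * hdet'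
    · refine ⟨_, actMat_mem_discKernelPlus m h1, ?_⟩
      rw [map_cast_mulVec, actMat_mulVec, repVector, inv_matSQ_mulVec, hhalf]
      ext i
      fin_cases i
      · simp only [Fin.zero_eta, Matrix.cons_val_zero]
        rw [div_eq_iff (mul_ne_zero hlev hdQ)]
        linear_combination -(level m : ℚ) * hdet'
      · simp
      · simp
      · simp [hw3]

/-! ### The quaternion algebra over `K` -/

section Quaternion

variable {m ℓ : ℕ}

lemma ext_coord {x y : B m ℓ} (h1 : coord₁ m ℓ x = coord₁ m ℓ y)
    (h2 : coord₂ m ℓ x = coord₂ m ℓ y) : x = y := by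
  have a := congrArg QuadraticAlgebra.re h1
  have b := congrArg QuadraticAlgebra.im h1
  have c := congrArg QuadraticAlgebra.re h2
  have d := congrArg QuadraticAlgebra.im h2
  exact QuaternionAlgebra.ext a b c d

/-- The quaternion `g₁ + g₂ ε`. -/
def quat (m ℓ : ℕ) (g₁ g₂ : K m) : B m ℓ := ⟨g₁.re, g₁.im, g₂.re, g₂.im⟩

@[simp] lemma coord₁_quat (g₁ g₂ : K m) : coord₁ m ℓ (quat m ℓ g₁ g₂) = g₁ := rfl

@[simp] lemma coord₂_quat (g₁ g₂ : K m) : coord₂ m ℓ (quat m ℓ g₁ g₂) = g₂ := rfl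

lemma coord₁_add (x y : B m ℓ) : coord₁ m ℓ (x + y) = coord₁ m ℓ x + coord₁ m ℓ y := rfl

lemma coord₂_add (x y : B m ℓ) : coord₂ m ℓ (x + y) = coord₂ m ℓ x + coord₂ m ℓ y := rfl

lemma coord₁_incl_mul (u : K m) (x : B m ℓ) :
    coord₁ m ℓ (incl m ℓ u * x) = u * coord₁ m ℓ x := by
  ext <;> simp [coord₁, incl]

lemma coord₂_incl_mul (u : K m) (x : B m ℓ) :
    coord₂ m ℓ (incl m ℓ u * x) = u * coord₂ m ℓ x := by
  ext <;> simp [coord₂, incl]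

lemma coord₁_mul_incl (x : B m ℓ) (u : K m) :
    coord₁ m ℓ (x * incl m ℓ u) = coord₁ m ℓ x * u := by
  ext <;> simp [coord₁, incl]

lemma coord₂_mul_incl (x : B m ℓ) (u : K m) :
    coord₂ m ℓ (x * incl m ℓ u) = coord₂ m ℓ x * star u := by
  ext <;> simp [coord₂, incl]

lemma coord₁_mul_star (x y : B m ℓ) : coord₁ m ℓ (x * star y) =
    coord₁ m ℓ x * star (coord₁ m ℓ y) +
      algebraMap ℚ (K m) ℓ * (coord₂ m ℓ x * star (coord₂ m ℓ y)) := by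
  ext <;> simp [coord₁, coord₂] <;> ring

lemma coord₂_mul_star (x y : B m ℓ) : coord₂ m ℓ (x * star y) =
    coord₂ m ℓ x * coord₁ m ℓ y - coord₁ m ℓ x * coord₂ m ℓ y := by
  ext <;> simp [coord₁, coord₂] <;> ring

lemma coord₁_eps_mul (x : B m ℓ) :
    coord₁ m ℓ (eps m ℓ * x) = -algebraMap ℚ (K m) ℓ * star (coord₂ m ℓ x) := by
  ext <;> simp [coord₁, coord₂, eps]

lemma coord₂_eps_mul (x : B m ℓ) :
    coord₂ m ℓ (eps m ℓ * x) = star (coord₁ m ℓ x) := by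
  ext <;> simp [coord₁, coord₂, eps]

lemma incl_star (u : K m) : incl m ℓ (star u) = star (incl m ℓ u) := by
  ext <;> simp [incl]

lemma mul_star_self (x : B m ℓ) : x * star x = algebraMap ℚ (B m ℓ) (nrd m ℓ x) := by
  ext <;> simp [nrd] <;> ring

lemma star_mul_self' (x : B m ℓ) : star x * x = algebraMap ℚ (B m ℓ) (nrd m ℓ x) := by
  ext <;> simp [nrd] <;> ring

lemma nrd_star (x : B m ℓ) : nrd m ℓ (star x) = nrd m ℓ x := by
  simp [nrd]

lemma nrd_eq (x : B m ℓ) :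
    nrd m ℓ x = x.re ^ 2 + m * x.imI ^ 2 + ℓ * x.imJ ^ 2 + m * ℓ * x.imK ^ 2 := by
  simp [nrd]; ring

lemma incl_algebraMap (q : ℚ) : incl m ℓ (algebraMap ℚ (K m) q) = algebraMap ℚ (B m ℓ) q := by
  ext <;> simp [incl]

lemma nrd_pos [NeZero m] (hℓ : 0 < ℓ) {x : B m ℓ} (hx : x ≠ 0) : 0 < nrd m ℓ x := by
  have hm : (0 : ℚ) < m := by exact_mod_cast Nat.pos_of_ne_zero (NeZero.ne m)
  have hl : (0 : ℚ) < ℓ := by exact_mod_cast hℓ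
  rw [nrd_eq]
  by_contra h
  have p1 := sq_nonneg x.re
  have p2 := mul_nonneg hm.le (sq_nonneg x.imI)
  have p3 := mul_nonneg hl.le (sq_nonneg x.imJ)
  have p4 := mul_nonneg (mul_pos hm hl).le (sq_nonneg x.imK)
  apply hx
  have e1 : x.re ^ 2 = 0 := by linarith
  have e2 : m * x.imI ^ 2 = 0 := by linarith
  have e3 : ℓ * x.imJ ^ 2 = 0 := by linarith
  have e4 : m * ℓ * x.imK ^ 2 = 0 := by linarith
  ext
  · simpa using e1
  · simpa [hm.ne'] using e2
  · simpa [hl.ne'] using e3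
  · simpa [hm.ne', hl.ne'] using e4

lemma mem_orderO_iff [NeZero m] (hm : Squarefree m) (x : B m ℓ) :
    x ∈ orderO m ℓ ↔ ∃ a b : R m, coord₁ m ℓ x = toK m a ∧ coord₂ m ℓ x = toK m b := by
  constructor
  · rintro ⟨a, b, rfl⟩
    refine ⟨(toOK m hm).symm a, star ((toOK m hm).symm b), ?_, ?_⟩
    · rw [← coe_toOK m hm, RingEquiv.apply_symm_apply]
      ext <;> simp [coord₁, incl, eps]
    · rw [toK_star, ← coe_toOK m hm, RingEquiv.apply_symm_apply]
      ext <;> simp [coord₂, incl, eps]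
  · rintro ⟨a, b, h1, h2⟩
    refine ⟨toOK m hm a, toOK m hm (star b), ?_⟩
    rw [coe_toOK, coe_toOK]
    apply ext_coord
    · rw [h1]; ext <;> simp [coord₁, incl, eps]
    · rw [h2, toK_star]; ext <;> simp [coord₂, incl, eps]

lemma mem_okSpan_iff [NeZero m] (hm : Squarefree m) (ω₁ ω₂ x : B m ℓ) :
    x ∈ okSpan m ℓ ω₁ ω₂ ↔
      ∃ u : Fin 2 → R m, x = incl m ℓ (toK m (u 0)) * ω₁ + incl m ℓ (toK m (u 1)) * ω₂ := by
  constructor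
  · rintro ⟨a, b, rfl⟩
    refine ⟨![(toOK m hm).symm a, (toOK m hm).symm b], ?_⟩
    simp only [Matrix.cons_val_zero, Matrix.cons_val_one]
    rw [← coe_toOK m hm, ← coe_toOK m hm, RingEquiv.apply_symm_apply, RingEquiv.apply_symm_apply]
  · rintro ⟨u, rfl⟩
    exact ⟨toOK m hm (u 0), toOK m hm (u 1), by rw [coe_toOK, coe_toOK]⟩

lemma conjIdeal_conjIdeal (I : AddSubgroup (B m ℓ)) : conjIdeal m ℓ (conjIdeal m ℓ I) = I := by
  ext x
  constructor
  · rintro ⟨_, ⟨y, hy, rfl⟩, rfl⟩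
    simpa using hy
  · intro hx
    exact ⟨star x, ⟨x, hx, rfl⟩, by simp⟩

lemma mem_conjIdeal (I : AddSubgroup (B m ℓ)) (x : B m ℓ) :
    x ∈ conjIdeal m ℓ I ↔ star x ∈ I := by
  constructor
  · rintro ⟨y, hy, rfl⟩
    simpa using hy
  · intro hx
    exact ⟨star x, hx, by simp⟩

/-- The determinant of a proper basis does not depend on the basis: the determinant of the change of
basis is a unit, and it is a positive rational number. -/
lemma normLeft_eq [NeZero m] (hm : Squarefree m) {I : AddSubgroup (B m ℓ)} {ω₁ ω₂ : B m ℓ} {n : ℕ}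
    (h : IsProperBasis m ℓ I ω₁ ω₂ n) : normLeft m ℓ I = n := by
  -- each determinant divides the other, with quotient the determinant of the change of basis
  have hdet : ∀ {ω₁ ω₂ ω₁' ω₂' : B m ℓ} {n n' : ℕ}, IsProperBasis m ℓ I ω₁ ω₂ n →
      IsProperBasis m ℓ I ω₁' ω₂' n' → ∃ r : R m, (n' : K m) = toK m r * n := by
    rintro ω₁ ω₂ ω₁' ω₂' n n' ⟨h1, -, h3⟩ ⟨h1', -, h3'⟩
    have hm1 : ω₁' ∈ I := by
      rw [h1', mem_okSpan_iff hm]; exact ⟨![1, 0], by ext <;> simp [incl]⟩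
    have hm2 : ω₂' ∈ I := by
      rw [h1', mem_okSpan_iff hm]; exact ⟨![0, 1], by ext <;> simp [incl]⟩
    rw [h1, mem_okSpan_iff hm] at hm1 hm2
    obtain ⟨u, hu⟩ := hm1
    obtain ⟨w, hw⟩ := hm2
    refine ⟨u 0 * w 1 - u 1 * w 0, ?_⟩
    rw [← h3, ← h3', hu, hw]
    simp only [basisDet, Matrix.det_fin_two_of, coord₁_add, coord₂_add, coord₁_incl_mul,
      coord₂_incl_mul, map_sub, map_mul]
    ring
  have huniq : ∀ {ω₁' ω₂' : B m ℓ} {n' : ℕ}, IsProperBasis m ℓ I ω₁' ω₂' n' → n' = n := by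
    intro ω₁' ω₂' n' h'
    obtain ⟨r, hr⟩ := hdet h h'
    obtain ⟨r', hr'⟩ := hdet h' h
    have hn : (n : K m) ≠ 0 := by exact_mod_cast h.2.1.ne'
    have hrr : r' * r = 1 := by
      apply toK_injective m
      rw [map_mul, map_one]
      apply mul_right_cancel₀ hn
      rw [mul_assoc, ← hr, ← hr', one_mul]
    have hN : r.norm = 1 := by
      have h1 : r'.norm * r.norm = 1 := by rw [← map_mul, hrr, QuadraticAlgebra.norm_one]
      rcases Int.isUnit_iff.1 (IsUnit.of_mul_eq_one _ (by rw [mul_comm]; exact h1)) with h2 | h2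
      · exact h2
      · have := norm_nonneg' m r; omega
    have h2 := congrArg QuadraticAlgebra.norm hr
    rw [map_mul, toK_norm, hN, QuadraticAlgebra.norm_natCast, QuadraticAlgebra.norm_natCast] at h2
    have h3 : n' ^ 2 = n ^ 2 := by
      have : (n' : ℚ) ^ 2 = (n : ℚ) ^ 2 := by simpa using h2
      exact_mod_cast this
    exact Nat.pow_left_injective (two_ne_zero) h3
  have hset : {n : ℕ | ∃ ω₁ ω₂, IsProperBasis m ℓ I ω₁ ω₂ n} = {n} := by
    ext k
    constructor
    · rintro ⟨_, _, hk⟩; exact huniq hk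
    · rintro rfl; exact ⟨_, _, h⟩
  rw [normLeft, hset, csInf_singleton]

end Quaternion

/-! ### The right ideals attached to a Hermitian form -/

/-- The sesquilinear form `x H cᴴ`, where `H` has coordinates `v`. -/
def herm (m : ℕ) (v : Fin 4 → ℤ) (x c : Fin 2 → R m) : R m :=
  x ⬝ᵥ (Hm v *ᵥ star c)

/-- The determinant with rows `c` and `x`. -/
def det₂ (m : ℕ) (x c : Fin 2 → R m) : R m := x 1 * c 0 - x 0 * c 1

variable {m ℓ : ℕ}

lemma herm_apply (v : Fin 4 → ℤ) (x c : Fin 2 → R m) :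
    herm m v x c = x 0 * .C (v 0) * star (c 0) + x 0 * ⟨v 1, v 2⟩ * star (c 1) +
      x 1 * star ⟨v 1, v 2⟩ * star (c 0) + x 1 * .C (v 3) * star (c 1) := by
  simp only [herm, Hm, dotProduct, Matrix.mulVec, Fin.sum_univ_two, Matrix.of_apply,
    Matrix.cons_val', Matrix.cons_val_zero, Matrix.cons_val_one, Matrix.cons_val_fin_one,
    Pi.star_apply]
  ring

lemma herm_self (v : Fin 4 → ℤ) (c : Fin 2 → R m) :
    herm m v c c = algebraMap ℤ (R m) (rowForm m v c) := by
  rw [herm_apply, rowForm]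
  simp only [map_add, map_mul, QuadraticAlgebra.algebraMap_norm_eq_mul_star,
    QuadraticAlgebra.algebraMap_trace_eq_add_star, star_mul, star_star,
    QuadraticAlgebra.C_eq_algebraMap]
  ring

lemma herm_add (v : Fin 4 → ℤ) (x y c : Fin 2 → R m) :
    herm m v (x + y) c = herm m v x c + herm m v y c := by
  rw [herm, add_dotProduct]; rfl

lemma herm_smul (v : Fin 4 → ℤ) (u : R m) (x c : Fin 2 → R m) :
    herm m v (u • x) c = u * herm m v x c := by
  rw [herm, smul_dotProduct]; rfl

lemma det₂_add (x y c : Fin 2 → R m) : det₂ m (x + y) c = det₂ m x c + det₂ m y c := by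
  simp [det₂]; ring

lemma det₂_smul (u : R m) (x c : Fin 2 → R m) : det₂ m (u • x) c = u * det₂ m x c := by
  simp [det₂]; ring

lemma herm_vecMul (v : Fin 4 → ℤ) (g : Matrix (Fin 2) (Fin 2) (R m)) (x c : Fin 2 → R m) :
    herm m v (x ᵥ* g) (c ᵥ* g) = herm m (act g v) x c := by
  rw [herm, herm, Hm_act, Matrix.star_vecMul, ← Matrix.dotProduct_mulVec, Matrix.mulVec_mulVec,
    Matrix.mulVec_mulVec, mul_assoc]

lemma det₂_vecMul (g : Matrix (Fin 2) (Fin 2) (R m)) (x c : Fin 2 → R m) :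
    det₂ m (x ᵥ* g) (c ᵥ* g) = g.det * det₂ m x c := by
  simp only [det₂, Matrix.det_fin_two, Matrix.vecMul, dotProduct, Fin.sum_univ_two]
  ring

lemma vec_eq (x : Fin 2 → R m) : x = x 0 • ![1, 0] + x 1 • ![0, 1] := by
  ext1 i; fin_cases i <;> simp

/-- The quaternion `x H cᴴ + det(c, x) ε`. If `ω₁, ω₂` is a basis with norm form `H` and determinant
`n`, this is `n⁻¹ (x₁ω₁ + x₂ω₂) (c₁ω₁ + c₂ω₂)‾`. -/
def el (m ℓ : ℕ) (v : Fin 4 → ℤ) (x c : Fin 2 → R m) : B m ℓ :=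
  quat m ℓ (toK m (herm m v x c)) (toK m (det₂ m x c))

lemma el_add (v : Fin 4 → ℤ) (x y c : Fin 2 → R m) :
    el m ℓ v (x + y) c = el m ℓ v x c + el m ℓ v y c := by
  apply ext_coord <;> simp [el, coord₁_add, coord₂_add, herm_add, det₂_add]

lemma el_smul (v : Fin 4 → ℤ) (u : R m) (x c : Fin 2 → R m) :
    el m ℓ v (u • x) c = incl m ℓ (toK m u) * el m ℓ v x c := by
  apply ext_coord <;> simp [el, coord₁_incl_mul, coord₂_incl_mul, herm_smul, det₂_smul]

lemma el_smul_right (v : Fin 4 → ℤ) (u : R m) (x c : Fin 2 → R m) :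
    el m ℓ v x (u • c) = el m ℓ v x c * incl m ℓ (toK m (star u)) := by
  apply ext_coord
  · simp only [el, coord₁_mul_incl, coord₁_quat, ← map_mul, herm_apply]
    simp
    ring
  · simp only [el, coord₂_mul_incl, coord₂_quat, ← toK_star, ← map_mul, det₂]
    simp
    ring

lemma el_vecMul {v : Fin 4 → ℤ} {g : Matrix (Fin 2) (Fin 2) (R m)} (hg : g.det = 1)
    (hgv : act g v = v) (x c : Fin 2 → R m) : el m ℓ v (x ᵥ* g) (c ᵥ* g) = el m ℓ v x c := by
  rw [el, el, herm_vecMul, det₂_vecMul, hgv, hg, one_mul]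

lemma el_eq_iff {v : Fin 4 → ℤ} {x c x' c' : Fin 2 → R m} :
    el m ℓ v x c = el m ℓ v x' c' ↔ herm m v x c = herm m v x' c' ∧ det₂ m x c = det₂ m x' c' := by
  refine ⟨fun h => ⟨toK_injective m ?_, toK_injective m ?_⟩, fun h => by rw [el, el, h.1, h.2]⟩
  · exact congrArg (coord₁ m ℓ) h
  · exact congrArg (coord₂ m ℓ) h

lemma el_mul_star_el {v : Fin 4 → ℤ} (hv : detForm m v = ℓ) (x x' c : Fin 2 → R m) :
    el m ℓ v x c * star (el m ℓ v x' c) =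
      incl m ℓ (algebraMap ℚ (K m) (rowForm m v c)) * el m ℓ v x x' := by
  have hdet : (algebraMap ℤ (R m) (v 0)) * algebraMap ℤ (R m) (v 3) -
      (⟨v 1, v 2⟩ : R m) * star ⟨v 1, v 2⟩ = algebraMap ℤ (R m) ℓ := by
    rw [← QuadraticAlgebra.algebraMap_norm_eq_mul_star, ← map_mul, ← map_sub, ← hv, detForm]
  have hl : algebraMap ℚ (K m) (ℓ : ℚ) = toK m (algebraMap ℤ (R m) ℓ) := by
    rw [toK_intCast]; simp
  apply ext_coord
  · rw [coord₁_mul_star, coord₁_incl_mul, hl, ← toK_intCast, ← herm_self]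
    simp only [el, coord₁_quat, coord₂_quat, ← toK_star, ← map_mul, ← map_add]
    congr 1
    rw [← hdet]
    simp only [herm_apply, det₂, star_add, star_sub, star_mul, star_star,
      QuadraticAlgebra.C_eq_algebraMap, QuadraticAlgebra.algebraMap_eq, QuadraticAlgebra.star_mk,
      mul_zero, add_zero, neg_zero]
    ring_nf
  · rw [coord₂_mul_star, coord₂_incl_mul, ← toK_intCast, ← herm_self]
    simp only [el, coord₁_quat, coord₂_quat, ← map_mul, ← map_sub]
    congr 1
    simp only [herm_apply, det₂]
    ring

/-- The left ideal `n⁻¹ U (c₁ω₁ + c₂ω₂)‾`. -/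
def leftId (m ℓ : ℕ) [NeZero m] (v : Fin 4 → ℤ) (c : Fin 2 → R m) : AddSubgroup (B m ℓ) :=
  okSpan m ℓ (el m ℓ v ![1, 0] c) (el m ℓ v ![0, 1] c)

/-- The right ideal `n⁻¹ (c₁ω₁ + c₂ω₂) Ū`. -/
def rightId (m ℓ : ℕ) [NeZero m] (v : Fin 4 → ℤ) (c : Fin 2 → R m) : AddSubgroup (B m ℓ) :=
  conjIdeal m ℓ (leftId m ℓ v c)

lemma mem_leftId_iff [NeZero m] (hm : Squarefree m) (v : Fin 4 → ℤ) (c : Fin 2 → R m)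
    (z : B m ℓ) : z ∈ leftId m ℓ v c ↔ ∃ x, z = el m ℓ v x c := by
  rw [leftId, mem_okSpan_iff hm]
  refine exists_congr fun x => ?_
  conv_rhs => rw [vec_eq x, el_add, el_smul, el_smul]

lemma basisDet_el (v : Fin 4 → ℤ) (c : Fin 2 → R m) :
    basisDet m ℓ (el m ℓ v ![1, 0] c) (el m ℓ v ![0, 1] c) =
      algebraMap ℚ (K m) (rowForm m v c) := by
  rw [basisDet, Matrix.det_fin_two_of, ← toK_intCast, ← herm_self]
  simp only [el, coord₁_quat, coord₂_quat, ← map_mul, ← map_sub, det₂, herm_apply]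
  congr 1
  simp
  ring

/-- Completing the square in the first variable. -/
lemma apply_zero_mul_rowForm (v : Fin 4 → ℤ) (c : Fin 2 → R m) : v 0 * rowForm m v c =
    (v 0 • c 0 + star ⟨v 1, v 2⟩ * c 1).norm + detForm m v * (c 1).norm := by
  rw [norm_add', map_mul, QuadraticAlgebra.norm_star, detForm, rowForm]
  simp only [QuadraticAlgebra.norm_def, QuadraticAlgebra.trace_def, QuadraticAlgebra.re_mul,
    QuadraticAlgebra.im_mul, QuadraticAlgebra.re_star, QuadraticAlgebra.im_star,
    QuadraticAlgebra.re_smul, QuadraticAlgebra.im_smul, smul_eq_mul, star_mul]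
  ring

/-- The Hermitian form with coordinates `v` is positive definite: its leading entry and its
determinant are positive. -/
lemma rowForm_pos [NeZero m] (hℓ : 0 < ℓ) {v : Fin 4 → ℤ} (hv : detForm m v = ℓ) (hv0 : 0 < v 0)
    {c : Fin 2 → R m} (hc : c ≠ 0) : 0 < rowForm m v c := by
  have key := apply_zero_mul_rowForm v c
  rw [hv] at key
  have hl : (0 : ℤ) < ℓ := by exact_mod_cast hℓ
  have h1 := norm_nonneg' m (v 0 • c 0 + star ⟨v 1, v 2⟩ * c 1)
  have h2 := norm_nonneg' m (c 1)
  have h3 : 0 < v 0 * rowForm m v c := by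
    rw [key]
    by_contra hneg
    have e2 : (c 1).norm = 0 := by nlinarith
    have e1 : (v 0 • c 0 + star ⟨v 1, v 2⟩ * c 1).norm = 0 := by nlinarith
    rw [norm_eq_zero'] at e1 e2
    rw [e2, mul_zero, add_zero] at e1
    apply hc
    have := (smul_eq_zero.1 e1).resolve_left hv0.ne'
    ext1 i; fin_cases i <;> assumption
  exact pos_of_mul_pos_right h3 hv0.le

lemma normRight_rightId [NeZero m] (hm : Squarefree m) {v : Fin 4 → ℤ} {c : Fin 2 → R m}
    (hc : 0 < rowForm m v c) : (normRight m ℓ (rightId m ℓ v c) : ℤ) = rowForm m v c := by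
  obtain ⟨n, hn⟩ := Int.eq_ofNat_of_zero_le hc.le
  rw [normRight, rightId, conjIdeal_conjIdeal, hn]
  have : IsProperBasis m ℓ (leftId m ℓ v c) (el m ℓ v ![1, 0] c) (el m ℓ v ![0, 1] c) n :=
    ⟨rfl, by omega, by rw [basisDet_el, hn]; simp⟩
  rw [normLeft_eq hm this]

/-- The ideals attached to two rows coincide exactly when the rows are equivalent under the special
unitary group of the form, which is the group of units of norm one of the right order of `U`. -/
theorem rightId_eq_iff [NeZero m] (hm : Squarefree m) {v : Fin 4 → ℤ} (hv : detForm m v = ℓ)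
    {c c' : Fin 2 → R m} (hc : 0 < rowForm m v c) (hc' : 0 < rowForm m v c') :
    rightId m ℓ v c = rightId m ℓ v c' ↔ SURel m v c c' := by
  constructor
  · intro h
    have hF : rowForm m v c = rowForm m v c' := by
      rw [← normRight_rightId (ℓ := ℓ) hm hc, ← normRight_rightId (ℓ := ℓ) hm hc', h]
    have hL : leftId m ℓ v c = leftId m ℓ v c' := by
      rw [← conjIdeal_conjIdeal (leftId m ℓ v c), ← conjIdeal_conjIdeal (leftId m ℓ v c')]
      exact congrArg _ h
    obtain ⟨x, hx⟩ := (mem_leftId_iff hm v c' _).1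
      (hL ▸ (mem_leftId_iff hm v c (el m ℓ v ![1, 0] c)).2 ⟨_, rfl⟩)
    obtain ⟨y, hy⟩ := (mem_leftId_iff hm v c' _).1
      (hL ▸ (mem_leftId_iff hm v c (el m ℓ v ![0, 1] c)).2 ⟨_, rfl⟩)
    -- the matrix of right multiplication, on the basis of `U`
    obtain ⟨g, hg⟩ : ∃ g : Matrix (Fin 2) (Fin 2) (R m), g = Matrix.of ![x, y] := ⟨_, rfl⟩
    have hzg : ∀ z : Fin 2 → R m, z ᵥ* g = z 0 • x + z 1 • y := fun z => by
      ext1 i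
      simp [Matrix.vecMul, dotProduct, Fin.sum_univ_two, hg]
    have hmul : ∀ z, el m ℓ v z c = el m ℓ v (z ᵥ* g) c' := fun z => by
      rw [hzg, el_add, el_smul, el_smul, ← hx, ← hy]
      conv_lhs => rw [vec_eq z, el_add, el_smul, el_smul]
    -- `F(c) el(z, z') = el(z, c) el(z', c)‾` recovers all the `el(z, z')`
    have hpres : ∀ z z', el m ℓ v z z' = el m ℓ v (z ᵥ* g) (z' ᵥ* g) := fun z z' => by
      have h1 := el_mul_star_el hv z z' c
      have h2 := el_mul_star_el hv (z ᵥ* g) (z' ᵥ* g) c'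
      rw [← hmul, ← hmul, h1, ← hF, incl_algebraMap, ← Algebra.smul_def, ← Algebra.smul_def] at h2
      have hne' : ((rowForm m v c : ℤ) : ℚ) ≠ 0 := by exact_mod_cast hc.ne'
      exact smul_right_injective _ hne' h2
    have hgdet : g.det = 1 := by
      have := (el_eq_iff.1 (hpres ![0, 1] ![1, 0])).2
      rw [det₂_vecMul] at this
      simpa [det₂] using this.symm
    refine ⟨g, hgdet, ?_, ?_⟩
    · apply Hm_injective (a := paramA m) (b := paramB m)
      have hH : ∀ z z', herm m (act g v) z z' = herm m v z z' := fun z z' => by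
        rw [← herm_vecMul]; exact ((el_eq_iff.1 (hpres z z')).1).symm
      have h00 := hH ![1, 0] ![1, 0]
      have h01 := hH ![1, 0] ![0, 1]
      have h10 := hH ![0, 1] ![1, 0]
      have h11 := hH ![0, 1] ![0, 1]
      simp [herm_apply] at h00 h01 h10 h11
      ext1 i j
      fin_cases i <;> fin_cases j
      · simp [Hm, h00]
      · simp [Hm, h01]
      · simp [Hm, h01]
      · simp [Hm, h11]
    · have hdd : ∀ z, det₂ m (z ᵥ* g) c' = det₂ m (z ᵥ* g) (c ᵥ* g) := fun z =>
        (el_eq_iff.1 ((hmul z).symm.trans (hpres z c))).2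
      have hsurj : ∀ w, det₂ m w c' = det₂ m w (c ᵥ* g) := fun w => by
        have := hdd (w ᵥ* g.adjugate)
        rwa [Matrix.vecMul_vecMul, Matrix.adjugate_mul, hgdet, one_smul, Matrix.vecMul_one] at this
      have h0 := hsurj ![0, 1]
      have h1 := hsurj ![1, 0]
      simp [det₂] at h0 h1
      ext1 i; fin_cases i
      · exact h0
      · exact h1
  · rintro ⟨g, hg, hgv, rfl⟩
    rw [rightId, rightId]
    congr 1
    ext z
    rw [mem_leftId_iff hm, mem_leftId_iff hm]
    constructor
    · rintro ⟨x, rfl⟩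
      exact ⟨x ᵥ* g, (el_vecMul hg hgv x c).symm⟩
    · rintro ⟨x, rfl⟩
      refine ⟨x ᵥ* g.adjugate, ?_⟩
      rw [← el_vecMul hg hgv (x ᵥ* g.adjugate) c, Matrix.vecMul_vecMul, Matrix.adjugate_mul, hg,
        one_smul, Matrix.vecMul_one]

/-! ### The class of `Ū` -/

variable {m ℓ : ℕ}

/-- The inclusion of `ℚ` in `K`, on coordinates. -/
def ratK (m : ℕ) : ℚ →+* K m := algebraMap ℚ (K m)

lemma algebraMap_eq_ratK (q : ℚ) : algebraMap ℚ (K m) q = ratK m q := rfl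

/-- The two `ℚ`-algebra structures on `K`, from the coordinates and from characteristic zero,
agree. -/
lemma algebraMap_eq_ratK' [NeZero m] (q : ℚ) :
    @algebraMap ℚ (K m) _ _ DivisionRing.toRatAlgebra q = ratK m q :=
  RingHom.congr_fun (Subsingleton.elim (@algebraMap ℚ (K m) _ _ DivisionRing.toRatAlgebra)
    (ratK m)) q

lemma star_ratK (q : ℚ) : star (ratK m q) = ratK m q := star_algebraMap' m q

lemma ratK_ne_zero {q : ℚ} (hq : q ≠ 0) : ratK m q ≠ 0 := by
  rw [Ne, ratK, ← map_zero (algebraMap ℚ (K m)), QuadraticAlgebra.algebraMap_inj]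
  exact hq

lemma incl_ratK (q : ℚ) (x : B m ℓ) : incl m ℓ (ratK m q) * x = q • x := by
  ext <;> simp [incl, ratK]

/-- `ω₁, ω₂ ∈ B` have determinant `n` and Gram matrix `n H`, where `H` has coordinates `v`. -/
structure IsNormBasis (m ℓ : ℕ) (v : Fin 4 → ℤ) (ω₁ ω₂ : B m ℓ) (n : ℚ) : Prop where
  pos : 0 < n
  gram₁₁ : coord₁ m ℓ (ω₁ * star ω₁) = ratK m (n * v 0)
  gram₂₁ : coord₁ m ℓ (ω₂ * star ω₁) = ratK m n * toK m (star ⟨v 1, v 2⟩)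
  gram₂₂ : coord₁ m ℓ (ω₂ * star ω₂) = ratK m (n * v 3)
  det : basisDet m ℓ ω₁ ω₂ = ratK m n

lemma coord₂_mul_star_self (x : B m ℓ) : coord₂ m ℓ (x * star x) = 0 := by
  rw [coord₂_mul_star]; ring

lemma coord₂_mul_star_eq_basisDet (x y : B m ℓ) :
    coord₂ m ℓ (y * star x) = basisDet m ℓ x y := by
  rw [coord₂_mul_star, basisDet, Matrix.det_fin_two_of]; ring

lemma coord₂_mul_star_eq_neg_basisDet (x y : B m ℓ) :
    coord₂ m ℓ (x * star y) = -basisDet m ℓ x y := by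
  rw [coord₂_mul_star, basisDet, Matrix.det_fin_two_of]; ring

lemma coord₁_star_mul_star (x y : B m ℓ) :
    coord₁ m ℓ (x * star y) = star (coord₁ m ℓ (y * star x)) := by
  simp only [coord₁_mul_star, star_add, star_mul, star_star, star_algebraMap']
  ring

/-- The linear combination of `ω₁`, `ω₂` with coefficient row `x`. -/
def comb (ω₁ ω₂ : B m ℓ) (x : Fin 2 → R m) : B m ℓ :=
  incl m ℓ (toK m (x 0)) * ω₁ + incl m ℓ (toK m (x 1)) * ω₂

lemma comb_mul_star_comb {v : Fin 4 → ℤ} {ω₁ ω₂ : B m ℓ} {n : ℚ}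
    (h : IsNormBasis m ℓ v ω₁ ω₂ n) (x c : Fin 2 → R m) :
    comb ω₁ ω₂ x * star (comb ω₁ ω₂ c) = n • el m ℓ v x c := by
  have h12 : coord₁ m ℓ (ω₁ * star ω₂) = ratK m n * toK m ⟨v 1, v 2⟩ := by
    rw [coord₁_star_mul_star, h.gram₂₁, star_mul, star_ratK, ← toK_star, star_star, mul_comm]
  have hexp : comb ω₁ ω₂ x * star (comb ω₁ ω₂ c) =
      incl m ℓ (toK m (x 0)) * (ω₁ * star ω₁ * incl m ℓ (toK m (star (c 0)))) +
      incl m ℓ (toK m (x 0)) * (ω₁ * star ω₂ * incl m ℓ (toK m (star (c 1)))) +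
      (incl m ℓ (toK m (x 1)) * (ω₂ * star ω₁ * incl m ℓ (toK m (star (c 0)))) +
      incl m ℓ (toK m (x 1)) * (ω₂ * star ω₂ * incl m ℓ (toK m (star (c 1))))) := by
    simp only [comb, star_add, star_mul, toK_star, incl_star]
    noncomm_ring
  rw [hexp, ← incl_ratK]
  have e : ∀ k : ℤ, ratK m (n * k) = ratK m n * toK m (algebraMap ℤ (R m) k) := fun k => by
    rw [map_mul, toK_intCast]; rfl
  apply ext_coord
  · simp only [coord₁_add, coord₁_incl_mul, coord₁_mul_incl, h.gram₁₁, h.gram₂₁, h.gram₂₂, h12, e,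
      el, coord₁_quat, herm_apply, map_add, map_mul, QuadraticAlgebra.C_eq_algebraMap]
    ring
  · simp only [coord₂_add, coord₂_incl_mul, coord₂_mul_incl, coord₂_mul_star_self,
      coord₂_mul_star_eq_basisDet ω₁ ω₂, coord₂_mul_star_eq_neg_basisDet ω₁ ω₂, h.det,
      el, coord₂_quat, det₂, ← toK_star, star_star, map_sub, map_mul]
    ring

lemma mem_okSpan_iff_comb [NeZero m] (hm : Squarefree m) (ω₁ ω₂ z : B m ℓ) :
    z ∈ okSpan m ℓ ω₁ ω₂ ↔ ∃ x, z = comb ω₁ ω₂ x :=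
  mem_okSpan_iff hm ω₁ ω₂ z

lemma isUnit_of_ne_zero [NeZero m] (hℓ : 0 < ℓ) {x : B m ℓ} (hx : x ≠ 0) : IsUnit x := by
  have h := (nrd_pos hℓ hx).ne'
  refine ⟨⟨x, (nrd m ℓ x)⁻¹ • star x, ?_, ?_⟩, rfl⟩
  · rw [mul_smul_comm, mul_star_self, Algebra.smul_def, ← map_mul, inv_mul_cancel₀ h, map_one]
  · rw [smul_mul_assoc, star_mul_self', Algebra.smul_def, ← map_mul, inv_mul_cancel₀ h, map_one]

lemma star_mem_orderO [NeZero m] (hm : Squarefree m) {x : B m ℓ} (hx : x ∈ orderO m ℓ) :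
    star x ∈ orderO m ℓ := by
  rw [mem_orderO_iff hm] at hx ⊢
  obtain ⟨a, b, h1, h2⟩ := hx
  refine ⟨star a, -b, ?_, ?_⟩
  · rw [toK_star, ← h1]; ext <;> simp [coord₁]
  · rw [map_neg, ← h2]; ext <;> simp [coord₂]

lemma rightId_eq_map [NeZero m] (hm : Squarefree m) {v : Fin 4 → ℤ} {ω₁ ω₂ : B m ℓ} {n : ℚ}
    (h : IsNormBasis m ℓ v ω₁ ω₂ n) (c : Fin 2 → R m) :
    rightId m ℓ v c = (conjIdeal m ℓ (okSpan m ℓ ω₁ ω₂)).map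
      (AddMonoidHom.mulLeft (n⁻¹ • comb ω₁ ω₂ c)) := by
  have hel : ∀ x, star (el m ℓ v x c) = n⁻¹ • comb ω₁ ω₂ c * star (comb ω₁ ω₂ x) := fun x => by
    have h1 := congrArg star (comb_mul_star_comb h x c)
    rw [star_mul, star_star, QuaternionAlgebra.star_smul] at h1
    rw [smul_mul_assoc, h1, smul_smul, inv_mul_cancel₀ h.pos.ne', one_smul]
  ext z
  rw [rightId, mem_conjIdeal, mem_leftId_iff hm]
  constructor
  · rintro ⟨x, hx⟩
    refine ⟨star (comb ω₁ ω₂ x), ?_, ?_⟩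
    · change _ ∈ conjIdeal m ℓ _
      rw [mem_conjIdeal, star_star, mem_okSpan_iff_comb hm]; exact ⟨x, rfl⟩
    · change _ * _ = z
      rw [← hel, ← hx, star_star]
  · rintro ⟨u, hu, rfl⟩
    change u ∈ conjIdeal m ℓ _ at hu
    rw [mem_conjIdeal, mem_okSpan_iff_comb hm] at hu
    obtain ⟨x, hx⟩ := hu
    refine ⟨x, ?_⟩
    rw [← star_star u, hx, ← star_star (el m ℓ v x c), hel]
    rfl

/-- The right ideals in the class of `Ū` are those attached to the nonzero rows. -/
theorem setOf_rightIdeal_eq [NeZero m] (hm : Squarefree m) (hℓ : 0 < ℓ) {v : Fin 4 → ℤ}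
    (hv : detForm m v = ℓ) (hv0 : 0 < v 0) {ω₁ ω₂ : B m ℓ} {n : ℚ}
    (h : IsNormBasis m ℓ v ω₁ ω₂ n) (hU : IsLeftIdeal m ℓ (okSpan m ℓ ω₁ ω₂)) :
    {I | IsRightIdeal m ℓ I ∧ SameRightClass m ℓ (conjIdeal m ℓ (okSpan m ℓ ω₁ ω₂)) I} =
      rightId m ℓ v '' {c | c ≠ 0} := by
  have hn := h.pos.ne'
  ext I
  constructor
  · rintro ⟨⟨hI, -⟩, α, rfl⟩
    have hmem : ∀ x, coord₂ m ℓ (α * star (comb ω₁ ω₂ x)) ∈ Set.range (toK m) := fun x => by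
      have h1 : α * star (comb ω₁ ω₂ x) ∈ orderO m ℓ := hI ⟨star (comb ω₁ ω₂ x), by
        change _ ∈ conjIdeal m ℓ _
        rw [mem_conjIdeal, star_star, mem_okSpan_iff_comb hm]; exact ⟨x, rfl⟩, rfl⟩
      obtain ⟨a, b, -, hb⟩ := (mem_orderO_iff hm _).1 h1
      exact ⟨b, hb.symm⟩
    have hc1 : comb ω₁ ω₂ ![1, 0] = ω₁ := by ext <;> simp [comb, incl]
    have hc2 : comb ω₁ ω₂ ![0, 1] = ω₂ := by ext <;> simp [comb, incl]
    obtain ⟨s, hs⟩ := hmem ![1, 0]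
    obtain ⟨t, ht⟩ := hmem ![0, 1]
    rw [hc1] at hs
    rw [hc2] at ht
    -- the second coordinates of `α ω̄₁` and `α ω̄₂` determine `α`
    have hα : (α : B m ℓ) = n⁻¹ • comb ω₁ ω₂ ![-t, s] := by
      have hdet := h.det
      rw [basisDet, Matrix.det_fin_two_of] at hdet
      rw [coord₂_mul_star] at hs ht
      have hK := ratK_ne_zero (m := m) hn
      have h' : n • (α : B m ℓ) = comb ω₁ ω₂ ![-t, s] := by
        rw [← incl_ratK]
        apply ext_coord
        · simp only [coord₁_incl_mul, comb, coord₁_add, Matrix.cons_val_zero, Matrix.cons_val_one,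
            ← hdet, map_neg, hs, ht]
          ring
        · simp only [coord₂_incl_mul, comb, coord₂_add, Matrix.cons_val_zero, Matrix.cons_val_one,
            ← hdet, map_neg, hs, ht]
          ring
      rw [← h', smul_smul, inv_mul_cancel₀ hn, one_smul]
    refine ⟨![-t, s], fun h0 => α.ne_zero ?_, ?_⟩
    · have hz : incl m ℓ 0 = 0 := by ext <;> simp [incl]
      rw [hα, h0]; simp [comb, hz]
    · rw [rightId_eq_map hm h, hα]
  · rintro ⟨c, hc, rfl⟩
    have hcomb : comb ω₁ ω₂ c ≠ 0 := fun h0 => by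
      have h1 := comb_mul_star_comb h c c
      rw [h0, zero_mul] at h1
      have h2 := (smul_eq_zero.1 h1.symm).resolve_left hn
      have h3 := congrArg (coord₁ m ℓ) h2
      rw [el, coord₁_quat, herm_self, toK_intCast] at h3
      have h4 : ((rowForm m v c : ℤ) : ℚ) = 0 := congrArg QuadraticAlgebra.re h3
      have h5 := rowForm_pos hℓ hv hv0 hc
      have h6 : rowForm m v c = 0 := by exact_mod_cast h4
      omega
    refine ⟨⟨fun z hz => ?_, fun w hw z hz => ?_⟩, ?_⟩
    · rw [rightId, mem_conjIdeal, mem_leftId_iff hm] at hz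
      obtain ⟨x, hx⟩ := hz
      rw [← star_star z]
      apply star_mem_orderO hm
      rw [hx, mem_orderO_iff hm]
      exact ⟨_, _, rfl, rfl⟩
    · rw [rightId_eq_map hm h] at hz ⊢
      obtain ⟨u, hu, rfl⟩ := hz
      refine ⟨u * w, ?_, (mul_assoc _ _ _).symm⟩
      change u ∈ conjIdeal m ℓ _ at hu
      change _ ∈ conjIdeal m ℓ _
      rw [mem_conjIdeal] at hu ⊢
      rw [star_mul]
      exact hU.2 _ (star_mem_orderO hm hw) _ hu
    · obtain ⟨α, hα⟩ := isUnit_of_ne_zero hℓ (smul_ne_zero (inv_ne_zero hn) hcomb)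
      exact ⟨α, by rw [rightId_eq_map hm h, hα]⟩

/-- If `𝒪_K ω₁ + 𝒪_K ω₂` is stable under `ε`, the off-diagonal entry of its norm form is
integral. -/
lemma exists_toK_eq_of_isLeftIdeal [NeZero m] (hm : Squarefree m) {ω₁ ω₂ : B m ℓ} {n a : ℚ}
    {b : K m} (hn : n ≠ 0) (ha : a ≠ 0) (h11 : coord₁ m ℓ (ω₁ * star ω₁) = ratK m (n * a))
    (h21 : coord₁ m ℓ (ω₂ * star ω₁) = ratK m n * b) (hd : basisDet m ℓ ω₁ ω₂ = ratK m n)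
    (hU : IsLeftIdeal m ℓ (okSpan m ℓ ω₁ ω₂)) : ∃ r : R m, b = toK m r := by
  have heps : eps m ℓ ∈ orderO m ℓ := by
    rw [mem_orderO_iff hm]
    exact ⟨0, 1, by ext <;> simp [coord₁, eps], by ext <;> simp [coord₂, eps]⟩
  have h1 : ω₁ ∈ okSpan m ℓ ω₁ ω₂ := by
    rw [mem_okSpan_iff hm]; exact ⟨![1, 0], by ext <;> simp [incl]⟩
  obtain ⟨x, hx⟩ := (mem_okSpan_iff hm _ _ _).1 (hU.2 _ heps _ h1)
  have hx' : eps m ℓ * (ω₁ * star ω₁) = incl m ℓ (toK m (x 0)) * (ω₁ * star ω₁) +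
      incl m ℓ (toK m (x 1)) * (ω₂ * star ω₁) := by
    rw [← mul_assoc, hx]; noncomm_ring
  have e1 := congrArg (coord₁ m ℓ) hx'
  have e2 := congrArg (coord₂ m ℓ) hx'
  simp only [coord₁_add, coord₂_add, coord₁_incl_mul, coord₂_incl_mul, coord₁_eps_mul,
    coord₂_eps_mul, h11, h21, coord₂_mul_star_self, coord₂_mul_star_eq_basisDet ω₁ ω₂, hd,
    map_mul, star_mul, star_ratK, star_zero, mul_zero, zero_add] at e1 e2
  have hnK := ratK_ne_zero (m := m) hn
  have haK := ratK_ne_zero (m := m) ha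
  refine ⟨-x 0, ?_⟩
  have e3 : toK m (x 1) = ratK m a := by
    apply mul_left_cancel₀ hnK; linear_combination -e2
  rw [e3] at e1
  rw [map_neg]
  apply mul_left_cancel₀ hnK
  apply mul_left_cancel₀ haK
  linear_combination -e1

lemma eq_of_toK_eq {x y : ℚ} {r : R m} (h : ratK m x + omegaK m * ratK m y = toK m r) :
    x = r.re ∧ y = r.im := by
  have h1 := congrArg QuadraticAlgebra.im h
  rw [toK_im] at h1
  simp [ratK] at h1
  have h2 := h1.resolve_right (omegaK_im_ne m)
  have h3 := congrArg QuadraticAlgebra.re h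
  rw [toK_re] at h3
  simp [ratK, h2] at h3
  exact ⟨h3, h2⟩

/-! ### Latimer's correspondence -/

/-- The coordinates of the complex conjugate of the Hermitian matrix with coordinates `v`. -/
def conjV (m : ℕ) (v : Fin 4 → ℤ) : Fin 4 → ℤ := ![v 0, v 1 + paramB m * v 2, -v 2, v 3]

lemma conjV_apply_zero (v : Fin 4 → ℤ) : conjV m v 0 = v 0 := rfl

lemma conjV_mid (v : Fin 4 → ℤ) : (⟨conjV m v 1, conjV m v 2⟩ : R m) = star ⟨v 1, v 2⟩ := rfl

lemma conjV_apply_three (v : Fin 4 → ℤ) : conjV m v 3 = v 3 := rfl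

lemma detForm_conjV (v : Fin 4 → ℤ) : detForm m (conjV m v) = detForm m v := by
  rw [detForm, conjV_mid, QuadraticAlgebra.norm_star]; rfl

lemma Hm_conjV (v : Fin 4 → ℤ) :
    (Hm (conjV m v) : Matrix (Fin 2) (Fin 2) (R m)) = (Hm v).map star := by
  ext1 i j
  fin_cases i <;> fin_cases j
  · simp [Hm, conjV_apply_zero]
  · simp [Hm, conjV_mid]
  · simp [Hm, conjV_mid]
  · simp [Hm, conjV_apply_three]

lemma rowForm_conjV (v : Fin 4 → ℤ) (c : Fin 2 → R m) :
    rowForm m (conjV m v) c = rowForm m v (star c) := by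
  rw [rowForm, rowForm, conjV_mid]
  simp only [Pi.star_apply, QuadraticAlgebra.norm_star, star_star]
  rw [← QuadraticAlgebra.trace_star (z := c 0 * _ * _)]
  simp only [star_mul, star_star, conjV_apply_zero, conjV_apply_three]
  rw [mul_comm (c 1), mul_comm _ (star (c 0))]

lemma SURel_conjV (v : Fin 4 → ℤ) {c c' : Fin 2 → R m} (h : SURel m v c c') :
    SURel m (conjV m v) (star c) (star c') := by
  obtain ⟨g, hg, hgv, rfl⟩ := h
  have hdet : (g.map star).det = 1 := by
    rw [← star_one (R m), ← hg, Matrix.det_fin_two, Matrix.det_fin_two]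
    simp
  refine ⟨g.map star, hdet, ?_, ?_⟩
  · apply Hm_injective (a := paramA m) (b := paramB m)
    rw [Hm_act, Hm_conjV]
    conv_rhs => rw [← hgv, Hm_act]
    have hmap : ∀ M N : Matrix (Fin 2) (Fin 2) (R m),
        (M * N).map star = M.map star * N.map star := fun M N => by
      ext1 i j; simp [Matrix.mul_apply, Fin.sum_univ_two]
    rw [hmap, hmap]
    rfl
  · ext1 i
    simp [Matrix.vecMul, dotProduct, Fin.sum_univ_two]

lemma conjV_conjV (v : Fin 4 → ℤ) : conjV m (conjV m v) = v := by
  ext i; fin_cases i <;> simp [conjV]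

lemma SURel_conjV_iff (v : Fin 4 → ℤ) (c c' : Fin 2 → R m) :
    SURel m (conjV m v) (star c) (star c') ↔ SURel m v c c' := by
  refine ⟨fun h => ?_, SURel_conjV v⟩
  have := SURel_conjV _ h
  rwa [conjV_conjV, star_star, star_star] at this

lemma phi0_apply (m : ℕ) (x y : Fin 4 → ℚ) :
    phi0 m x y = (x 0 * y 3 + x 3 * y 0 - 2 * x 1 * y 1 - paramB m * (x 1 * y 2 + x 2 * y 1)
      + 2 * paramA m * x 2 * y 2) / 2 := by
  have : (matS0 m).map (Int.cast : ℤ → ℚ) = S0 (paramA m : ℚ) (paramB m : ℚ) := by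
    rw [matS0_eq]; exact S0_map (Int.castRingHom ℚ) _ _
  rw [phi0, this]
  simp [S0, Matrix.mulVec, dotProduct, Fin.sum_univ_succ]
  ring

lemma hermForm_apply (m : ℕ) (ξ : Fin 4 → ℚ) (u w : K m) :
    hermForm m (hermMatrix m ξ) u w = ratK m (ξ 0) * (u * star u) +
      (ratK m (ξ 1) + omegaK m * ratK m (ξ 2)) * u * star w +
      star (ratK m (ξ 1) + omegaK m * ratK m (ξ 2)) * w * star u + ratK m (ξ 3) * (w * star w) := by
  simp only [hermForm, hermMatrix, dotProduct, Matrix.mulVec, Fin.sum_univ_two, Matrix.of_apply,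
    Matrix.cons_val', Matrix.cons_val_zero, Matrix.cons_val_one, Matrix.cons_val_fin_one,
    algebraMap_eq_ratK, star_add, star_mul, star_ratK]
  ring

lemma coord₁_mul_star_self (x : B m ℓ) : coord₁ m ℓ (x * star x) = ratK m (nrd m ℓ x) := by
  rw [mul_star_self]
  ext <;> simp [coord₁, ratK]

/-- The norm form of a proper basis determines its Gram matrix, by polarization. -/
lemma gram_of_hasNormForm [NeZero m] {ξ : Fin 4 → ℚ} {ω₁ ω₂ : B m ℓ} {n : ℕ}
    (h : ∀ u w : R m, ratK m (nrd m ℓ (incl m ℓ (toK m u) * ω₁ + incl m ℓ (toK m w) * ω₂)) =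
      n * hermForm m (hermMatrix m ξ) (toK m u) (toK m w)) :
    coord₁ m ℓ (ω₁ * star ω₁) = ratK m (n * ξ 0) ∧
    coord₁ m ℓ (ω₂ * star ω₁) = ratK m n * star (ratK m (ξ 1) + omegaK m * ratK m (ξ 2)) ∧
    coord₁ m ℓ (ω₂ * star ω₂) = ratK m (n * ξ 3) := by
  have hn : (n : K m) = ratK m n := by simp
  have hexp : ∀ u w : K m, ratK m (nrd m ℓ (incl m ℓ u * ω₁ + incl m ℓ w * ω₂)) =
      coord₁ m ℓ (ω₁ * star ω₁) * (u * star u) + star (coord₁ m ℓ (ω₂ * star ω₁)) * u * star w +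
        coord₁ m ℓ (ω₂ * star ω₁) * w * star u + coord₁ m ℓ (ω₂ * star ω₂) * (w * star w) := by
    intro u w
    have e : (incl m ℓ u * ω₁ + incl m ℓ w * ω₂) * star (incl m ℓ u * ω₁ + incl m ℓ w * ω₂) =
        incl m ℓ u * (ω₁ * star ω₁ * incl m ℓ (star u)) +
        incl m ℓ u * (ω₁ * star ω₂ * incl m ℓ (star w)) +
        (incl m ℓ w * (ω₂ * star ω₁ * incl m ℓ (star u)) +
        incl m ℓ w * (ω₂ * star ω₂ * incl m ℓ (star w))) := by
      simp only [star_add, star_mul, incl_star]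
      noncomm_ring
    rw [← coord₁_mul_star_self, e]
    simp only [coord₁_add, coord₁_incl_mul, coord₁_mul_incl, coord₁_star_mul_star ω₁ ω₂]
    ring
  simp only [hexp, hermForm_apply, hn] at h
  have h10 := h 1 0
  have h01 := h 0 1
  have h11 := h 1 1
  have hω := h ⟨0, 1⟩ 1
  have hω1 : toK m ⟨0, 1⟩ = omegaK m := by rw [toK_apply]; simp
  rw [hω1] at hω
  simp only [map_one, map_zero, star_one, star_zero, mul_one, mul_zero, add_zero,
    zero_add] at h10 h01 h11 hω
  refine ⟨by rw [h10, map_mul], ?_, by rw [h01, map_mul]⟩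
  generalize star (ratK m (ξ 1) + omegaK m * ratK m (ξ 2)) = b' at *
  set b := ratK m (ξ 1) + omegaK m * ratK m (ξ 2)
  -- the difference `z` of the two sides satisfies `z̄ + z = 0` and `ω z̄ + ω̄ z = 0`
  have hne : star (omegaK m) - omegaK m ≠ 0 := fun h0 => by
    have := congrArg QuadraticAlgebra.im h0
    simp at this
    have := omegaK_im_ne m
    apply this
    linarith
  apply mul_left_cancel₀ hne
  linear_combination hω - omegaK m * h11 + (omegaK m - omegaK m * star (omegaK m)) * h10 +
    (omegaK m - 1) * h01

/-- The facts about the form attached to `ξ` and the class of `Ū` that the count of ideals uses. -/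
structure ClassData (m ℓ : ℕ) [NeZero m] (ξ : Fin 4 → ℚ) (U : AddSubgroup (B m ℓ))
    (v w : Fin 4 → ℤ) : Prop where
  /-- `ξ` is the integral vector `v`. -/
  vec : ξ = fun i => (v i : ℚ)
  /-- The form `w` that describes the ideals is that of `ξ` or its complex conjugate. -/
  conj : w = v ∨ w = conjV m v
  det : detForm m v = ℓ
  pos : 0 < v 0
  /-- The pairing `2φ₀(ξ, ·)` takes the value `1` on the lattice. -/
  prim : ∃ (x y : ℤ) (z : R m), v 0 * y + v 3 * x - (⟨v 1, v 2⟩ * star z : R m).trace = 1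
  /-- The right ideals in the class of `Ū` are those attached to the nonzero rows. -/
  ideals : {I | IsRightIdeal m ℓ I ∧ SameRightClass m ℓ (conjIdeal m ℓ U) I} =
    rightId m ℓ w '' {c | c ≠ 0}

/-- A primitive vector in the positive cone whose off-diagonal entry is integral is an integral
vector of determinant `ℓ`, and its pairing with the lattice takes the value `1/2`. -/
lemma exists_int_vec {ξ : Fin 4 → ℚ} (hξ : ξ ∈ primitiveVectors m ℓ) (hξ' : ξ ∈ cone m) {r : R m}
    (hr : ratK m (ξ 1) + omegaK m * ratK m (ξ 2) = toK m r) :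
    ∃ v : Fin 4 → ℤ, ξ = (fun i => (v i : ℚ)) ∧ (⟨v 1, v 2⟩ : R m) = r ∧ detForm m v = ℓ ∧
      0 < v 0 ∧
      ∃ (x y : ℤ) (z : R m), v 0 * y + v 3 * x - (⟨v 1, v 2⟩ * star z : R m).trace = 1 := by
  obtain ⟨hphi, himg⟩ := hξ
  obtain ⟨h0, -⟩ := hξ'
  have hint : ∀ y : Fin 4 → ℤ, ∃ k : ℤ, phi0 m ξ (fun i => (y i : ℚ)) = k / 2 := fun y => by
    have : phi0 m ξ (fun i => (y i : ℚ)) ∈ phi0 m ξ '' latL0 := ⟨_, ⟨y, rfl⟩, rfl⟩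
    rw [himg] at this
    obtain ⟨k, hk⟩ := this
    exact ⟨k, hk.symm⟩
  obtain ⟨a, ha⟩ := hint ![0, 0, 0, 1]
  obtain ⟨c, hc⟩ := hint ![1, 0, 0, 0]
  rw [phi0_apply] at ha hc hphi
  simp at ha hc
  obtain ⟨hr1, hr2⟩ := eq_of_toK_eq hr
  have hprim : ∃ (x y : ℤ) (z : R m), a * y + c * x - (r * star z).trace = 1 := by
    have : (1 / 2 : ℚ) ∈ phi0 m ξ '' latL0 := by rw [himg]; exact ⟨1, by simp⟩
    obtain ⟨_, ⟨y, rfl⟩, hy⟩ := this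
    rw [phi0_apply, ha, hc, hr1, hr2] at hy
    refine ⟨y 0, y 3, ⟨y 1, y 2⟩, ?_⟩
    rw [QuadraticAlgebra.trace_def]
    simp
    have : (a : ℚ) * y 3 + c * y 0 - (2 * (r.re * (y 1 + paramB m * y 2) + -(paramA m * r.im * y 2))
        + paramB m * (-(r.re * y 2) + r.im * (y 1 + paramB m * y 2) +
          -(paramB m * r.im * y 2))) = 1 := by
      linear_combination 2 * hy
    exact_mod_cast this
  refine ⟨![a, r.re, r.im, c], ?_, rfl, ?_, ?_, hprim⟩
  · ext i; fin_cases i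
    · exact ha
    · exact hr1
    · exact hr2
    · exact hc
  · rw [detForm, QuadraticAlgebra.norm_def]
    rw [ha, hc, hr1, hr2] at hphi
    simp
    have : (a : ℚ) * c - (r.re * r.re + paramB m * r.re * r.im - paramA m * r.im * r.im) = ℓ := by
      rw [← hphi]; ring
    exact_mod_cast this
  · rw [ha] at h0; simpa using h0

/-- The data of the class, from a basis with Gram matrix a multiple of the Hermitian matrix of `ξ`
or of its complex conjugate. -/
lemma exists_classData_aux [NeZero m] (hm : Squarefree m) (hℓ : 0 < ℓ) {ξ : Fin 4 → ℚ}
    (hξ : ξ ∈ primitiveVectors m ℓ) (hξ' : ξ ∈ cone m) {ω₁ ω₂ : B m ℓ}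
    (hU : IsLeftIdeal m ℓ (okSpan m ℓ ω₁ ω₂)) {n : ℚ} (hn : 0 < n)
    (h11 : coord₁ m ℓ (ω₁ * star ω₁) = ratK m (n * ξ 0))
    (h21 : coord₁ m ℓ (ω₂ * star ω₁) = ratK m n * (ratK m (ξ 1) + omegaK m * ratK m (ξ 2)) ∨
      coord₁ m ℓ (ω₂ * star ω₁) = ratK m n * star (ratK m (ξ 1) + omegaK m * ratK m (ξ 2)))
    (h22 : coord₁ m ℓ (ω₂ * star ω₂) = ratK m (n * ξ 3))
    (hd : basisDet m ℓ ω₁ ω₂ = ratK m n) :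
    ∃ v w, ClassData m ℓ ξ (okSpan m ℓ ω₁ ω₂) v w := by
  have h0 := hξ'.1
  have hr : ∃ r : R m, ratK m (ξ 1) + omegaK m * ratK m (ξ 2) = toK m r := by
    rcases h21 with h21 | h21
    · exact exists_toK_eq_of_isLeftIdeal hm hn.ne' h0.ne' h11 h21 hd hU
    · obtain ⟨r, hr⟩ := exists_toK_eq_of_isLeftIdeal hm hn.ne' h0.ne' h11 h21 hd hU
      exact ⟨star r, by rw [toK_star, ← hr, star_star]⟩
  obtain ⟨r, hr⟩ := hr
  obtain ⟨v, hξv, hvr, hdet, hpos, hprim⟩ := exists_int_vec hξ hξ' hr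
  have ha : ξ 0 = v 0 := congrFun hξv 0
  have hc : ξ 3 = v 3 := congrFun hξv 3
  rw [← hvr] at hr
  rcases h21 with h21 | h21
  · have hB : IsNormBasis m ℓ (conjV m v) ω₁ ω₂ n :=
      ⟨hn, by rw [h11, ha, conjV_apply_zero], by rw [h21, hr, conjV_mid, star_star],
        by rw [h22, hc, conjV_apply_three], hd⟩
    have hpos' : 0 < conjV m v 0 := by rw [conjV_apply_zero]; exact hpos
    have hdet' : detForm m (conjV m v) = ℓ := by rw [detForm_conjV, hdet]
    have hI := setOf_rightIdeal_eq hm hℓ hdet' hpos' hB hU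
    exact ⟨v, conjV m v, hξv, Or.inr rfl, hdet, hpos, hprim, hI⟩
  · have hB : IsNormBasis m ℓ v ω₁ ω₂ n :=
      ⟨hn, by rw [h11, ha], by rw [h21, hr, toK_star], by rw [h22, hc], hd⟩
    exact ⟨v, v, hξv, Or.inl rfl, hdet, hpos, hprim, setOf_rightIdeal_eq hm hℓ hdet hpos hB hU⟩

/-- Both senses of Latimer's correspondence lead to a basis whose norm form is the form attached to
`ξ`, or its complex conjugate. -/
theorem exists_classData [NeZero m] (hm : Squarefree m) (hℓ : 0 < ℓ) {ξ : Fin 4 → ℚ}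
    (hξ : ξ ∈ primitiveVectors m ℓ) (hξ' : ξ ∈ cone m) {U : AddSubgroup (B m ℓ)}
    (hU : IsLeftIdeal m ℓ U) (hUξ : HasNormForm m ℓ U (hermMatrix m ξ) ∨
      SameLeftClass m ℓ (latimerIdeal m ℓ (hermMatrix m ξ)) U) :
    ∃ v w, ClassData m ℓ ξ U v w := by
  rcases hUξ with ⟨ω₁, ω₂, n, ⟨rfl, hn, hd⟩, hform⟩ | ⟨α, rfl⟩
  · have hform' : ∀ u w : R m,
        ratK m (nrd m ℓ (incl m ℓ (toK m u) * ω₁ + incl m ℓ (toK m w) * ω₂)) =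
          n * hermForm m (hermMatrix m ξ) (toK m u) (toK m w) := fun u w => by
      rw [← algebraMap_eq_ratK']
      exact hform (toOK m hm u) (toOK m hm w)
    obtain ⟨h11, h21, h22⟩ := gram_of_hasNormForm hform'
    exact exists_classData_aux hm hℓ hξ hξ' hU (n := n) (by exact_mod_cast hn) h11 (Or.inr h21) h22
      (by rw [hd]; simp)
  · obtain ⟨a, hα⟩ : ∃ a, ξ 0 = a := ⟨_, rfl⟩
    have h0 := hξ'.1
    have hphi := hξ.1
    rw [phi0_apply] at hphi
    set b := ratK m (ξ 1) + omegaK m * ratK m (ξ 2) with hb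
    -- the basis `aα`, `(b + ε)α` has Gram matrix `a nrd(α)` times the complex conjugate form
    have hspan : (latimerIdeal m ℓ (hermMatrix m ξ)).map (AddMonoidHom.mulRight (α : B m ℓ)) =
        okSpan m ℓ (incl m ℓ (ratK m (ξ 0)) * α) ((incl m ℓ b + eps m ℓ) * α) := by
      ext z
      constructor
      · rintro ⟨_, ⟨u, w, rfl⟩, rfl⟩
        refine ⟨u, w, ?_⟩
        change (_ + _) * (α : B m ℓ) = _
        rw [add_mul, mul_assoc, mul_assoc]
        rfl
      · rintro ⟨u, w, rfl⟩
        refine ⟨_, ⟨u, w, rfl⟩, ?_⟩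
        change (_ + _) * (α : B m ℓ) = _
        rw [add_mul, mul_assoc, mul_assoc]
        rfl
    rw [hspan] at hU ⊢
    have hnrd := nrd_pos hℓ α.ne_zero
    have hmul : ∀ x y : B m ℓ, (x * α) * star (y * α) = nrd m ℓ α • (x * star y) := fun x y => by
      rw [star_mul, mul_assoc, ← mul_assoc (α : B m ℓ), mul_star_self, Algebra.smul_def,
        ← mul_assoc, ← mul_assoc, Algebra.commutes]
    have hsmul : ∀ (q : ℚ) (x : B m ℓ), coord₁ m ℓ (q • x) = ratK m q * coord₁ m ℓ x :=
      fun q x => by rw [← incl_ratK, coord₁_incl_mul]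
    have hsmul₂ : ∀ (q : ℚ) (x : B m ℓ), coord₂ m ℓ (q • x) = ratK m q * coord₂ m ℓ x :=
      fun q x => by rw [← incl_ratK, coord₂_incl_mul]
    have ci1 : ∀ u : K m, coord₁ m ℓ (incl m ℓ u) = u := fun u => rfl
    have ci2 : ∀ u : K m, coord₂ m ℓ (incl m ℓ u) = 0 := fun u => rfl
    have ce1 : coord₁ m ℓ (eps m ℓ) = 0 := rfl
    have ce2 : coord₂ m ℓ (eps m ℓ) = 1 := by ext <;> simp [coord₂, eps]
    -- `φ₀(ξ, ξ) = ℓ` in terms of the Hermitian matrix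
    have hNb : b * star b + ratK m ℓ = ratK m (ξ 0) * ratK m (ξ 3) := by
      have hs : star b = ratK m (ξ 1) + (ratK m (paramB m) - omegaK m) * ratK m (ξ 2) := by
        rw [hb, star_add, star_mul, star_ratK, star_ratK, star_omegaK]
        rw [algebraMap_eq_ratK]; ring
      have hω := omegaK_sq m
      rw [algebraMap_eq_ratK, algebraMap_eq_ratK] at hω
      have hphi' := congrArg (ratK m) hphi
      simp only [map_add, map_mul, map_sub, map_div₀, map_ofNat] at hphi'
      have h2 : (2 : K m) ≠ 0 := two_ne_zero
      rw [div_eq_iff h2] at hphi'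
      rw [hs, hb]
      apply mul_left_cancel₀ h2
      linear_combination -hphi' - 2 * ratK m (ξ 2) ^ 2 * hω
    refine exists_classData_aux hm hℓ hξ hξ' hU (n := ξ 0 * nrd m ℓ α) (mul_pos h0 hnrd) ?_
      (Or.inl ?_) ?_ ?_
    · rw [hmul, hsmul, coord₁_mul_star, ci1, ci2, star_ratK]
      simp only [map_mul]; ring
    · rw [hmul, hsmul, coord₁_mul_star, ci1, ci2, coord₁_add, coord₂_add, star_ratK, ci1, ce1]
      simp only [map_mul, star_zero]; ring
    · rw [hmul, hsmul, coord₁_mul_star, coord₁_add, coord₂_add, ci1, ci2, ce1, ce2,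
        algebraMap_eq_ratK]
      simp only [map_mul, add_zero, zero_add, star_one, mul_one]
      linear_combination ratK m (nrd m ℓ α) * hNb
    · rw [← coord₂_mul_star_eq_basisDet, hmul, hsmul₂, coord₂_mul_star, coord₁_add, coord₂_add,
        ci1, ci2, ce1, ce2, ci1, ci2]
      simp only [map_mul]; ring

/-! ### Dirichlet series of norm functions -/

/-- Grouping the terms of `∑ N(i)^{-s}` by the value of `N(i)` gives the `L`-series whose
coefficients count the fibres of `N`. -/
lemma hasSum_LSeries_of_card_fiber {ι : Type*} {N : ι → ℕ} (hN : ∀ i, N i ≠ 0) {s : ℂ}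
    (h : Summable fun i => (N i : ℂ) ^ (-s)) {a : ℕ → ℂ}
    (ha : ∀ n ≠ 0, a n = Nat.card {i // N i = n}) :
    LSeriesSummable a s ∧ HasSum (fun i => (N i : ℂ) ^ (-s)) (LSeries a s) := by
  have h1 : HasSum (fun x : Σ n, {i // N i = n} => (N x.2 : ℂ) ^ (-s))
      (∑' i, (N i : ℂ) ^ (-s)) :=
    (Equiv.sigmaFiberEquiv N).hasSum_iff (f := fun i => (N i : ℂ) ^ (-s)) |>.2 h.hasSum
  have h2 : ∀ n, HasSum (fun i : {i // N i = n} => (N i : ℂ) ^ (-s)) (LSeries.term a s n) := by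
    intro n
    have hconst : (fun i : {i // N i = n} => (N i : ℂ) ^ (-s)) = fun _ => (n : ℂ) ^ (-s) := by
      ext i; rw [i.2]
    rw [hconst]
    rcases eq_or_ne n 0 with rfl | hn
    · have : IsEmpty {i // N i = 0} := ⟨fun i => hN i i.2⟩
      rw [LSeries.term_zero]
      exact hasSum_empty
    · have hfin : Finite {i // N i = n} := by
        -- the terms over an infinite fibre would be constant and nonzero
        by_contra hinf
        rw [not_finite_iff_infinite] at hinf
        have h3 : Summable fun i : {i // N i = n} => (N i : ℂ) ^ (-s) := h.subtype _
        rw [hconst, summable_const_iff] at h3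
        simp [Complex.cpow_eq_zero_iff, hn] at h3
      have := Fintype.ofFinite {i // N i = n}
      rw [LSeries.term_of_ne_zero hn, ha n hn, Nat.card_eq_fintype_card, div_eq_mul_inv,
        ← Complex.cpow_neg, ← nsmul_eq_mul]
      convert hasSum_fintype fun _ : {i // N i = n} => (n : ℂ) ^ (-s)
      simp
  have h3 := h1.sigma h2
  refine ⟨h3.summable, ?_⟩
  rw [LSeries, h3.tsum_eq]
  exact h.hasSum

/-- Removing the Euler factors at a finite set of primes from the sum of a completely
multiplicative function over the nonzero ideals. -/
lemma hasSum_mul_prod_one_sub {D : Type*} [CommRing D] [IsDedekindDomain D] {f : Ideal D → ℂ}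
    (hf : ∀ I J, f (I * J) = f I * f J) {Z : ℂ}
    (hZ : HasSum ({I : Ideal D | I ≠ ⊥}.indicator f) Z) (T : Finset (Ideal D))
    (hT : ∀ 𝔭 ∈ T, 𝔭.IsPrime ∧ 𝔭 ≠ ⊥) :
    HasSum ({I : Ideal D | I ≠ ⊥ ∧ ∀ 𝔭 ∈ T, ¬ 𝔭 ∣ I}.indicator f)
      (Z * ∏ 𝔭 ∈ T, (1 - f 𝔭)) := by
  classical
  induction T using Finset.induction_on with
  | empty => simpa using hZ
  | insert 𝔮 T hq ih =>
    have hW := ih fun 𝔭 h𝔭 => hT 𝔭 (Finset.mem_insert_of_mem h𝔭)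
    set S : Set (Ideal D) := {I | I ≠ ⊥ ∧ ∀ 𝔭 ∈ T, ¬ 𝔭 ∣ I} with hS
    set W := Z * ∏ 𝔭 ∈ T, (1 - f 𝔭)
    have hprime : ∀ 𝔭 ∈ insert 𝔮 T, Prime 𝔭 := fun 𝔭 h =>
      Ideal.prime_of_isPrime (hT 𝔭 h).2 (hT 𝔭 h).1
    have hq0 : 𝔮 ≠ 0 := (hprime 𝔮 (Finset.mem_insert_self _ _)).ne_zero
    have hmem : ∀ I, 𝔮 * I ∈ S ↔ I ∈ S := by
      intro I
      simp only [hS, Set.mem_ofPred_eq, ← Ideal.zero_eq_bot]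
      refine and_congr (mul_ne_zero_iff_left hq0) (forall₂_congr fun 𝔭 h𝔭 => not_congr ?_)
      have hp := hprime 𝔭 (Finset.mem_insert_of_mem h𝔭)
      rw [hp.dvd_mul, or_iff_right]
      intro hd
      rw [hp.dvd_prime_iff_associated (hprime 𝔮 (Finset.mem_insert_self _ _)),
        associated_iff_eq] at hd
      exact hq (hd ▸ h𝔭)
    -- the ideals of `S` divisible by `𝔮` are the products `𝔮 I` with `I ∈ S`
    have hg : HasSum ((S ∩ {I | 𝔮 ∣ I}).indicator f) (f 𝔮 * W) := by
      rw [← (mul_right_injective₀ hq0).hasSum_iff]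
      · have e : (S ∩ {I | 𝔮 ∣ I}).indicator f ∘ (𝔮 * ·) =
            fun I => f 𝔮 * S.indicator f I := by
          ext1 I
          have hI : 𝔮 * I ∈ S ∩ {I | 𝔮 ∣ I} ↔ I ∈ S :=
            (and_iff_left (dvd_mul_right 𝔮 I)).trans (hmem I)
          simp only [Function.comp_apply, Set.indicator_apply, hI, hf, mul_ite, mul_zero]
        rw [e]
        exact hW.mul_left (f 𝔮)
      · intro I hI
        rw [Set.indicator_of_notMem]
        rintro ⟨-, J, rfl⟩
        exact hI ⟨J, rfl⟩
    rw [Finset.prod_insert hq]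
    have e : ({I : Ideal D | I ≠ ⊥ ∧ ∀ 𝔭 ∈ insert 𝔮 T, ¬ 𝔭 ∣ I}.indicator f) =
        fun I => S.indicator f I - (S ∩ {I | 𝔮 ∣ I}).indicator f I := by
      ext1 I
      have h1 : I ∈ {I : Ideal D | I ≠ ⊥ ∧ ∀ 𝔭 ∈ insert 𝔮 T, ¬ 𝔭 ∣ I} ↔ I ∈ S ∧ ¬ 𝔮 ∣ I := by
        simp only [hS, Set.mem_ofPred_eq, Finset.forall_mem_insert]
        tauto
      have h2 : I ∈ S ∩ {I | 𝔮 ∣ I} ↔ I ∈ S ∧ 𝔮 ∣ I := Iff.rfl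
      simp only [Set.indicator_apply, h1, h2]
      by_cases h3 : I ∈ S <;> by_cases h4 : 𝔮 ∣ I <;> simp [h3, h4]
    have e' : Z * ((1 - f 𝔮) * ∏ 𝔭 ∈ T, (1 - f 𝔭)) = W - f 𝔮 * W := by
      simp only [W]; ring
    rw [e, e']
    exact hW.sub hg

lemma dvd_absNorm_iff_exists_mem_primesOverFinset {F : Type*} [Field F] [NumberField F] {p : ℕ}
    (hp : p.Prime) (I : Ideal (𝓞 F)) :
    p ∣ Ideal.absNorm I ↔
      ∃ 𝔭 ∈ IsDedekindDomain.primesOverFinset (Ideal.span {(p : ℤ)}) (𝓞 F), 𝔭 ∣ I := by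
  have hp' : Prime (p : ℤ) := Nat.prime_iff_prime_int.1 hp
  have hbot : Ideal.span {(p : ℤ)} ≠ ⊥ := by
    rw [Ne, Ideal.span_singleton_eq_bot]; exact hp'.ne_zero
  have hmax : (Ideal.span {(p : ℤ)}).IsMaximal :=
    PrincipalIdealRing.isMaximal_of_irreducible hp'.irreducible
  simp only [IsDedekindDomain.mem_primesOverFinset_iff hbot]
  constructor
  · intro h
    obtain ⟨𝔭, h1, h2, h3⟩ := Ideal.exists_isMaximal_dvd_of_dvd_absNorm' hp I h
    exact ⟨𝔭, ⟨h1.isPrime, ⟨h2.symm⟩⟩, h3⟩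
  · rintro ⟨𝔭, ⟨h1, h2⟩, h3⟩
    refine dvd_trans ?_ (Ideal.absNorm_dvd_absNorm_of_le (Ideal.dvd_iff_le.1 h3))
    have h4 := Int.absNorm_under_dvd_absNorm 𝔭
    rwa [← h2.over, Ideal.absNorm_span_singleton, Algebra.norm_self, MonoidHom.id_apply,
      Int.natAbs_natCast] at h4

/-- The Dedekind zeta function with the Euler factors above `𝒫` removed is the sum over the
nonzero ideals of norm prime to `𝒫`. -/
lemma hasSum_dedekindZeta_mul_prod {F : Type*} [Field F] [NumberField F] {P : Finset ℕ}
    (hP : ∀ p ∈ P, p.Prime) {s : ℂ}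
    (h : Summable fun I : {I : Ideal (𝓞 F) // I ≠ ⊥} => (Ideal.absNorm I.1 : ℂ) ^ (-s)) :
    HasSum (fun I : {I : Ideal (𝓞 F) // I ≠ ⊥ ∧ ∀ p ∈ P, ¬ p ∣ Ideal.absNorm I} =>
        (Ideal.absNorm I.1 : ℂ) ^ (-s))
      (NumberField.dedekindZeta F s *
        ∏ p ∈ P, ∏ 𝔭 ∈ IsDedekindDomain.primesOverFinset (Ideal.span {(p : ℤ)}) (𝓞 F),
          (1 - (Ideal.absNorm 𝔭 : ℂ) ^ (-s))) := by
  classical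
  have h0 : ∀ I : {I : Ideal (𝓞 F) // I ≠ ⊥}, Ideal.absNorm I.1 ≠ 0 := fun I => by
    rw [Ne, Ideal.absNorm_eq_zero_iff]; exact I.2
  have h1 := (hasSum_LSeries_of_card_fiber h0 h
    (a := fun n => (Nat.card {I : Ideal (𝓞 F) // Ideal.absNorm I = n} : ℂ)) fun n hn => by
      congr 1
      refine Nat.card_congr ⟨fun I => ⟨⟨I.1, fun hI => hn ?_⟩, I.2⟩, fun I => ⟨I.1.1, I.2⟩,
        fun _ => rfl, fun _ => rfl⟩
      rw [← I.2, hI, Ideal.absNorm_bot]).2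
  have hover : ∀ p ∈ P, ∀ 𝔭 ∈ IsDedekindDomain.primesOverFinset (Ideal.span {(p : ℤ)}) (𝓞 F),
      𝔭.IsPrime ∧ 𝔭.LiesOver (Ideal.span {(p : ℤ)}) := fun p hp 𝔭 h𝔭 => by
    have hp' : Prime (p : ℤ) := Nat.prime_iff_prime_int.1 (hP p hp)
    have hmax : (Ideal.span {(p : ℤ)}).IsMaximal :=
      PrincipalIdealRing.isMaximal_of_irreducible hp'.irreducible
    rwa [IsDedekindDomain.mem_primesOverFinset_iff] at h𝔭
    rw [Ne, Ideal.span_singleton_eq_bot]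
    exact hp'.ne_zero
  have hdisj : (P : Set ℕ).PairwiseDisjoint fun p =>
      IsDedekindDomain.primesOverFinset (Ideal.span {(p : ℤ)}) (𝓞 F) := by
    intro p hp q hq hpq
    rw [Function.onFun, Finset.disjoint_left]
    intro 𝔭 h𝔭 h𝔭'
    apply hpq
    have e := (hover p hp 𝔭 h𝔭).2.over.trans (hover q hq 𝔭 h𝔭').2.over.symm
    have e2 := congrArg Ideal.absNorm e
    simpa [Ideal.absNorm_span_singleton] using e2
  rw [← Finset.prod_biUnion hdisj]
  have h2 := hasSum_mul_prod_one_sub (f := fun I : Ideal (𝓞 F) => (Ideal.absNorm I : ℂ) ^ (-s))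
    (fun I J => by rw [map_mul, Nat.cast_mul]; exact Complex.natCast_mul_natCast_cpow _ _ _)
    (hasSum_subtype_iff_indicator.1 h1)
    (P.biUnion fun p => IsDedekindDomain.primesOverFinset (Ideal.span {(p : ℤ)}) (𝓞 F))
    (fun 𝔭 h𝔭 => by
      obtain ⟨p, hp, h𝔭⟩ := Finset.mem_biUnion.1 h𝔭
      refine ⟨(hover p hp 𝔭 h𝔭).1, fun hbot => ?_⟩
      have e := (hover p hp 𝔭 h𝔭).2.over
      rw [hbot, Ideal.under_bot, Ideal.span_singleton_eq_bot] at e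
      exact (hP p hp).ne_zero (by exact_mod_cast e))
  have hset : {I : Ideal (𝓞 F) | I ≠ ⊥ ∧ ∀ 𝔭 ∈ P.biUnion fun p =>
        IsDedekindDomain.primesOverFinset (Ideal.span {(p : ℤ)}) (𝓞 F), ¬ 𝔭 ∣ I} =
      {I | I ≠ ⊥ ∧ ∀ p ∈ P, ¬ p ∣ Ideal.absNorm I} := by
    ext I
    refine and_congr_right fun _ => ⟨fun hI p hp hd => ?_, fun hI 𝔭 h𝔭 hd => ?_⟩
    · obtain ⟨𝔭, h𝔭, hd⟩ := (dvd_absNorm_iff_exists_mem_primesOverFinset (hP p hp) I).1 hd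
      exact hI 𝔭 (Finset.mem_biUnion.2 ⟨p, hp, h𝔭⟩) hd
    · obtain ⟨p, hp, h𝔭⟩ := Finset.mem_biUnion.1 h𝔭
      exact hI p hp ((dvd_absNorm_iff_exists_mem_primesOverFinset (hP p hp) I).2 ⟨𝔭, h𝔭, hd⟩)
  rw [hset] at h2
  exact hasSum_subtype_iff_indicator.2 h2

/-- The product of two absolutely convergent sums as a sum over a set in bijection with the product
of the index sets. -/
lemma hasSum_of_bijective_mul {α β γ : Type*} {f : α → ℂ} {g : β → ℂ} {k : γ → ℂ} {a b : ℂ}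
    (hf : HasSum f a) (hg : HasSum g b) {Φ : α × β → γ} (hΦ : Function.Bijective Φ)
    (h : ∀ x, k (Φ x) = f x.1 * g x.2) : HasSum k (a * b) := by
  have h1 := hf.mul hg (summable_mul_of_summable_norm hf.summable.norm hg.summable.norm)
  rw [← (Equiv.ofBijective Φ hΦ).hasSum_iff]
  rwa [show k ∘ Equiv.ofBijective Φ hΦ = fun x => f x.1 * g x.2 from funext h]

/-! ### Convergence -/

/-- `∑ F(c)^{-σ}` converges for `σ > 2` if the quaternary form `F` dominates the squares of the
coordinates. -/
lemma summable_rpow_neg_of_sq_le {ι : Type*} {x : ι → Fin 4 → ℤ} (hx : Function.Injective x)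
    {F : ι → ℤ} {C : ℤ} (hC : 0 < C) (hF : ∀ c, 0 ≤ F c) (hF0 : ∀ c, x c = 0 → F c = 0)
    (h : ∀ c i, x c i ^ 2 ≤ C * F c) {σ : ℝ} (hσ : 2 < σ) :
    Summable fun c => (F c : ℝ) ^ (-σ) := by
  -- compare with `∑ ‖x‖^{-2σ}` over the lattice `ℤ⁴`
  let b := Pi.basisFun ℝ (Fin 4)
  let L := Submodule.span ℤ (Set.range b)
  have hr : -(2 * σ) < -(Module.finrank ℤ L : ℝ) := by
    have : Module.finrank ℤ L = 4 := by rw [ZLattice.rank ℝ L]; simp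
    rw [this]; push_cast; linarith
  have hs := ZLattice.summable_norm_rpow L _ hr
  have hmem : ∀ c, (fun i => (x c i : ℝ)) ∈ L := fun c => by
    rw [b.mem_span_iff_repr_mem ℤ]
    intro i
    exact ⟨x c i, by simp [b]⟩
  have hinj : Function.Injective fun c => (⟨_, hmem c⟩ : L) := fun c c' hcc => hx <| by
    ext i
    have : (x c i : ℝ) = x c' i := congrFun (congrArg Subtype.val hcc) i
    exact_mod_cast this
  have hC' : (0 : ℝ) < C := by exact_mod_cast hC
  refine Summable.of_nonneg_of_le (fun c => ?_) (fun c => ?_)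
    ((hs.comp_injective hinj).mul_left ((C : ℝ) ^ σ))
  · have := hF c
    positivity
  · have hFc : (0 : ℝ) ≤ F c := by exact_mod_cast hF c
    simp only [Function.comp_apply]
    rcases eq_or_ne (x c) 0 with h0 | h0
    · rw [hF0 c h0, Int.cast_zero, Real.zero_rpow (by linarith)]
      positivity
    have hpos : 0 < ‖(⟨_, hmem c⟩ : L)‖ := by
      rw [norm_pos_iff]
      intro hz
      apply h0
      ext i
      have : (x c i : ℝ) = 0 := congrFun (congrArg Subtype.val hz) i
      exact_mod_cast this
    have hnorm : ‖(⟨_, hmem c⟩ : L)‖ ^ 2 ≤ C * F c := by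
      rw [← Real.le_sqrt (norm_nonneg _) (by positivity)]
      refine (pi_norm_le_iff_of_nonneg (Real.sqrt_nonneg _)).2 fun i => ?_
      rw [Real.norm_eq_abs]
      apply Real.abs_le_sqrt
      have : (x c i : ℝ) ^ 2 ≤ C * F c := by exact_mod_cast h c i
      exact this
    have hCF : (0 : ℝ) < C * F c := lt_of_lt_of_le (by positivity) hnorm
    have hF' : (0 : ℝ) < F c := pos_of_mul_pos_right hCF hC'.le
    calc (F c : ℝ) ^ (-σ) = (C : ℝ) ^ σ * (C * F c : ℝ) ^ (-σ) := by
          rw [Real.mul_rpow hC'.le hFc, ← mul_assoc, ← Real.rpow_add hC']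
          simp
      _ ≤ (C : ℝ) ^ σ * (‖(⟨_, hmem c⟩ : L)‖ ^ 2) ^ (-σ) := by
          gcongr ?_ * ?_
          exact Real.rpow_le_rpow_of_nonpos (by positivity) hnorm (by linarith)
      _ = _ := by
          rw [← Real.rpow_natCast, ← Real.rpow_mul (norm_nonneg _)]
          congr 2
          push_cast; ring

/-- The norm form dominates the squares of the coordinates. -/
lemma sq_le_norm [NeZero m] (z : R m) : z.re ^ 2 ≤ 4 * z.norm ∧ z.im ^ 2 ≤ 4 * z.norm := by
  have h := four_mul_norm m z
  have hd := disc_le m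
  rw [QuadraticAlgebra.trace_def] at h
  generalize z.norm = n, z.re = x, z.im = y at h ⊢
  have hB : paramB m = 0 ∨ paramB m = 1 := by unfold paramB; split_ifs <;> simp
  have him : y ^ 2 ≤ 4 * n := by
    nlinarith [sq_nonneg y, sq_nonneg (2 * x + paramB m * y)]
  refine ⟨?_, him⟩
  rcases hB with hB | hB <;> rw [hB] at h hd <;>
    nlinarith [sq_nonneg y, sq_nonneg (x + y), sq_nonneg (x + 2 * y), sq_nonneg x]

/-- Completing the square in the second variable. -/
lemma apply_three_mul_rowForm (v : Fin 4 → ℤ) (c : Fin 2 → R m) : v 3 * rowForm m v c =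
    (v 3 • c 1 + ⟨v 1, v 2⟩ * c 0).norm + detForm m v * (c 0).norm := by
  rw [norm_add', map_mul, detForm, rowForm]
  simp only [QuadraticAlgebra.norm_def, QuadraticAlgebra.trace_def, QuadraticAlgebra.re_mul,
    QuadraticAlgebra.im_mul, QuadraticAlgebra.re_star, QuadraticAlgebra.im_star,
    QuadraticAlgebra.re_smul, QuadraticAlgebra.im_smul, smul_eq_mul, star_mul]
  ring

lemma summable_rowForm [NeZero m] (hℓ : 0 < ℓ) {v : Fin 4 → ℤ} (hv : detForm m v = ℓ)
    (hv0 : 0 < v 0) {σ : ℝ} (hσ : 2 < σ) :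
    Summable fun c : Fin 2 → R m => (rowForm m v c : ℝ) ^ (-σ) := by
  have hl : (1 : ℤ) ≤ ℓ := by exact_mod_cast hℓ
  have hb := norm_nonneg' m ⟨v 1, v 2⟩
  have hv3 : 0 < v 3 := by
    have : 0 < v 0 * v 3 := by rw [detForm] at hv; linarith
    exact pos_of_mul_pos_right this hv0.le
  have hnn : ∀ c : Fin 2 → R m, 0 ≤ rowForm m v c := fun c => by
    rcases eq_or_ne c 0 with rfl | hc
    · simp [rowForm]
    · exact (rowForm_pos hℓ hv hv0 hc).le
  have h1 : ∀ c : Fin 2 → R m, (c 1).norm ≤ v 0 * rowForm m v c := fun c => by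
    rw [apply_zero_mul_rowForm, hv]
    nlinarith [norm_nonneg' m (c 1), norm_nonneg' m (v 0 • c 0 + star ⟨v 1, v 2⟩ * c 1)]
  have h0 : ∀ c : Fin 2 → R m, (c 0).norm ≤ v 3 * rowForm m v c := fun c => by
    rw [apply_three_mul_rowForm, hv]
    nlinarith [norm_nonneg' m (c 0), norm_nonneg' m (v 3 • c 1 + ⟨v 1, v 2⟩ * c 0)]
  refine summable_rpow_neg_of_sq_le (x := fun c => ![(c 0).re, (c 0).im, (c 1).re, (c 1).im])
    (fun c c' h => ?_) (C := 4 * (v 0 + v 3)) (by positivity) hnn (fun c hc => ?_)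
    (fun c i => ?_) hσ
  · have e0 := congrFun h 0
    have e1 := congrFun h 1
    have e2 := congrFun h 2
    have e3 := congrFun h 3
    ext i <;> fin_cases i <;> assumption
  · have e0 := congrFun hc 0
    have e1 := congrFun hc 1
    have e2 := congrFun hc 2
    have e3 := congrFun hc 3
    have : c = 0 := by ext i <;> fin_cases i <;> assumption
    rw [this]; simp [rowForm]
  · have a0 := sq_le_norm (c 0)
    have a1 := sq_le_norm (c 1)
    have b0 := mul_nonneg hv0.le (hnn c)
    have b3 := mul_nonneg hv3.le (hnn c)
    have c0 := h0 c
    have c1 := h1 c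
    rw [mul_assoc, add_mul]
    fin_cases i <;> simp <;> linarith [a0.1, a0.2, a1.1, a1.2]

/-! ### The reduced norms of a right ideal -/

namespace ClassData

variable [NeZero m] {ξ : Fin 4 → ℚ} {U : AddSubgroup (B m ℓ)} {v w : Fin 4 → ℤ}

lemma det' (h : ClassData m ℓ ξ U v w) : detForm m w = ℓ := by
  rcases h.conj with rfl | rfl
  · exact h.det
  · rw [detForm_conjV, h.det]

lemma pos' (h : ClassData m ℓ ξ U v w) : 0 < w 0 := by
  rcases h.conj with rfl | rfl
  · exact h.pos
  · exact h.pos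

/-- By primitivity, the values of the form generate `ℤ`. -/
lemma one_mem (h : ClassData m ℓ ξ U v w) {A : AddSubgroup ℤ} (hA : ∀ c, rowForm m w c ∈ A) :
    1 ∈ A := by
  have hv : ∀ c, rowForm m v c ∈ A := fun c => by
    rcases h.conj with rfl | rfl
    · exact hA c
    · have := hA (star c)
      rwa [rowForm_conjV, star_star] at this
  obtain ⟨x, y, z, hxyz⟩ := h.prim
  have h0 : v 0 ∈ A := by simpa [rowForm] using hv ![1, 0]
  have h3 : v 3 ∈ A := by simpa [rowForm] using hv ![0, 1]
  have hz := hv ![star z, 1]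
  -- the value at the row `(z̄, 1)` is `v₀ N(z) + T(b z̄) + v₃`
  have e : 1 = (y + z.norm) • v 0 + (x + 1) • v 3 - rowForm m v ![star z, 1] := by
    simp only [rowForm, Matrix.cons_val_zero, Matrix.cons_val_one, QuadraticAlgebra.norm_star,
      star_one, mul_one, map_one, smul_eq_mul]
    rw [mul_comm (star z)]
    linear_combination -hxyz
  rw [e]
  exact A.sub_mem (A.add_mem (A.zsmul_mem h0 _) (A.zsmul_mem h3 _)) hz

end ClassData

lemma mem_rightId_iff [NeZero m] (hm : Squarefree m) {v : Fin 4 → ℤ} {c : Fin 2 → R m}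
    {z : B m ℓ} : z ∈ rightId m ℓ v c ↔ ∃ x, z = star (el m ℓ v x c) := by
  rw [rightId, mem_conjIdeal, mem_leftId_iff hm]
  exact exists_congr fun x => star_eq_iff_star_eq.trans eq_comm

lemma nrd_el {v : Fin 4 → ℤ} (hv : detForm m v = ℓ) (x c : Fin 2 → R m) :
    nrd m ℓ (el m ℓ v x c) = rowForm m v c * rowForm m v x := by
  have h : (el m ℓ v x x).re = rowForm m v x := by
    have h1 : coord₁ m ℓ (el m ℓ v x x) = toK m (algebraMap ℤ (R m) (rowForm m v x)) := by
      rw [el, coord₁_quat, herm_self]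
    rw [toK_intCast] at h1
    exact congrArg QuadraticAlgebra.re h1
  rw [nrd, el_mul_star_el hv, algebraMap_eq_ratK, incl_ratK, QuaternionAlgebra.re_smul, h,
    smul_eq_mul]

lemma nrdLattice_rightId [NeZero m] (hm : Squarefree m) {ξ : Fin 4 → ℚ}
    {U : AddSubgroup (B m ℓ)} {v w : Fin 4 → ℤ} (h : ClassData m ℓ ξ U v w) (c : Fin 2 → R m) :
    nrdLattice m ℓ (rightId m ℓ w c) = AddSubgroup.zmultiples (rowForm m w c : ℚ) := by
  apply le_antisymm
  · rw [nrdLattice, AddSubgroup.closure_le]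
    rintro _ ⟨z, hz, rfl⟩
    obtain ⟨x, rfl⟩ := (mem_rightId_iff hm).1 hz
    rw [nrd_star, nrd_el h.det']
    exact ⟨rowForm m w x, by simp [mul_comm]⟩
  · rw [AddSubgroup.zmultiples_le]
    have h1 := h.one_mem (A := (nrdLattice m ℓ (rightId m ℓ w c)).comap
      ((AddMonoidHom.mulLeft (rowForm m w c : ℚ)).comp (Int.castAddHom ℚ))) fun x => by
        change (rowForm m w c : ℚ) * (rowForm m w x : ℚ) ∈ nrdLattice m ℓ (rightId m ℓ w c)
        rw [← nrd_el h.det', ← nrd_star]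
        exact AddSubgroup.subset_closure ⟨_, (mem_rightId_iff hm).2 ⟨x, rfl⟩, rfl⟩
    change (rowForm m w c : ℚ) * ((1 : ℤ) : ℚ) ∈ nrdLattice m ℓ (rightId m ℓ w c) at h1
    rwa [Int.cast_one, mul_one] at h1

/-! ### Primitive right ideals and contents -/

/-- The right ideals attached to the unimodular rows, that is, those not of the form `h Y` for a
right ideal `Y` in the class and a nonunit `h ∈ 𝒪_K`. -/
def primIds (m ℓ : ℕ) [NeZero m] (v : Fin 4 → ℤ) : Set (AddSubgroup (B m ℓ)) :=
  rightId m ℓ v '' {c | IsCoprime (c 0) (c 1)}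

lemma ne_zero_of_isCoprime [NeZero m] {c : Fin 2 → R m} (h : IsCoprime (c 0) (c 1)) : c ≠ 0 := by
  rintro rfl
  exact not_isCoprime_zero_zero h

lemma primIds_subset [NeZero m] (v : Fin 4 → ℤ) :
    primIds m ℓ v ⊆ rightId m ℓ v '' {c | c ≠ 0} :=
  Set.image_mono fun _ => ne_zero_of_isCoprime

lemma rowForm_smul (v : Fin 4 → ℤ) (h : R m) (c : Fin 2 → R m) :
    rowForm m v (h • c) = h.norm * rowForm m v c := by
  have e : (h • c) 0 * ⟨v 1, v 2⟩ * star ((h • c) 1) =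
      (h.norm : ℤ) • (c 0 * ⟨v 1, v 2⟩ * star (c 1)) := by
    simp only [Pi.smul_apply, smul_eq_mul, star_mul]
    ext <;> simp [QuadraticAlgebra.norm_def] <;> ring
  rw [rowForm, rowForm, e]
  simp only [Pi.smul_apply, smul_eq_mul, map_mul]
  simp only [QuadraticAlgebra.trace_def, QuadraticAlgebra.re_smul, QuadraticAlgebra.im_smul,
    smul_eq_mul]
  ring

lemma rightId_smul [NeZero m] (hm : Squarefree m) (v : Fin 4 → ℤ) (h : R m) (c : Fin 2 → R m) :
    rightId m ℓ v (h • c) =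
      (rightId m ℓ v c).map (AddMonoidHom.mulLeft (incl m ℓ (toK m h))) := by
  have e : ∀ x, star (el m ℓ v x (h • c)) = incl m ℓ (toK m h) * star (el m ℓ v x c) := fun x => by
    rw [el_smul_right, star_mul, ← incl_star, ← toK_star, star_star]
  ext z
  rw [mem_rightId_iff hm]
  constructor
  · rintro ⟨x, rfl⟩
    exact ⟨_, (mem_rightId_iff hm).2 ⟨x, rfl⟩, (e x).symm⟩
  · rintro ⟨y, hy, rfl⟩
    obtain ⟨x, rfl⟩ := (mem_rightId_iff hm).1 hy
    exact ⟨x, (e x).symm⟩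

lemma normRight_rightId_of_ne_zero [NeZero m] (hm : Squarefree m) (hℓ : 0 < ℓ) {v : Fin 4 → ℤ}
    (hv : detForm m v = ℓ) (hv0 : 0 < v 0) {c : Fin 2 → R m} (hc : c ≠ 0) :
    (normRight m ℓ (rightId m ℓ v c) : ℤ) = rowForm m v c :=
  normRight_rightId hm (rowForm_pos hℓ hv hv0 hc)

/-- The content of a row is determined up to units by the right ideal attached to it. -/
lemma dvd_of_rightId_smul_eq [NeZero m] (hm : Squarefree m) (hℓ : 0 < ℓ) {v : Fin 4 → ℤ}
    (hv : detForm m v = ℓ) (hv0 : 0 < v 0) {h h' : R m} (hh : h ≠ 0) (hh' : h' ≠ 0)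
    {c c' : Fin 2 → R m} (hc : IsCoprime (c 0) (c 1)) (hc' : IsCoprime (c' 0) (c' 1))
    (heq : rightId m ℓ v (h • c) = rightId m ℓ v (h' • c')) : h ∣ h' := by
  obtain ⟨g, -, -, hg⟩ := (rightId_eq_iff hm hv
    (rowForm_pos hℓ hv hv0 (smul_ne_zero hh (ne_zero_of_isCoprime hc)))
    (rowForm_pos hℓ hv hv0 (smul_ne_zero hh' (ne_zero_of_isCoprime hc')))).1 heq
  rw [Matrix.smul_vecMul] at hg
  obtain ⟨a, b, hab⟩ := hc'
  have h0 : h' * c' 0 = h * (c ᵥ* g) 0 := congrFun hg 0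
  have h1 : h' * c' 1 = h * (c ᵥ* g) 1 := congrFun hg 1
  exact ⟨a * (c ᵥ* g) 0 + b * (c ᵥ* g) 1, by linear_combination -h' * hab + a * h0 + b * h1⟩

section ClassNumberOne

variable [NeZero m]

/-- A generator, in coordinates, of an ideal of the principal ideal ring `𝒪_K`. -/
lemma exists_span_toOK_eq (hm : Squarefree m) [IsPrincipalIdealRing (R m)] (I : Ideal (𝓞 (K m))) :
    ∃ h, Ideal.span {toOK m hm h} = I := by
  have : IsPrincipalIdealRing (𝓞 (K m)) :=
    IsPrincipalIdealRing.of_surjective (toOK m hm).toRingHom (toOK m hm).surjective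
  obtain ⟨g, hg⟩ := IsPrincipalIdealRing.principal I
  exact ⟨(toOK m hm).symm g, by rw [RingEquiv.apply_symm_apply, hg]⟩

/-- A chosen generator of an ideal of `𝒪_K`. -/
def gen (hm : Squarefree m) [IsPrincipalIdealRing (R m)] (I : Ideal (𝓞 (K m))) : R m :=
  (exists_span_toOK_eq hm I).choose

variable (hm : Squarefree m) [IsPrincipalIdealRing (R m)]

lemma span_gen (I : Ideal (𝓞 (K m))) : Ideal.span {toOK m hm (gen hm I)} = I :=
  (exists_span_toOK_eq hm I).choose_spec

lemma gen_ne_zero {I : Ideal (𝓞 (K m))} (hI : I ≠ ⊥) : gen hm I ≠ 0 := fun h => hI <| by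
  rw [← span_gen hm I, h, map_zero, Ideal.span_singleton_eq_bot]

lemma norm_gen (I : Ideal (𝓞 (K m))) : (gen hm I).norm = Ideal.absNorm I := by
  conv_rhs => rw [← span_gen hm I, absNorm_span_toOK]
  exact (Int.natAbs_of_nonneg (norm_nonneg' m _)).symm

/-- The right ideal `h Y`, where `h` is the chosen generator of the ideal `I` of `𝒪_K`. -/
def mulId (ℓ : ℕ) (I : Ideal (𝓞 (K m))) (Y : AddSubgroup (B m ℓ)) : AddSubgroup (B m ℓ) :=
  Y.map (AddMonoidHom.mulLeft (incl m ℓ (toK m (gen hm I))))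

lemma mulId_rightId (I : Ideal (𝓞 (K m))) (v : Fin 4 → ℤ) (c : Fin 2 → R m) :
    mulId hm ℓ I (rightId m ℓ v c) = rightId m ℓ v (gen hm I • c) :=
  (rightId_smul hm v _ c).symm

lemma normRight_mulId (hℓ : 0 < ℓ) {v : Fin 4 → ℤ} (hv : detForm m v = ℓ) (hv0 : 0 < v 0)
    {I : Ideal (𝓞 (K m))} (hI : I ≠ ⊥) {Y : AddSubgroup (B m ℓ)}
    (hY : Y ∈ primIds m ℓ v) :
    normRight m ℓ (mulId hm ℓ I Y) = Ideal.absNorm I * normRight m ℓ Y := by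
  obtain ⟨c, hc, rfl⟩ := hY
  have hc0 := ne_zero_of_isCoprime hc
  have h1 := normRight_rightId_of_ne_zero hm hℓ hv hv0 hc0
  have h2 := normRight_rightId_of_ne_zero hm hℓ hv hv0 (smul_ne_zero (gen_ne_zero hm hI) hc0)
  rw [rowForm_smul, norm_gen, ← h1] at h2
  rw [mulId_rightId]
  exact_mod_cast h2

lemma mulId_injective (hℓ : 0 < ℓ) {v : Fin 4 → ℤ} (hv : detForm m v = ℓ) (hv0 : 0 < v 0)
    {I I' : Ideal (𝓞 (K m))} (hI : I ≠ ⊥) (hI' : I' ≠ ⊥)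
    {Y Y' : AddSubgroup (B m ℓ)} (hY : Y ∈ primIds m ℓ v) (hY' : Y' ∈ primIds m ℓ v)
    (h : mulId hm ℓ I Y = mulId hm ℓ I' Y') : I = I' ∧ Y = Y' := by
  have hII : I = I' := by
    obtain ⟨c, hc, rfl⟩ := hY
    obtain ⟨c', hc', rfl⟩ := hY'
    rw [mulId_rightId, mulId_rightId] at h
    have h1 := dvd_of_rightId_smul_eq hm hℓ hv hv0 (gen_ne_zero hm hI) (gen_ne_zero hm hI')
      hc hc' h
    have h2 := dvd_of_rightId_smul_eq hm hℓ hv hv0 (gen_ne_zero hm hI') (gen_ne_zero hm hI)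
      hc' hc h.symm
    rw [← span_gen hm I, ← span_gen hm I', Ideal.span_singleton_eq_span_singleton]
    exact associated_of_dvd_dvd (map_dvd (toOK m hm) h1) (map_dvd (toOK m hm) h2)
  subst hII
  refine ⟨rfl, AddSubgroup.map_injective (fun x y hxy => ?_) h⟩
  have hne : incl m ℓ (toK m (gen hm I)) ≠ 0 := fun h0 => gen_ne_zero hm hI <| by
    apply toK_injective m
    rw [map_zero]
    have e := congrArg (coord₁ m ℓ) h0
    exact e
  exact (isUnit_of_ne_zero hℓ hne).mul_left_cancel hxy

lemma exists_mulId_eq {v : Fin 4 → ℤ} {J : AddSubgroup (B m ℓ)}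
    (hJ : J ∈ rightId m ℓ v '' {c | c ≠ 0}) :
    ∃ I, I ≠ ⊥ ∧ ∃ Y ∈ primIds m ℓ v, mulId hm ℓ I Y = J := by
  obtain ⟨c, hc, rfl⟩ := hJ
  obtain ⟨d, x, y, hd, h0, h1, hxy⟩ := exists_eq_mul_isCoprime (x := c 0) (y := c 1)
    fun h => hc (by ext1 i; fin_cases i; exacts [h.1, h.2])
  have hspan := span_gen hm (Ideal.span {toOK m hm d})
  rw [Ideal.span_singleton_eq_span_singleton] at hspan
  obtain ⟨u, hu⟩ : Associated (gen hm (Ideal.span {toOK m hm d})) d := by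
    simpa using hspan.map (toOK m hm).symm
  refine ⟨Ideal.span {toOK m hm d}, ?_, _, ⟨(u : R m) • ![x, y], ?_, rfl⟩, ?_⟩
  · rw [Ne, Ideal.span_singleton_eq_bot]
    simpa using hd
  -- the chosen generator differs from `d` by the unit `u`
  · obtain ⟨a, b, hab⟩ := hxy
    refine ⟨a * ↑u⁻¹, b * ↑u⁻¹, ?_⟩
    have := u.inv_mul
    simp
    linear_combination hab + (a * x + b * y) * this
  · rw [mulId_rightId, smul_smul, hu]
    congr 1
    ext1 i
    fin_cases i
    · exact h0.symm
    · exact h1.symm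

end ClassNumberOne

/-! ### Assembling the Dirichlet series -/

section Series

variable [NeZero m]

lemma summable_normRight (hm : Squarefree m) (hℓ : 0 < ℓ) {v : Fin 4 → ℤ}
    (hv : detForm m v = ℓ) (hv0 : 0 < v 0) {S : Set (AddSubgroup (B m ℓ))}
    (hS : S ⊆ rightId m ℓ v '' {c | c ≠ 0}) {s : ℂ} (hs : 2 < s.re) :
    Summable fun I : S => (normRight m ℓ I.1 : ℂ) ^ (-s) := by
  choose c hc0 hc using fun I : S => hS I.2
  have hinj : Function.Injective c := fun I J h => Subtype.ext <| by rw [← hc I, ← hc J, h]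
  refine Summable.of_norm (((summable_rowForm hℓ hv hv0 hs).comp_injective hinj).congr fun I => ?_)
  have h1 := normRight_rightId_of_ne_zero hm hℓ hv hv0 (hc0 I)
  have hpos := rowForm_pos hℓ hv hv0 (hc0 I)
  rw [← h1] at hpos
  rw [hc] at h1 hpos
  rw [Complex.norm_natCast_cpow_of_pos (by exact_mod_cast hpos), Function.comp_apply, ← h1]
  simp

lemma summable_absNorm (hm : Squarefree m) [IsPrincipalIdealRing (R m)] (hℓ : 0 < ℓ)
    {v : Fin 4 → ℤ} (hv : detForm m v = ℓ) (hv0 : 0 < v 0) {s : ℂ} (hs : 2 < s.re) :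
    Summable fun I : {I : Ideal (𝓞 (K m)) // I ≠ ⊥} => (Ideal.absNorm I.1 : ℂ) ^ (-s) := by
  have hinj : Function.Injective fun I : {I : Ideal (𝓞 (K m)) // I ≠ ⊥} =>
      (![gen hm I.1, 0] : Fin 2 → R m) := fun I J h => Subtype.ext <| by
    rw [← span_gen hm I.1, ← span_gen hm J.1]
    have : gen hm I.1 = gen hm J.1 := congrFun h 0
    rw [this]
  have hv0' : (0 : ℝ) < v 0 := by exact_mod_cast hv0
  refine Summable.of_norm ((((summable_rowForm hℓ hv hv0 hs).comp_injective hinj).mul_left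
    ((v 0 : ℝ) ^ s.re)).congr fun I => ?_)
  have hpos : 0 < Ideal.absNorm I.1 := by
    rw [Nat.pos_iff_ne_zero, Ne, Ideal.absNorm_eq_zero_iff]; exact I.2
  have e : rowForm m v ![gen hm I.1, 0] = v 0 * Ideal.absNorm I.1 := by
    simp [rowForm, norm_gen]
  rw [Complex.norm_natCast_cpow_of_pos hpos, Function.comp_apply, e, Int.cast_mul,
    Int.cast_natCast, Real.mul_rpow hv0'.le (by positivity), ← mul_assoc, ← Real.rpow_add hv0']
  simp

/-- The representation numbers count primitive right ideals of given norm. -/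
lemma repCount_eq_card (hm : Squarefree m) [IsPrincipalIdealRing (R m)] (hℓ : 0 < ℓ)
    {ξ : Fin 4 → ℚ} {U : AddSubgroup (B m ℓ)} {v w : Fin 4 → ℤ} (h : ClassData m ℓ ξ U v w)
    {d : ℕ} (hd : d ≠ 0) :
    repCount m ℓ ξ d = Nat.card {Y // Y ∈ primIds m ℓ w ∧ normRight m ℓ Y = d} := by
  have hd' : (0 : ℤ) < d := by exact_mod_cast Nat.pos_of_ne_zero hd
  have key : ∀ c : Fin 2 → R m, IsCoprime (c 0) (c 1) →
      (normRight m ℓ (rightId m ℓ w c) = d ↔ rowForm m w c = d) := fun c hc => by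
    rw [← normRight_rightId_of_ne_zero hm hℓ h.det' h.pos' (ne_zero_of_isCoprime hc)]
    exact Nat.cast_inj.symm
  rw [h.vec]
  change _ = Nat.card ({Y | Y ∈ primIds m ℓ w ∧ normRight m ℓ Y = d} : Set _)
  rw [Nat.card_coe_set_eq]
  rcases h.conj with rfl | rfl
  · rw [repCount_eq_ncard m ℓ h.det hd (rightId m ℓ w) fun c c' hc hc' =>
      rightId_eq_iff hm h.det (hc ▸ hd') (hc' ▸ hd')]
    congr 1
    ext Y
    constructor
    · rintro ⟨c, ⟨hc, hcd⟩, rfl⟩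
      exact ⟨⟨c, hc, rfl⟩, (key c hc).2 hcd⟩
    · rintro ⟨⟨c, hc, rfl⟩, hcd⟩
      exact ⟨c, ⟨hc, (key c hc).1 hcd⟩, rfl⟩
  · have hstar : ∀ c : Fin 2 → R m, IsCoprime (c 0) (c 1) →
        IsCoprime (star c 0) (star c 1) := fun c hc => hc.map (starRingEnd (R m))
    rw [repCount_eq_ncard m ℓ h.det hd (fun c => rightId m ℓ (conjV m v) (star c))
      fun c c' hc hc' => by
        rw [← SURel_conjV_iff]
        refine rightId_eq_iff hm h.det' ?_ ?_
        · rw [rowForm_conjV, star_star, hc]; exact hd'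
        · rw [rowForm_conjV, star_star, hc']; exact hd']
    congr 1
    ext Y
    constructor
    · rintro ⟨c, ⟨hc, hcd⟩, rfl⟩
      refine ⟨⟨star c, hstar c hc, rfl⟩, (key _ (hstar c hc)).2 ?_⟩
      rw [rowForm_conjV, star_star, hcd]
    · rintro ⟨⟨c, hc, rfl⟩, hcd⟩
      have h1 := (key c hc).1 hcd
      rw [rowForm_conjV] at h1
      exact ⟨star c, ⟨hstar c hc, h1⟩, by simp only [star_star]⟩

lemma hasSum_zetaXi (hm : Squarefree m) [IsPrincipalIdealRing (R m)] (hℓ : 0 < ℓ)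
    {P : Finset ℕ} (hP : ∀ p ∈ P, p.Prime)
    {ξ : Fin 4 → ℚ} {U : AddSubgroup (B m ℓ)} {v w : Fin 4 → ℤ} (h : ClassData m ℓ ξ U v w)
    {s : ℂ} (hs : 2 < s.re) :
    LSeriesSummable (zetaXiCoeff m ℓ P ξ) s ∧
      HasSum (fun Y : {Y | Y ∈ primIds m ℓ w ∧ ∀ p ∈ P, ¬ p ∣ normRight m ℓ Y} =>
        (normRight m ℓ Y.1 : ℂ) ^ (-s)) (zetaXi m ℓ P ξ s) := by
  have hsub : {Y | Y ∈ primIds m ℓ w ∧ ∀ p ∈ P, ¬ p ∣ normRight m ℓ Y} ⊆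
      rightId m ℓ w '' {c | c ≠ 0} := fun Y hY => primIds_subset w hY.1
  refine hasSum_LSeries_of_card_fiber (fun Y => ?_)
    (summable_normRight hm hℓ h.det' h.pos' hsub hs) fun n hn => ?_
  · obtain ⟨c, hc, hY⟩ := hsub Y.2
    have h1 := normRight_rightId_of_ne_zero hm hℓ h.det' h.pos' hc
    have h2 := rowForm_pos hℓ h.det' h.pos' hc
    rw [hY] at h1
    omega
  · have hiff : (∀ p ∈ P, n.Coprime p) ↔ ∀ p ∈ P, ¬ p ∣ n := forall₂_congr fun p hp => by
      rw [Nat.coprime_comm, (hP p hp).coprime_iff_not_dvd]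
    rw [zetaXiCoeff]
    split_ifs with hcop
    · rw [repCount_eq_card hm hℓ h hn]
      congr 1
      refine Nat.card_congr ⟨fun Y => ⟨⟨Y.1, Y.2.1, ?_⟩, Y.2.2⟩, fun Y => ⟨Y.1.1, Y.1.2.1, Y.2⟩,
        fun _ => rfl, fun _ => rfl⟩
      rw [Y.2.2]; exact hiff.1 hcop
    · have : IsEmpty {Y : {Y | Y ∈ primIds m ℓ w ∧ ∀ p ∈ P, ¬ p ∣ normRight m ℓ Y} //
          normRight m ℓ Y.1 = n} := ⟨fun Y => hcop <| hiff.2 <| by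
        have := Y.1.2.2
        rwa [Y.2] at this⟩
      simp

lemma mem_rightIdealsInClass_iff {P : Finset ℕ} {ξ : Fin 4 → ℚ} {U : AddSubgroup (B m ℓ)}
    {v w : Fin 4 → ℤ} (h : ClassData m ℓ ξ U v w) {J : AddSubgroup (B m ℓ)} :
    J ∈ rightIdealsInClass m ℓ P U ↔
      J ∈ rightId m ℓ w '' {c | c ≠ 0} ∧ ∀ p ∈ P, ¬ p ∣ normRight m ℓ J := by
  rw [← h.ideals]
  exact and_assoc.symm

lemma mulId_mem_rightIdealsInClass_iff (hm : Squarefree m) [IsPrincipalIdealRing (R m)]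
    (hℓ : 0 < ℓ) {P : Finset ℕ} (hP : ∀ p ∈ P, p.Prime)
    {ξ : Fin 4 → ℚ} {U : AddSubgroup (B m ℓ)} {v w : Fin 4 → ℤ} (h : ClassData m ℓ ξ U v w)
    {I : Ideal (𝓞 (K m))} {Y : AddSubgroup (B m ℓ)} (hI : I ≠ ⊥) (hY : Y ∈ primIds m ℓ w) :
    mulId hm ℓ I Y ∈ rightIdealsInClass m ℓ P U ↔
      (∀ p ∈ P, ¬ p ∣ Ideal.absNorm I) ∧ ∀ p ∈ P, ¬ p ∣ normRight m ℓ Y := by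
  have h1 : mulId hm ℓ I Y ∈ rightId m ℓ w '' {c | c ≠ 0} := by
    obtain ⟨c, hc, rfl⟩ := hY
    rw [mulId_rightId]
    exact ⟨_, smul_ne_zero (gen_ne_zero hm hI) (ne_zero_of_isCoprime hc), rfl⟩
  rw [mem_rightIdealsInClass_iff h, and_iff_right h1,
    normRight_mulId hm hℓ h.det' h.pos' hI hY, ← forall₂_and]
  refine forall₂_congr fun p hp => ?_
  rw [(hP p hp).dvd_mul, not_or]

/-- Every right ideal in the class is uniquely `h Y` with `(h)` an ideal of `𝒪_K` and `Y`
primitive, and both factors inherit the condition at `𝒫`. -/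
lemma exists_bijective_mulId (hm : Squarefree m) [IsPrincipalIdealRing (R m)]
    (hℓ : 0 < ℓ) {P : Finset ℕ} (hP : ∀ p ∈ P, p.Prime)
    {ξ : Fin 4 → ℚ} {U : AddSubgroup (B m ℓ)} {v w : Fin 4 → ℤ} (h : ClassData m ℓ ξ U v w) :
    ∃ Φ : {I : Ideal (𝓞 (K m)) // I ≠ ⊥ ∧ ∀ p ∈ P, ¬ p ∣ Ideal.absNorm I} ×
      {Y | Y ∈ primIds m ℓ w ∧ ∀ p ∈ P, ¬ p ∣ normRight m ℓ Y} → rightIdealsInClass m ℓ P U,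
      Function.Bijective Φ ∧ ∀ x, (Φ x).1 = mulId hm ℓ x.1.1 x.2.1 := by
  refine ⟨fun x => ⟨mulId hm ℓ x.1.1 x.2.1,
    (mulId_mem_rightIdealsInClass_iff hm hℓ hP h x.1.2.1 x.2.2.1).2 ⟨x.1.2.2, x.2.2.2⟩⟩,
    ⟨?_, ?_⟩, fun _ => rfl⟩
  · rintro ⟨I, Y⟩ ⟨I', Y'⟩ he
    obtain ⟨h1, h2⟩ := mulId_injective hm hℓ h.det' h.pos' I.2.1 I'.2.1 Y.2.1 Y'.2.1
      (congrArg Subtype.val he)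
    exact Prod.ext (Subtype.ext h1) (Subtype.ext h2)
  · rintro ⟨J, hJ⟩
    obtain ⟨I, hI, Y, hY, rfl⟩ := exists_mulId_eq hm ((mem_rightIdealsInClass_iff h).1 hJ).1
    have h2 := (mulId_mem_rightIdealsInClass_iff hm hℓ hP h hI hY).1 hJ
    exact ⟨⟨⟨I, hI, h2.1⟩, ⟨Y, hY, h2.2⟩⟩, rfl⟩

lemma hasSum_zetaK (hm : Squarefree m) [IsPrincipalIdealRing (R m)] (hℓ : 0 < ℓ)
    {P : Finset ℕ} (hP : ∀ p ∈ P, p.Prime) {v : Fin 4 → ℤ} (hv : detForm m v = ℓ) (hv0 : 0 < v 0)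
    {s : ℂ} (hs : 2 < s.re) :
    HasSum (fun I : {I : Ideal (𝓞 (K m)) // I ≠ ⊥ ∧ ∀ p ∈ P, ¬ p ∣ Ideal.absNorm I} =>
      (Ideal.absNorm I.1 : ℂ) ^ (-s)) (zetaK m P s) :=
  hasSum_dedekindZeta_mul_prod hP (summable_absNorm hm hℓ hv hv0 hs)

lemma hasSum_zetaHat (hm : Squarefree m) (hK : NumberField.classNumber (K m) = 1) (hℓ : 0 < ℓ)
    {P : Finset ℕ} (hP : ∀ p ∈ P, p.Prime)
    {ξ : Fin 4 → ℚ} {U : AddSubgroup (B m ℓ)} {v w : Fin 4 → ℤ} (h : ClassData m ℓ ξ U v w)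
    {s : ℂ} (hs : 2 < s.re) :
    HasSum (fun I : rightIdealsInClass m ℓ P U => (normRight m ℓ I.1 : ℂ) ^ (-s))
      (zetaHat m ℓ P ξ s) := by
  have := isPrincipalIdealRing_R m hm hK
  have hA := hasSum_zetaK hm hℓ hP h.det' h.pos' hs
  have hB := (hasSum_zetaXi hm hℓ hP h hs).2
  obtain ⟨Φ, hΦ, hΦ'⟩ := exists_bijective_mulId hm hℓ hP h
  refine hasSum_of_bijective_mul hA hB hΦ fun x => ?_
  rw [hΦ', normRight_mulId hm hℓ h.det' h.pos' x.1.2.1 x.2.2.1, Nat.cast_mul,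
    Complex.natCast_mul_natCast_cpow]

end Series

end

end HermZeta

theorem mainTheorem5 (m ℓ : ℕ) [NeZero m] (hm : Squarefree m) (hℓ : 0 < ℓ)
    (hK : NumberField.classNumber (HermZeta.K m) = 1)
    (P : Finset ℕ) (hP : ∀ p ∈ P, p.Prime)
    (ξ : Fin 4 → ℚ) (hξ : ξ ∈ HermZeta.primitiveVectors m ℓ) (hξ' : ξ ∈ HermZeta.cone m)
    (U : AddSubgroup (HermZeta.B m ℓ)) (hU : HermZeta.IsLeftIdeal m ℓ U)
    (hUξ : HermZeta.HasNormForm m ℓ U (HermZeta.hermMatrix m ξ) ∨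
      HermZeta.SameLeftClass m ℓ (HermZeta.latimerIdeal m ℓ (HermZeta.hermMatrix m ξ)) U) :
    (∀ I ∈ HermZeta.rightIdealsInClass m ℓ P U,
      0 < HermZeta.normRight m ℓ I ∧
      HermZeta.nrdLattice m ℓ I =
        AddSubgroup.zmultiples (HermZeta.normRight m ℓ I : ℚ)) ∧
    ∀ s : ℂ, 2 < s.re →
      LSeriesSummable (HermZeta.zetaXiCoeff m ℓ P ξ) s ∧
      HasSum (fun I : HermZeta.rightIdealsInClass m ℓ P U =>
          (HermZeta.normRight m ℓ (I : AddSubgroup (HermZeta.B m ℓ)) : ℂ) ^ (-s))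
        (HermZeta.zetaHat m ℓ P ξ s) := by
  obtain ⟨v, w, h⟩ := exists_classData hm hℓ hξ hξ' hU hUξ
  have := isPrincipalIdealRing_R m hm hK
  refine ⟨fun I hI => ?_, fun s hs =>
    ⟨(hasSum_zetaXi hm hℓ hP h hs).1, hasSum_zetaHat hm hK hℓ hP h hs⟩⟩
  obtain ⟨c, hc, rfl⟩ : I ∈ rightId m ℓ w '' {c | c ≠ 0} := by
    rw [← h.ideals]
    exact ⟨hI.1, hI.2.1⟩
  have h1 := normRight_rightId_of_ne_zero hm hℓ h.det' h.pos' hc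
  have h2 := rowForm_pos hℓ h.det' h.pos' hc
  refine ⟨by omega, ?_⟩
  rw [nrdLattice_rightId hm h c, ← h1, Int.cast_natCast]
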